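/- Conventions. Inputs are binary strings. A function $f:\mathbb Z_{\ge 0}\to\mathbb Z_{>0}$ is called polynomially bounded if a polynomial-time deterministic Turing machine outputs $1^{f(n)}$ on input $1^n$. A function $f:\mathbb Z_{\ge 0}\to[0,1]$ is polynomial-time computable if a polynomial-time deterministic Turing machine computes from $(1^n,1^k)$ a nonnegative integer $a$ with $|a/2^k-f(n)|\le 2^{-k}$. Fix any finite set of quantum gates with which the Hadamard transformation and all classical reversible transformations can be implemented exactly (up to a global phase, using ancilla qubits that start and end in $|0\rangle$). For polynomially bounded $m$, an $m$-message polynomial-time quantum verifier $V$ is a polynomial-time computable map taking each input $x$ to a description of quantum circuits $V_{x,1},\dots,V_{x,\lceil (m(|x|)+1)/2\rceil}$ over this gate set, acting on common qubits, together with a partition of these qubits into a private register $\mathsf V$ and a message register $\mathsf M$, and a designated output qubit in $\mathsf V$. An $m$-message quantum prover $P$ has, on input $x$, a finite private register $\mathsf P$ of qubits and arbitrary unitary transformations $P_{x,1},\dots,P_{x,\lfloor (m(|x|)+1)/2\rfloor}$ on $(\mathsf M,\mathsf P)$. The qubits in $(\mathsf V,\mathsf M)$ start in $|0\rangle$, and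 $\mathsf P$ starts in an arbitrary density operator $\rho$ (the initial state of $P$). The transformations are applied alternately, ending with the verifier's last one: in the order $P_{x,1},V_{x,1},P_{x,2},V_{x,2},\dots$ if $m(|x|)$ is odd, and $V_{x,1},P_{x,1},V_{x,2},P_{x,2},\dots$ if $m(|x|)$ is even. Then the output qubit is measured in the standard basis, and $V$ accepts $x$ if the outcome is $1$. A promise problem is a pair $A=(A_{\rm yes},A_{\rm no})$ of disjoint sets of binary strings. It is in $\mathrm{QIP}(m,c,s)$ if there is an $m$-message polynomial-time quantum verifier $V$ such that, for every input $x$: if $x\in A_{\rm yes}$, some prover with some initial state makes $V$ accept $x$ with probability at least $c(|x|)$; and if $x\in A_{\rm no}$, every prover with every initial state makes $V$ accept $x$ with probability at most $s(|x|)$. For $s<\frac12$, the problem $A$ has a perfectly rewindable $m$-message quantum interactive proof system with soundness $s$ if there is an $m$-message polynomial-time quantum verifier $V$ such that, for every input $x$: if $x\in A_{\rm yes}$, there is a prover $P$ (its transformations being fixed) such that the maximum, over all initial states $\rho$ of $P$, of the probability that $V$ accepts $x$ is exactly $\frac12$; and if $x\in A_{\rm no}$, every prover with every initial state makes $V$ accept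 $x$ with probability at most $s(|x|)$. Lemma. Let $m:\mathbb Z_{\ge 0}\to\mathbb Z_{>0}$ be polynomially bounded and let $c,s:\mathbb Z_{\ge 0}\to[0,1]$ be polynomial-time computable functions with $c(n)-s(n)\ge 1/p(n)$ for all $n$, for some polynomially bounded $p:\mathbb Z_{\ge 0}\to\mathbb Z_{>0}$. Then every promise problem in $\mathrm{QIP}(m,c,s)$ has a perfectly rewindable $m$-message quantum interactive proof system with soundness $\frac12-\frac{c-s}{4}$. -/

import Mathlib

namespace QuantumIP

/-! ### Polynomial-time computability

All notions are in terms of Mathlib's polynomial-time deterministic (multi-stack) Turing machines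
`Turing.TM2ComputableInPolyTime`. -/

/-- `f : ℤ_{≥0} → ℤ_{>0}` is polynomially bounded: some polynomial-time deterministic Turing machine
outputs `1^{f n}` on input `1^n`. -/
def PolynomiallyBounded (f : ℕ → ℕ) : Prop :=
  (∀ n, 0 < f n) ∧
    Nonempty (Turing.TM2ComputableInPolyTime
      Computability.unaryEncodeNat Computability.unaryEncodeNat f)

/-- The pair `(1^n, 1^k)`, written as the bit string `1^n 0 1^k`. -/
def unaryPair (a : ℕ × ℕ) : List Bool :=
  Computability.unaryEncodeNat a.1 ++ false :: Computability.unaryEncodeNat a.2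

/-- Polynomial-time computability of a real-valued function `f : ℤ_{≥0} → [0,1]`: on input
`(1^n, 1^k)` one can compute in polynomial time (the binary expansion of) a natural number `a` with
`|a / 2^k - f n| ≤ 2^{-k}`. In particular this covers every `f` whose values are rational numbers
that can be written down exactly in polynomial time. -/
def PolyTimeComputableReal (f : ℕ → ℝ) : Prop :=
  ∃ a : ℕ × ℕ → ℕ,
    Nonempty (Turing.TM2ComputableInPolyTime unaryPair Computability.encodeNat a) ∧
      ∀ n k : ℕ, |(a (n, k) : ℝ) / 2 ^ k - f n| ≤ 1 / 2 ^ k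

/-! ### Operators on qubits

A register is a finite type `ι` of qubits; its standard basis is `ι → Bool`, and an operator on it
is a matrix indexed by `ι → Bool`. -/

/-- Operators on the Hilbert space of the qubits `ι`. -/
abbrev Op (ι : Type) : Type := Matrix (ι → Bool) (ι → Bool) ℂ

/-- The operator which applies `U` to the qubits in the image of `w` (in the order given by `w`) and
the identity to all the other qubits. -/
def onQubits {κ ι : Type} [Fintype κ] [Fintype ι] [DecidableEq ι] (w : κ ↪ ι) (U : Op κ) : Op ι :=
  Matrix.of fun x y =>
    if ∀ i, (∀ k, w k ≠ i) → x i = y i then U (fun k => x (w k)) (fun k => y (w k)) else 0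

/-- The Hadamard operator on one qubit. -/
noncomputable def hadamard : Op (Fin 1) :=
  Matrix.of fun x y => (if x 0 && y 0 then -1 else 1) / (Real.sqrt 2 : ℂ)

/-- The operator `|y⟩ ↦ |σ y⟩` of a classical reversible transformation `σ`. -/
def classicalOp {ι : Type} [Fintype ι] [DecidableEq ι] (σ : Equiv.Perm (ι → Bool)) : Op ι :=
  Matrix.of fun x y => if x = σ y then 1 else 0

/-! ### Gate sets and circuits -/

/-- A finite set of quantum gates, each a unitary operator on finitely many qubits. -/
structure GateSet where
  size : ℕ
  arity : Fin size → ℕ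
  gate : (g : Fin size) → Matrix.unitaryGroup (Fin (arity g) → Bool) ℂ

/-- An application of a gate to distinct qubits among `ι`. -/
structure GateApp (G : GateSet) (ι : Type) where
  name : Fin G.size
  wires : Fin (G.arity name) ↪ ι

/-- A quantum circuit over the gate set `G` on the qubits `ι`; the head is the first gate applied. -/
abbrev Circuit (G : GateSet) (ι : Type) : Type := List (GateApp G ι)

section
variable {G : GateSet} {ι : Type} [Fintype ι] [DecidableEq ι]

/-- The operator of a single gate application. -/
def GateApp.op (a : GateApp G ι) : Op ι :=
  onQubits a.wires (G.gate a.name : Op (Fin (G.arity a.name)))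

/-- The unitary operator induced by a circuit. -/
def circuitOp : Circuit G ι → Op ι
  | [] => 1
  | a :: C => circuitOp C * a.op

end

/-- The operator `U` on `k` qubits is exactly implementable with the gate set `G`: for some number
`a` of ancilla qubits, some circuit over `G` maps `|y⟩|0^a⟩` to `ζ (U|y⟩)|0^a⟩` for all `y`, where
`ζ` is a global phase. -/
def ExactlyImplementable (G : GateSet) {k : ℕ} (U : Op (Fin k)) : Prop :=
  ∃ (a : ℕ) (C : Circuit G (Fin k ⊕ Fin a)) (ζ : ℂ), ‖ζ‖ = 1 ∧
    ∀ (x y : Fin k → Bool) (u : Fin a → Bool),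
      circuitOp C (Sum.elim x u) (Sum.elim y fun _ => false) =
        if u = (fun _ => false) then ζ * U x y else 0

/-- The assumption on the gate set: the Hadamard transformation and all classical reversible
transformations are exactly implementable. -/
def Admissible (G : GateSet) : Prop :=
  ExactlyImplementable G hadamard ∧
    ∀ (k : ℕ) (σ : Equiv.Perm (Fin k → Bool)), ExactlyImplementable G (classicalOp σ)

/-! ### Verifiers -/

/-- The qubits of a verifier with `v` private qubits (register `V`) and `q` message qubits
(register `M`). -/
abbrev VerifierQubits (v q : ℕ) : Type := Fin v ⊕ Fin q

/-- What a verifier's description string describes: the partition of the qubits into the registers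
`V` and `M`, the output qubit (in `V`), and a series of circuits acting on `(V, M)`. -/
structure VerifierDescription (G : GateSet) where
  privateQubits : ℕ
  messageQubits : ℕ
  output : Fin privateQubits
  circuits : List (Circuit G (VerifierQubits privateQubits messageQubits))

/-- The finite alphabet in which verifiers are described. -/
inductive Token (G : GateSet) where
  | one : Token G
  | priv : Token G
  | msg : Token G
  | gate : Fin G.size → Token G
  | circuit : Token G
  deriving DecidableEq, Fintype

section
variable {G : GateSet}

/-- The natural number `n` in unary. -/
def encodeUnary (n : ℕ) : List (Token G) := List.replicate n Token.one

/-- A qubit is described by its register and its index (in unary) therein. -/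
def encodeQubit {v q : ℕ} : VerifierQubits v q → List (Token G)
  | Sum.inl i => Token.priv :: encodeUnary i
  | Sum.inr j => Token.msg :: encodeUnary j

/-- A gate application is described by the gate and the qubits to which it is applied. -/
def encodeGateApp {v q : ℕ} (a : GateApp G (VerifierQubits v q)) : List (Token G) :=
  Token.gate a.name :: (List.ofFn a.wires).flatMap encodeQubit

/-- A circuit is described by its list of gate applications. -/
def encodeCircuit {v q : ℕ} (C : Circuit G (VerifierQubits v q)) : List (Token G) :=
  Token.circuit :: C.flatMap encodeGateApp

/-- The description string; its length is at least the number of qubits and of gates. -/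
def encodeDescription (D : VerifierDescription G) : List (Token G) :=
  Token.priv :: encodeUnary D.privateQubits ++ Token.msg :: encodeUnary D.messageQubits ++
    Token.priv :: encodeUnary D.output ++ D.circuits.flatMap encodeCircuit

end

section
variable {G : GateSet}

theorem encodeUnary_append_inj {a b : ℕ} {t t' : Token G} {l l' : List (Token G)}
    (ht : t ≠ Token.one) (ht' : t' ≠ Token.one)
    (h : encodeUnary a ++ t :: l = encodeUnary b ++ t' :: l') :
    a = b ∧ t :: l = t' :: l' := by
  induction a generalizing b with
  | zero =>
    cases b with
    | zero => exact ⟨rfl, by simpa [encodeUnary] using h⟩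
    | succ b =>
      simp only [encodeUnary, List.replicate_succ, List.replicate_zero, List.nil_append,
        List.cons_append, List.cons.injEq] at h
      exact absurd h.1 ht
  | succ a ih =>
    cases b with
    | zero =>
      simp only [encodeUnary, List.replicate_succ, List.replicate_zero, List.nil_append,
        List.cons_append, List.cons.injEq] at h
      exact absurd h.1.symm ht'
    | succ b =>
      simp only [encodeUnary, List.replicate_succ, List.cons_append, List.cons.injEq,
        true_and] at h
      obtain ⟨h1, h2⟩ := ih h
      exact ⟨by rw [h1], h2⟩

theorem encodeQubit_append_inj {v q : ℕ} {i j : VerifierQubits v q} {t t' : Token G}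
    {l l' : List (Token G)} (ht : t ≠ Token.one) (ht' : t' ≠ Token.one)
    (h : encodeQubit i ++ t :: l = encodeQubit j ++ t' :: l') :
    i = j ∧ t :: l = t' :: l' := by
  rcases i with i | i <;> rcases j with j | j <;>
    simp only [encodeQubit, List.cons_append, List.cons.injEq, reduceCtorEq, true_and,
      false_and] at h <;>
  · obtain ⟨h1, h2⟩ := encodeUnary_append_inj ht ht' h
    exact ⟨by rw [Fin.ext h1], h2⟩

theorem encodeQubits_append_inj {v q : ℕ} {w w' : List (VerifierQubits v q)} {t t' : Token G}
    {l l' : List (Token G)} (hw : w.length = w'.length) (ht : t ≠ Token.one)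
    (ht' : t' ≠ Token.one)
    (h : w.flatMap encodeQubit ++ t :: l = w'.flatMap encodeQubit ++ t' :: l') :
    w = w' ∧ t :: l = t' :: l' := by
  have key : ∀ (w : List (VerifierQubits v q)) (t : Token G) (l : List (Token G)),
      t ≠ Token.one → ∃ t₁ l₁, w.flatMap encodeQubit ++ t :: l = t₁ :: l₁ ∧ t₁ ≠ Token.one := by
    intro w t l ht
    rcases w with _ | ⟨(i | i), w⟩
    · exact ⟨t, l, rfl, ht⟩
    · exact ⟨Token.priv, _, rfl, by simp⟩
    · exact ⟨Token.msg, _, rfl, by simp⟩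
  induction w generalizing w' with
  | nil =>
    cases w' with
    | nil => exact ⟨rfl, by simpa using h⟩
    | cons j w' => simp at hw
  | cons i w ih =>
    cases w' with
    | nil => simp at hw
    | cons j w' =>
      simp only [List.flatMap_cons, List.append_assoc] at h
      obtain ⟨t₁, l₁, e₁, n₁⟩ := key w t l ht
      obtain ⟨t₂, l₂, e₂, n₂⟩ := key w' t' l' ht'
      rw [e₁, e₂] at h
      obtain ⟨h1, h2⟩ := encodeQubit_append_inj n₁ n₂ h
      rw [← e₁, ← e₂] at h2
      obtain ⟨h3, h4⟩ := ih (by simpa using hw) h2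
      exact ⟨by rw [h1, h3], h4⟩

theorem encodeGateApp_append_inj {v q : ℕ} {a b : GateApp G (VerifierQubits v q)}
    {t t' : Token G} {l l' : List (Token G)} (ht : t ≠ Token.one) (ht' : t' ≠ Token.one)
    (h : encodeGateApp a ++ t :: l = encodeGateApp b ++ t' :: l') :
    a = b ∧ t :: l = t' :: l' := by
  obtain ⟨g, w⟩ := a
  obtain ⟨g', w'⟩ := b
  simp only [encodeGateApp, List.cons_append, List.cons.injEq, Token.gate.injEq] at h
  obtain ⟨rfl, h⟩ := h
  obtain ⟨h1, h2⟩ := encodeQubits_append_inj (by simp) ht ht' h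
  have h3 : w = w' := DFunLike.coe_injective (List.ofFn_injective h1)
  exact ⟨by rw [h3], h2⟩

theorem encodeGates_append_inj {v q : ℕ} {C C' : Circuit G (VerifierQubits v q)}
    {l l' : List (Token G)}
    (h : C.flatMap encodeGateApp ++ Token.circuit :: l =
      C'.flatMap encodeGateApp ++ Token.circuit :: l') :
    C = C' ∧ l = l' := by
  have key : ∀ (C : Circuit G (VerifierQubits v q)) (l : List (Token G)),
      ∃ t₁ l₁, C.flatMap encodeGateApp ++ Token.circuit :: l = t₁ :: l₁ ∧ t₁ ≠ Token.one := by
    intro C l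
    rcases C with _ | ⟨a, C⟩
    · exact ⟨Token.circuit, l, rfl, by simp⟩
    · exact ⟨Token.gate a.name, _, rfl, by simp⟩
  induction C generalizing C' with
  | nil =>
    cases C' with
    | nil => exact ⟨rfl, by simpa using h⟩
    | cons b C' => simp [encodeGateApp] at h
  | cons a C ih =>
    cases C' with
    | nil => simp [encodeGateApp] at h
    | cons b C' =>
      simp only [List.flatMap_cons, List.append_assoc] at h
      obtain ⟨t₁, l₁, e₁, n₁⟩ := key C l
      obtain ⟨t₂, l₂, e₂, n₂⟩ := key C' l'
      rw [e₁, e₂] at h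
      obtain ⟨h1, h2⟩ := encodeGateApp_append_inj n₁ n₂ h
      rw [← e₁, ← e₂] at h2
      obtain ⟨h3, h4⟩ := ih h2
      exact ⟨by rw [h1, h3], h4⟩

theorem encodeCircuits_inj {v q : ℕ} {L L' : List (Circuit G (VerifierQubits v q))}
    (h : L.flatMap encodeCircuit ++ [Token.circuit] =
      L'.flatMap encodeCircuit ++ [Token.circuit]) : L = L' := by
  have key : ∀ L : List (Circuit G (VerifierQubits v q)),
      ∃ l₁, L.flatMap encodeCircuit ++ [Token.circuit] = (Token.circuit : Token G) :: l₁ := by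
    intro L
    rcases L with _ | ⟨C, L⟩
    · exact ⟨[], rfl⟩
    · exact ⟨_, rfl⟩
  induction L generalizing L' with
  | nil =>
    cases L' with
    | nil => rfl
    | cons C' L' =>
      have := congrArg List.length h
      simp [encodeCircuit] at this
  | cons C L ih =>
    cases L' with
    | nil =>
      have := congrArg List.length h
      simp [encodeCircuit] at this
    | cons C' L' =>
      simp only [List.flatMap_cons, List.append_assoc, encodeCircuit, List.cons_append,
        List.cons.injEq, true_and] at h
      obtain ⟨l₁, e₁⟩ := key L
      obtain ⟨l₂, e₂⟩ := key L'
      rw [e₁, e₂] at h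
      obtain ⟨h1, h2⟩ := encodeGates_append_inj h
      have h3 : L = L' := ih (by rw [e₁, e₂, h2])
      rw [h1, h3]

/-- A description string determines what it describes. -/
theorem encodeDescription_injective :
    Function.Injective (encodeDescription : VerifierDescription G → List (Token G)) := by
  rintro ⟨v, q, o, L⟩ ⟨v', q', o', L'⟩ h
  have h' := congrArg (fun l => l ++ [(Token.circuit : Token G)]) h
  simp only [encodeDescription, List.append_assoc, List.cons_append, List.cons.injEq,
    true_and] at h'
  obtain ⟨rfl, h1⟩ := encodeUnary_append_inj (by simp) (by simp) h'
  simp only [List.cons.injEq, true_and] at h1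
  obtain ⟨rfl, h2⟩ := encodeUnary_append_inj (by simp) (by simp) h1
  simp only [List.cons.injEq, true_and] at h2
  have key : ∀ L : List (Circuit G (VerifierQubits v q)),
      ∃ l₁, L.flatMap encodeCircuit ++ [Token.circuit] = (Token.circuit : Token G) :: l₁ := by
    intro L
    rcases L with _ | ⟨C, L⟩
    · exact ⟨[], rfl⟩
    · exact ⟨_, rfl⟩
  obtain ⟨l₁, e₁⟩ := key L
  obtain ⟨l₂, e₂⟩ := key L'
  rw [e₁, e₂] at h2
  obtain ⟨h3, h4⟩ := encodeUnary_append_inj (by simp) (by simp) h2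
  rw [← e₁, ← e₂] at h4
  rw [encodeCircuits_inj h4, Fin.ext h3]

end

/-- An `m`-message polynomial-time quantum verifier: a polynomial-time computable map which takes
every input `x` to the description of `⌈(m(|x|)+1)/2⌉ = ⌊m(|x|)/2⌋ + 1` circuits, of the registers
`V`, `M`, and of the output qubit. -/
structure Verifier (G : GateSet) (m : ℕ → ℕ) where
  describe : List Bool → VerifierDescription G
  polyTime : Nonempty (Turing.TM2ComputableInPolyTime
    (id : List Bool → List Bool) encodeDescription describe)
  length_circuits : ∀ x, (describe x).circuits.length = m x.length / 2 + 1

/-! ### Provers and the interaction -/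

/-- A prover, at a fixed input, with message register `M` of `q` qubits: a private register `P` of
some number of qubits, and the unitary transformations applied to `(M, P)`. In a system with `m`
messages the prover has `⌊(m+1)/2⌋` turns, and only the first so many transformations are used. -/
structure Prover (q : ℕ) where
  privateQubits : ℕ
  turn : ℕ → Matrix.unitaryGroup (Fin q ⊕ Fin privateQubits → Bool) ℂ

/-- Density operators on the qubits `ι`. -/
def IsDensity {ι : Type} [Fintype ι] [DecidableEq ι] (ρ : Op ι) : Prop :=
  open ComplexOrder in ρ.PosSemidef ∧ ρ.trace = 1

section
variable {G : GateSet} (D : VerifierDescription G) (P : Prover D.messageQubits)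

/-- All the qubits of `((V, M), P)`. -/
abbrev TotalQubits : Type :=
  VerifierQubits D.privateQubits D.messageQubits ⊕ Fin P.privateQubits

/-- The verifier's transformation number `j` (from `0`), tensored with the identity on `P`. -/
def verifierOp (j : ℕ) : Op (TotalQubits D P) :=
  onQubits Function.Embedding.inl (circuitOp (D.circuits.getD j []))

/-- The prover's transformation number `j` (from `0`), tensored with the identity on `V`. -/
def proverOp (j : ℕ) : Op (TotalQubits D P) :=
  onQubits (Function.Embedding.sumMap Function.Embedding.inr (Function.Embedding.refl _))
    (P.turn j : Op (Fin D.messageQubits ⊕ Fin P.privateQubits))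

/-- The transformation up to and including the verifier's action following the `j`-th turn of the
prover, in a system with `m` messages: the prover has the first turn if `m` is odd, and the verifier
if `m` is even. -/
def partialOp (m : ℕ) : ℕ → Op (TotalQubits D P)
  | 0 => if Even m then verifierOp D P 0 else 1
  | j + 1 => verifierOp D P (if Even m then j + 1 else j) * proverOp D P j * partialOp m j

/-- The transformation `Q_x` of the whole `m`-message protocol:
`V_{(m+1)/2} P_{(m+1)/2} ⋯ V_1 P_1` if `m` is odd, and
`V_{m/2+1} P_{m/2} V_{m/2} ⋯ P_1 V_1` if `m` is even. -/
def protocolOp (m : ℕ) : Op (TotalQubits D P) := partialOp D P m ((m + 1) / 2)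

/-- The initial state `|0⟩⟨0|_{(V,M)} ⊗ ρ`. -/
def initialState (ρ : Op (Fin P.privateQubits)) : Op (TotalQubits D P) :=
  Matrix.of fun x y =>
    if (∀ i, x (Sum.inl i) = false) ∧ (∀ i, y (Sum.inl i) = false) then
      ρ (fun k => x (Sum.inr k)) (fun k => y (Sum.inr k))
    else 0

/-- The probability that measuring the output qubit at the end of the `m`-message protocol yields
`1`, when the prover's initial state is `ρ`. -/
def acceptProb (m : ℕ) (ρ : Op (Fin P.privateQubits)) : ℝ :=
  (∑ z : TotalQubits D P → Bool, if z (Sum.inl (Sum.inl D.output)) = true then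
    (protocolOp D P m * initialState D P ρ * (protocolOp D P m).conjTranspose) z z else 0).re

end

/-! ### Proof systems -/

/-- A promise problem over the binary alphabet. -/
structure PromiseProblem where
  yes : Set (List Bool)
  no : Set (List Bool)
  disjoint : Disjoint yes no

/-- On input `x`, every prover with every initial state makes `V` accept with probability at
most `s`. -/
def SoundAt {G : GateSet} {m : ℕ → ℕ} (V : Verifier G m) (x : List Bool) (s : ℝ) : Prop :=
  ∀ (P : Prover (V.describe x).messageQubits) (ρ : Op (Fin P.privateQubits)), IsDensity ρ →
    acceptProb (V.describe x) P (m x.length) ρ ≤ s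

/-- The class `QIP(m, c, s)`. -/
def QIP (G : GateSet) (m : ℕ → ℕ) (c s : ℕ → ℝ) : Set PromiseProblem :=
  {A | ∃ V : Verifier G m, ∀ x : List Bool,
    (x ∈ A.yes → ∃ (P : Prover (V.describe x).messageQubits) (ρ : Op (Fin P.privateQubits)),
      IsDensity ρ ∧ c x.length ≤ acceptProb (V.describe x) P (m x.length) ρ) ∧
    (x ∈ A.no → SoundAt V x (s x.length))}

/-- `A` has a perfectly rewindable `m`-message quantum interactive proof system with soundness `s`
(where `s < 1/2`): on yes-instances there is a prover for which the maximum, over its initial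
states, of the acceptance probability is exactly `1/2`. -/
def HasPerfectlyRewindableProofSystem (G : GateSet) (m : ℕ → ℕ) (s : ℕ → ℝ)
    (A : PromiseProblem) : Prop :=
  (∀ n, 0 ≤ s n ∧ s n < 1 / 2) ∧
  ∃ V : Verifier G m, ∀ x : List Bool,
    (x ∈ A.yes → ∃ P : Prover (V.describe x).messageQubits,
      IsGreatest {p : ℝ | ∃ ρ : Op (Fin P.privateQubits), IsDensity ρ ∧
        p = acceptProb (V.describe x) P (m x.length) ρ} (1 / 2)) ∧
    (x ∈ A.no → SoundAt V x (s x.length))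

end QuantumIP

open QuantumIP

/-! Let the new verifier run the old one and then toss a fair coin. On one outcome it accepts iff
the old verifier would; on the other it accepts with an independent probability t, chosen equal to 1
- c or slightly larger. A prover that convinces the old verifier with probability p now succeeds
with probability (p + t)/2. On a yes-instance some prover has optimal p ≥ c, so this is at least
1/2; on a no-instance it is at most (s + t)/2, which would be 1/2 - (c - s)/2 for t = 1 - c. Half of
this margin pays for the rounding of t (`testBias_bounds`, `soundness_bound`).

To come down to exactly 1/2, the message register receives one more qubit, a flag whose value 1
makes the verifier reject. At the start of its first turn the honest prover takes the flag to a|0⟩ +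
b|1⟩ with a² = 1/(p + t). Nothing else touches the flag before the final test, so the acceptance
probability is multiplied by a² whatever the initial state (`pureProb_rotateProver`). With p the
maximum over initial states, which is attained by compactness (`exists_optimal`), the new maximum is
1/2 (`exists_isGreatest_acceptProb`). The prover is unbounded, so p need not be computable. A
cheating prover gains nothing from the flag: a prover of the old system can keep it as a private
qubit, and raising it only causes rejection (`pureProb_extendVerifier_le`,
`acceptProb_extendVerifier_le`).

The coin and the event of probability t must be realized exactly by Hadamard and classical
reversible gates. Hence t is dyadic: a random number, made of qubits in Hadamard states, is compared
digit by digit with a threshold computed from c (`weight_test`, `testProb_cons`).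

It remains to write down the new verifier in polynomial time. Maps to strings computed by stack
machines are closed under composition and pairing (`PolyTime.comp`, `PolyTime.pair`), one-pass
transducers with unary counters run in polynomial time (`polyTime_transducer`), and such a
transducer turns the old description and the digits of the threshold into the new description
(`output_descriptionTransducer`). -/

namespace QuantumIP

/-! ### Stack machines: runs, output growth, subroutines, moves. -/

open Turing StateTransition
open Turing.TM2 (Stmt Cfg stepAux)

/-! ### Runs of stack machines -/

section Runs
variable {C : Type*} {f : C → Option C} {a b c : C} {n n' : ℕ}

/-- The partial map `f` leads from `a` to `b` in at most `n` steps. -/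
def RunsWithin (f : C → Option C) (n : ℕ) (a b : C) : Prop :=
  ∃ t ≤ n, (flip bind f)^[t] (some a) = some b

theorem RunsWithin.refl : RunsWithin f n a a := ⟨0, Nat.zero_le _, rfl⟩

theorem RunsWithin.trans (h : RunsWithin f n a b) (h' : RunsWithin f n' b c) :
    RunsWithin f (n + n') a c := by
  obtain ⟨t, ht, e⟩ := h
  obtain ⟨t', ht', e'⟩ := h'
  exact ⟨t' + t, by omega, by rw [Function.iterate_add_apply, e, e']⟩

theorem RunsWithin.mono (h : RunsWithin f n a b) (hn : n ≤ n') : RunsWithin f n' a b := by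
  obtain ⟨t, ht, e⟩ := h
  exact ⟨t, ht.trans hn, e⟩

theorem RunsWithin.congr_left (h : a = b) (h' : RunsWithin f n b c) : RunsWithin f n a c :=
  h ▸ h'

theorem RunsWithin.congr_right (h : RunsWithin f n a b) (h' : b = c) : RunsWithin f n a c :=
  h' ▸ h

theorem RunsWithin.single (h : f a = some b) : RunsWithin f 1 a b :=
  ⟨1, le_rfl, h⟩

theorem RunsWithin.single_congr {b' : C} (e : b' = b) (h : f a = some b') : RunsWithin f 1 a b :=
  RunsWithin.single (h.trans (congrArg some e))

theorem RunsWithin.head (h : f a = some b) (h' : RunsWithin f n b c) :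
    RunsWithin f (n + 1) a c :=
  ((RunsWithin.single h).trans h').mono (by omega)

theorem RunsWithin.map {C' : Type*} {f' : C' → Option C'} (φ : C → C')
    (hφ : ∀ x y, f x = some y → f' (φ x) = some (φ y)) (h : RunsWithin f n a b) :
    RunsWithin f' n (φ a) (φ b) := by
  obtain ⟨t, ht, e⟩ := h
  refine ⟨t, ht, ?_⟩
  clear ht
  induction t generalizing a with
  | zero =>
    have : a = b := by simpa using e
    simp [this]
  | succ t ih =>
    rw [Function.iterate_succ_apply] at e ⊢
    change (flip bind f)^[t] (f a) = some b at e
    change (flip bind f')^[t] (f' (φ a)) = some (φ b)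
    cases hfa : f a with
    | none =>
      rw [hfa] at e
      exfalso
      -- Once undefined, the iteration stays undefined, so a run that ends in a configuration never
      -- passes through `none`.
      have : ∀ t, (flip bind f)^[t] none = none := by
        intro t
        induction t with
        | zero => rfl
        | succ t ih => rw [Function.iterate_succ_apply]; exact ih
      rw [this] at e
      cases e
    | some y =>
      rw [hfa] at e
      rw [hφ a y hfa]
      exact ih e

end Runs

theorem initList_eq (tm : FinTM2) (s : List (tm.Γ tm.k₀)) :
    initList tm s = ⟨some tm.main, tm.initialState,
      Function.update (fun _ => []) tm.k₀ s⟩ := by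
  unfold initList
  congr 1
  funext k
  by_cases h : k = tm.k₀
  · subst h; simp
  · simp [h]

/-- Halting with an output requires the initial internal state and empty stacks apart from the
output. All machines below have to clean up accordingly. -/
theorem haltList_eq (tm : FinTM2) (s : List (tm.Γ tm.k₁)) :
    haltList tm s = ⟨none, tm.initialState, Function.update (fun _ => []) tm.k₁ s⟩ := by
  unfold haltList
  congr 1
  funext k
  by_cases h : k = tm.k₁
  · subst h; simp
  · simp [h]

/-! ### Growth of the stacks -/

section Growth
variable {K : Type} [DecidableEq K] [Fintype K] {Γ : K → Type} {Λ σ : Type}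

/-- The largest number of symbols which a statement can push. -/
def maxPushes : Stmt Γ Λ σ → ℕ
  | .push _ _ q => maxPushes q + 1
  | .peek _ _ q => maxPushes q
  | .pop _ _ q => maxPushes q
  | .load _ q => maxPushes q
  | .branch _ q q' => maxPushes q + maxPushes q'
  | .goto _ => 0
  | .halt => 0

/-- The total size of all stacks. -/
def stackSize (S : ∀ k, List (Γ k)) : ℕ := ∑ k, (S k).length

theorem stackSize_update (S : ∀ k, List (Γ k)) (k : K) (l : List (Γ k)) :
    stackSize (Function.update S k l) + (S k).length = stackSize S + l.length := by
  unfold stackSize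
  rw [← Finset.add_sum_erase _ _ (Finset.mem_univ k),
    ← Finset.add_sum_erase Finset.univ (fun k => (S k).length) (Finset.mem_univ k)]
  have : ∑ x ∈ Finset.univ.erase k, (Function.update S k l x).length
      = ∑ x ∈ Finset.univ.erase k, (S x).length :=
    Finset.sum_congr rfl fun x hx => by
      rw [Function.update_of_ne (Finset.ne_of_mem_erase hx)]
  rw [this]
  simp only [Function.update_self]
  omega

theorem stackSize_stepAux (q : Stmt Γ Λ σ) (v : σ) (S : ∀ k, List (Γ k)) :
    stackSize (stepAux q v S).stk ≤ stackSize S + maxPushes q := by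
  induction q generalizing v S with
  | push k f q ih =>
    have h := stackSize_update S k (f v :: S k)
    have h' := ih v (Function.update S k (f v :: S k))
    simp only [List.length_cons, stepAux, maxPushes] at *
    omega
  | peek k f q ih => exact ih _ _
  | pop k f q ih =>
    have h := stackSize_update S k (S k).tail
    have h' := ih (f v (S k).head?) (Function.update S k (S k).tail)
    simp only [List.length_tail, stepAux, maxPushes] at *
    omega
  | load f q ih => exact ih _ _
  | branch f q q' ih ih' =>
    simp only [stepAux, maxPushes]
    cases f v
    · exact (ih' _ _).trans (by omega)
    · exact (ih _ _).trans (by omega)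
  | goto f => simp [stepAux]
  | halt => simp [stepAux]

/-- A single step executes the whole statement of a label and may push several symbols, but
boundedly many; so the stacks grow at most linearly with time. -/
theorem stackSize_runs [Fintype Λ] {M : Λ → Stmt Γ Λ σ} {n : ℕ} {a b : Cfg Γ Λ σ}
    (h : RunsWithin (TM2.step M) n a b) :
    stackSize b.stk ≤ stackSize a.stk + n * ∑ l, maxPushes (M l) := by
  obtain ⟨t, ht, e⟩ := h
  suffices stackSize b.stk ≤ stackSize a.stk + t * ∑ l, maxPushes (M l) from
    this.trans (by gcongr)
  clear ht
  induction t generalizing b with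
  | zero =>
    have : a = b := by simpa using e
    simp [this]
  | succ t ih =>
    rw [Function.iterate_succ_apply'] at e
    cases hc : (flip bind (TM2.step M))^[t] (some a) with
    | none => rw [hc] at e; cases e
    | some c =>
      rw [hc] at e
      change TM2.step M c = some b at e
      have h1 := ih hc
      obtain ⟨l, v, S⟩ := c
      cases l with
      | none => cases e
      | some l =>
        have e' : stepAux (M l) v S = b := by simpa using e
        have h2 := stackSize_stepAux (M l) v S
        rw [e'] at h2
        have h3 : maxPushes (M l) ≤ ∑ l, maxPushes (M l) :=
          Finset.single_le_sum (f := fun l => maxPushes (M l)) (fun _ _ => Nat.zero_le _)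
            (Finset.mem_univ l)
        rw [add_mul]
        simp only at h1
        omega

end Growth

/-! ### Machines with subroutines -/

section Sub
variable {I : Type} [DecidableEq I] (tm : I → FinTM2) {K₀ : Type} [DecidableEq K₀]
  (Γ₀ : K₀ → Type) (Λ₀ σ₀ : Type)

/-- The alphabets of the stacks of a machine with subroutines. -/
abbrev SubΓ : K₀ ⊕ (Σ i, (tm i).K) → Type := Sum.elim Γ₀ fun p => (tm p.1).Γ p.2

/-- The labels of a machine with subroutines. -/
abbrev SubΛ : Type := Λ₀ ⊕ Σ i, (tm i).Λ

/-- The internal states of a machine with subroutines. -/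
abbrev Subσ : Type := σ₀ × ∀ i, (tm i).σ

variable {Γ₀ Λ₀ σ₀}

/-- A statement of a subroutine, as a statement of the machine; it halts by jumping to `ret`. -/
def liftStmt (i : I) (ret : Λ₀) :
    Stmt (tm i).Γ (tm i).Λ (tm i).σ → Stmt (SubΓ tm Γ₀) (SubΛ tm Λ₀) (Subσ tm σ₀)
  | .push k f q => .push (Sum.inr ⟨i, k⟩) (fun v => f (v.2 i)) (liftStmt i ret q)
  | .peek k f q => .peek (Sum.inr ⟨i, k⟩)
      (fun v x => (v.1, Function.update v.2 i (f (v.2 i) x))) (liftStmt i ret q)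
  | .pop k f q => .pop (Sum.inr ⟨i, k⟩)
      (fun v x => (v.1, Function.update v.2 i (f (v.2 i) x))) (liftStmt i ret q)
  | .load f q => .load (fun v => (v.1, Function.update v.2 i (f (v.2 i)))) (liftStmt i ret q)
  | .branch f q q' => .branch (fun v => f (v.2 i)) (liftStmt i ret q) (liftStmt i ret q')
  | .goto f => .goto fun v => Sum.inr ⟨i, f (v.2 i)⟩
  | .halt => .goto fun _ => Sum.inl ret

/-- The stacks of a machine with subroutines. -/
def subStore (S : ∀ k, List (Γ₀ k)) (T : ∀ i, ∀ k, List ((tm i).Γ k)) :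
    ∀ k, List (SubΓ tm Γ₀ k)
  | .inl k => S k
  | .inr p => T p.1 p.2

theorem subStore_update_inr (S : ∀ k, List (Γ₀ k)) (T : ∀ i, ∀ k, List ((tm i).Γ k)) (i : I)
    (k : (tm i).K) (x : List ((tm i).Γ k)) :
    Function.update (subStore tm S T) (Sum.inr ⟨i, k⟩) x =
      subStore tm S (Function.update T i (Function.update (T i) k x)) := by
  funext j
  rcases j with j | ⟨j, k'⟩
  · exact Function.update_of_ne (by simp) ..
  · by_cases h : j = i
    · subst h
      have e : subStore tm S (Function.update T j (Function.update (T j) k x)) (Sum.inr ⟨j, k'⟩) =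
          Function.update (T j) k x k' :=
        congrFun (Function.update_self (f := T) ..) k'
      refine Eq.trans ?_ e.symm
      by_cases h' : k' = k
      · subst h'
        exact (Function.update_self ..).trans (Function.update_self (f := T j) ..).symm
      · exact (Function.update_of_ne (fun e => h' (by simpa using e)) ..).trans
          (Function.update_of_ne (f := T j) h' ..).symm
    · have e : subStore tm S (Function.update T i (Function.update (T i) k x)) (Sum.inr ⟨j, k'⟩) =
          T j k' :=
        congrFun (Function.update_of_ne (f := T) h ..) k'
      exact (Function.update_of_ne
        (fun e => h (congrArg Sigma.fst (Sum.inr.inj e))) ..).trans e.symm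

/-- A configuration of a subroutine, as a configuration of the machine. -/
def liftCfg (i : I) (ret : Λ₀) (v₀ : σ₀) (w : ∀ i, (tm i).σ) (S : ∀ k, List (Γ₀ k))
    (T : ∀ i, ∀ k, List ((tm i).Γ k)) (c : Cfg (tm i).Γ (tm i).Λ (tm i).σ) :
    Cfg (SubΓ tm Γ₀) (SubΛ tm Λ₀) (Subσ tm σ₀) where
  l := some (match c.l with
    | none => Sum.inl ret
    | some l => Sum.inr ⟨i, l⟩)
  var := (v₀, Function.update w i c.var)
  stk := subStore tm S (Function.update T i c.stk)

/-- A lifted statement touches only the stacks and the state component of its own subroutine, so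
lifting commutes with execution. Halting is included, because `liftCfg` sends a halted configuration
to the label `ret`. -/
theorem liftStmt_stepAux (i : I) (ret : Λ₀) (q : Stmt (tm i).Γ (tm i).Λ (tm i).σ)
    (v₀ : σ₀) (w : ∀ i, (tm i).σ) (S : ∀ k, List (Γ₀ k)) (T : ∀ i, ∀ k, List ((tm i).Γ k))
    (v : (tm i).σ) (s : ∀ k, List ((tm i).Γ k)) :
    stepAux (liftStmt tm i ret q) (v₀, Function.update w i v)
        (subStore tm S (Function.update T i s)) =
      liftCfg tm i ret v₀ w S T (stepAux q v s) := by
  have hst : ∀ s k, subStore tm S (Function.update T i s) (Sum.inr ⟨i, k⟩) = s k := by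
    intro s k; simp [subStore]
  have hup : ∀ (s : ∀ k, List ((tm i).Γ k)) (k : (tm i).K) (x : List ((tm i).Γ k)),
      Function.update (subStore tm S (Function.update T i s)) (Sum.inr ⟨i, k⟩) x =
        subStore tm S (Function.update T i (Function.update s k x)) := by
    intro s k x; rw [subStore_update_inr]; simp
  induction q generalizing v s with
  | push k f q ih =>
    simp only [liftStmt, stepAux, Function.update_self]
    rw [hst]
    erw [hup]
    exact ih _ _
  | peek k f q ih =>
    simp only [liftStmt, stepAux, Function.update_self, Function.update_idem]
    rw [hst]
    exact ih _ _
  | pop k f q ih =>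
    simp only [liftStmt, stepAux, Function.update_self, Function.update_idem]
    rw [hst]
    erw [hup]
    exact ih _ _
  | load f q ih =>
    simp only [liftStmt, stepAux, Function.update_self, Function.update_idem]
    exact ih _ _
  | branch f q q' ih ih' =>
    simp only [liftStmt, stepAux, Function.update_self]
    cases f v
    · exact ih' _ _
    · exact ih _ _
  | goto f => simp [liftStmt, stepAux, liftCfg]
  | halt => simp [liftStmt, stepAux, liftCfg]

/-- The program of a machine with subroutines. -/
def subProgram (m₀ : Λ₀ → Stmt (SubΓ tm Γ₀) (SubΛ tm Λ₀) (Subσ tm σ₀)) (ret : I → Λ₀) :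
    SubΛ tm Λ₀ → Stmt (SubΓ tm Γ₀) (SubΛ tm Λ₀) (Subσ tm σ₀)
  | .inl l => m₀ l
  | .inr p => liftStmt tm p.1 (ret p.1) ((tm p.1).m p.2)

/-- A subroutine that halts has reset its state, so all subroutines are again in their initial
states and calls can follow one another. -/
theorem runsWithin_sub (m₀ : Λ₀ → Stmt (SubΓ tm Γ₀) (SubΛ tm Λ₀) (Subσ tm σ₀)) (ret : I → Λ₀)
    (i : I) {n : ℕ} {a b : List _} (h : RunsWithin (tm i).step n (initList (tm i) a)
      (haltList (tm i) b))
    (v₀ : σ₀) (S : ∀ k, List (Γ₀ k)) (T : ∀ i, ∀ k, List ((tm i).Γ k)) :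
    RunsWithin (TM2.step (subProgram tm m₀ ret)) n
      ⟨some (Sum.inr ⟨i, (tm i).main⟩), (v₀, fun i => (tm i).initialState),
        subStore tm S (Function.update T i (Function.update (fun _ => []) (tm i).k₀ a))⟩
      ⟨some (Sum.inl (ret i)), (v₀, fun i => (tm i).initialState),
        subStore tm S (Function.update T i (Function.update (fun _ => []) (tm i).k₁ b))⟩ := by
  have := h.map (f' := TM2.step (subProgram tm m₀ ret))
    (liftCfg tm i (ret i) v₀ (fun i => (tm i).initialState) S T) ?_
  · rw [initList_eq, haltList_eq] at this
    simpa only [liftCfg, Function.update_eq_self] using this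
  · rintro ⟨l, v, s⟩ y hy
    cases l with
    | none => cases hy
    | some l =>
      have hy' : stepAux ((tm i).m l) v s = y := by simpa using hy
      subst hy'
      simp only [liftCfg, TM2.step]
      exact congrArg some (liftStmt_stepAux tm i (ret i) _ v₀ _ S T v s)

end Sub

/-! ### Moving stacks -/

section Move
variable {K : Type} [DecidableEq K] {Γ : K → Type} {Λ σ : Type}

/-- Move the stack `src` to `dst`, letter by letter. -/
def moveStmt (src dst : K) (set : σ → Option (Γ src) → σ) (get : σ → Option (Γ src))
    (conv : σ → Γ dst) (self next : Λ) : Stmt Γ Λ σ :=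
  .pop src set (.branch (fun v => (get v).isSome) (.push dst conv (.goto fun _ => self))
    (.goto fun _ => next))

/-- Each letter passes through the internal state, which `set` and `get` write and read. A move
reverses the order of the letters, so faithful transport takes two moves. -/
theorem runsWithin_move {M : Λ → Stmt Γ Λ σ} {src dst : K} {set : σ → Option (Γ src) → σ}
    {get : σ → Option (Γ src)} {conv : σ → Γ dst} {self next : Λ} (φ : Γ src → Γ dst)
    (hM : M self = moveStmt src dst set get conv self next) (hne : dst ≠ src)
    (hget : ∀ v x, get (set v x) = x) (hset : ∀ v x y, set (set v x) y = set v y)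
    (hconv : ∀ v a, conv (set v (some a)) = φ a) (v : σ) (S : ∀ k, List (Γ k))
    (L : List (Γ src)) (D : List (Γ dst)) :
    RunsWithin (TM2.step M) (L.length + 1)
      ⟨some self, v, Function.update (Function.update S dst D) src L⟩
      ⟨some next, set v none,
        Function.update (Function.update S dst ((L.map φ).reverse ++ D)) src []⟩ := by
  induction L generalizing v D with
  | nil =>
    refine (RunsWithin.single ?_).mono (by simp)
    simp [TM2.step, hM, moveStmt, hget]
  | cons a L ih =>
    have h := ih (set v (some a)) (φ a :: D)
    rw [hset] at h
    simp only [List.map_cons, List.reverse_cons, List.append_assoc, List.singleton_append]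
    refine RunsWithin.head ?_ h
    simp only [TM2.step, hM, moveStmt, stepAux, hget, Function.update_self, List.head?_cons,
      Option.isSome_some, cond_true, hconv, List.tail_cons, Function.update_idem,
      Function.update_of_ne hne]
    congr 2
    rw [Function.update_comm hne.symm]
    simp

/-- Move the stack `src` to both `dst` and `dst'`, letter by letter. -/
def moveTwoStmt (src dst dst' : K) (set : σ → Option (Γ src) → σ) (get : σ → Option (Γ src))
    (conv : σ → Γ dst) (conv' : σ → Γ dst') (self next : Λ) : Stmt Γ Λ σ :=
  .pop src set (.branch (fun v => (get v).isSome)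
    (.push dst conv (.push dst' conv' (.goto fun _ => self))) (.goto fun _ => next))

theorem runsWithin_moveTwo {M : Λ → Stmt Γ Λ σ} {src dst dst' : K}
    {set : σ → Option (Γ src) → σ}
    {get : σ → Option (Γ src)} {conv : σ → Γ dst} {conv' : σ → Γ dst'} {self next : Λ}
    (φ : Γ src → Γ dst) (φ' : Γ src → Γ dst')
    (hM : M self = moveTwoStmt src dst dst' set get conv conv' self next) (hne : dst ≠ src)
    (hne' : dst' ≠ src) (hne'' : dst' ≠ dst)
    (hget : ∀ v x, get (set v x) = x) (hset : ∀ v x y, set (set v x) y = set v y)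
    (hconv : ∀ v a, conv (set v (some a)) = φ a) (hconv' : ∀ v a, conv' (set v (some a)) = φ' a)
    (v : σ) (S : ∀ k, List (Γ k)) (L : List (Γ src)) (D : List (Γ dst)) (D' : List (Γ dst')) :
    RunsWithin (TM2.step M) (L.length + 1)
      ⟨some self, v,
        Function.update (Function.update (Function.update S dst' D') dst D) src L⟩
      ⟨some next, set v none,
        Function.update (Function.update (Function.update S dst' ((L.map φ').reverse ++ D'))
          dst ((L.map φ).reverse ++ D)) src []⟩ := by
  induction L generalizing v D D' with
  | nil =>
    refine (RunsWithin.single ?_).mono (by simp)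
    simp [TM2.step, hM, moveTwoStmt, hget]
  | cons a L ih =>
    have h := ih (set v (some a)) (φ a :: D) (φ' a :: D')
    rw [hset] at h
    simp only [List.map_cons, List.reverse_cons, List.append_assoc, List.singleton_append]
    refine RunsWithin.head ?_ h
    simp only [TM2.step, hM, moveTwoStmt, stepAux, hget, Function.update_self, List.head?_cons,
      Option.isSome_some, cond_true, hconv, hconv', List.tail_cons, Function.update_idem,
      Function.update_of_ne hne, Function.update_of_ne hne', Function.update_of_ne hne'']
    congr 2
    funext k
    by_cases h1 : k = src
    · subst h1; simp [hne.symm, hne'.symm]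
    by_cases h2 : k = dst
    · subst h2; simp [h1, hne''.symm]
    by_cases h3 : k = dst'
    · subst h3; simp [h1, h2]
    · simp [h1, h2, h3]

/-- The form suited to chaining: before and after the move, the stacks are a single update of the
same background `Z`, in which the source is empty. -/
theorem runsWithin_move' {M : Λ → Stmt Γ Λ σ} {src dst : K} {set : σ → Option (Γ src) → σ}
    {get : σ → Option (Γ src)} {conv : σ → Γ dst} {self next : Λ} (φ : Γ src → Γ dst)
    (hM : M self = moveStmt src dst set get conv self next) (hne : dst ≠ src)
    (hget : ∀ v x, get (set v x) = x) (hset : ∀ v x y, set (set v x) y = set v y)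
    (hconv : ∀ v a, conv (set v (some a)) = φ a) (v : σ) (Z : ∀ k, List (Γ k))
    (hZ : Z src = []) (L : List (Γ src)) (L' : List (Γ dst))
    (hL : (L.map φ).reverse ++ Z dst = L') {n : ℕ} (hn : L.length + 1 ≤ n) :
    RunsWithin (TM2.step M) n
      ⟨some self, v, Function.update Z src L⟩
      ⟨some next, set v none, Function.update Z dst L'⟩ := by
  have h := runsWithin_move φ hM hne hget hset hconv v Z L (Z dst)
  rw [Function.update_eq_self, Function.update_comm hne, ← hZ, Function.update_eq_self, hL] at h
  exact h.mono hn

theorem runsWithin_moveTwo' {M : Λ → Stmt Γ Λ σ} {src dst dst' : K}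
    {set : σ → Option (Γ src) → σ}
    {get : σ → Option (Γ src)} {conv : σ → Γ dst} {conv' : σ → Γ dst'} {self next : Λ}
    (φ : Γ src → Γ dst) (φ' : Γ src → Γ dst')
    (hM : M self = moveTwoStmt src dst dst' set get conv conv' self next) (hne : dst ≠ src)
    (hne' : dst' ≠ src) (hne'' : dst' ≠ dst)
    (hget : ∀ v x, get (set v x) = x) (hset : ∀ v x y, set (set v x) y = set v y)
    (hconv : ∀ v a, conv (set v (some a)) = φ a) (hconv' : ∀ v a, conv' (set v (some a)) = φ' a)
    (v : σ) (Z : ∀ k, List (Γ k)) (hZ : Z src = []) (L : List (Γ src)) (L' : List (Γ dst))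
    (L'' : List (Γ dst')) (hL : (L.map φ).reverse ++ Z dst = L')
    (hL' : (L.map φ').reverse ++ Z dst' = L'') {n : ℕ} (hn : L.length + 1 ≤ n) :
    RunsWithin (TM2.step M) n
      ⟨some self, v, Function.update Z src L⟩
      ⟨some next, set v none, Function.update (Function.update Z dst' L'') dst L'⟩ := by
  have h := runsWithin_moveTwo φ φ' hM hne hne' hne'' hget hset hconv hconv' v Z L (Z dst)
    (Z dst')
  rw [Function.update_eq_self, Function.update_eq_self, Function.update_comm hne,
    Function.update_comm hne', ← hZ, Function.update_eq_self, hL, hL'] at h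
  exact h.mono hn

end Move

end QuantumIP

/-! ### Composition and pairing of polynomial-time string maps. -/

namespace QuantumIP

open Turing StateTransition
open Turing.TM2 (Stmt Cfg stepAux)

/-! ### Polynomial-time computable maps to strings -/

/-- The map `F` to strings is computable in polynomial time from the encoding `ea`. -/
def PolyTime {X α β : Type} (ea : X → List α) (F : X → List β) : Prop :=
  ∃ (tm : FinTM2) (i : tm.Γ tm.k₀ ≃ α) (o : tm.Γ tm.k₁ ≃ β) (p : Polynomial ℕ), ∀ x,
    RunsWithin tm.step (p.eval (ea x).length) (initList tm ((ea x).map i.symm))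
      (haltList tm ((F x).map o.symm))

/-- The control stacks of `pairMachine`. -/
inductive PairStack
  | input
  | revInput
  | revOutput
  | output
  deriving DecidableEq

instance : Fintype PairStack :=
  ⟨{.input, .revInput, .revOutput, .output}, by rintro (_ | _ | _ | _) <;> simp⟩

/-- The alphabets of the control stacks of `pairMachine`. -/
abbrev PairΓ (α β γ : Type) : PairStack → Type
  | .input => α
  | .revInput => α
  | .revOutput => β ⊕ γ
  | .output => β ⊕ γ

section PolyTime
variable {X Y α β γ : Type} {ea : X → List α}

theorem polyTime_of_computable {eb : Y → List β} {f : X → Y}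
    (h : Nonempty (TM2ComputableInPolyTime ea eb f)) : PolyTime ea fun x => eb (f x) := by
  obtain ⟨⟨⟨tm, i, o⟩, p, hp⟩⟩ := h
  refine ⟨tm, i, o, p, fun x => ?_⟩
  obtain ⟨⟨t, ht⟩, h⟩ := hp x
  exact ⟨t, h, ht⟩

theorem computable_of_polyTime {eb : Y → List β} {f : X → Y}
    (h : PolyTime ea fun x => eb (f x)) : Nonempty (TM2ComputableInPolyTime ea eb f) := by
  obtain ⟨tm, i, o, p, hp⟩ := h
  choose t ht ht' using hp
  exact ⟨⟨⟨tm, i, o⟩, p, fun x => ⟨⟨t x, ht' x⟩, ht x⟩⟩⟩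

theorem stackSize_update_nil {K : Type} [DecidableEq K] [Fintype K] {Γ : K → Type} (k : K)
    (l : List (Γ k)) : stackSize (Function.update (fun _ => []) k l) = l.length := by
  have h := stackSize_update (fun k => ([] : List (Γ k))) k l
  have h' : stackSize (fun k => ([] : List (Γ k))) = 0 := by simp [stackSize]
  simp only [List.length_nil] at h
  omega

/-- The constant depends on the machine alone, so polynomial time forces polynomial output length;
this keeps the second of two composed machines polynomial in the original input. -/
theorem exists_length_le (tm : FinTM2) : ∃ C : ℕ, ∀ (n : ℕ) (a : List (tm.Γ tm.k₀))
    (b : List (tm.Γ tm.k₁)), RunsWithin tm.step n (initList tm a) (haltList tm b) →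
      b.length ≤ a.length + n * C := by
  let := tm.ΛFin
  let := tm.kFin
  refine ⟨∑ l, maxPushes (tm.m l), fun n a b h => ?_⟩
  rw [initList_eq, haltList_eq] at h
  have := stackSize_runs h
  rwa [stackSize_update_nil, stackSize_update_nil] at this

theorem eval_le_eval (p : Polynomial ℕ) {a b : ℕ} (h : a ≤ b) : p.eval a ≤ p.eval b := by
  rw [Polynomial.eval_eq_sum, Polynomial.eval_eq_sum]
  exact Finset.sum_le_sum fun i _ => Nat.mul_le_mul_left _ (Nat.pow_le_pow_left h _)

/-- Two machines, as a family. -/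
abbrev twoMachines (t t' : FinTM2) : Bool → FinTM2
  | false => t
  | true => t'

theorem runsWithin_sub' {I : Type} [DecidableEq I] (tm : I → FinTM2) {K₀ : Type} [DecidableEq K₀]
    {Γ₀ : K₀ → Type} {Λ₀ σ₀ : Type}
    (m₀ : Λ₀ → Stmt (SubΓ tm Γ₀) (SubΛ tm Λ₀) (Subσ tm σ₀)) (ret : I → Λ₀)
    (i : I) {n : ℕ} {a b : List _} (h : RunsWithin (tm i).step n (initList (tm i) a)
      (haltList (tm i) b))
    (v₀ : σ₀) (Z : ∀ k, List (SubΓ tm Γ₀ k)) (hZ : ∀ k, Z (Sum.inr ⟨i, k⟩) = []) :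
    RunsWithin (TM2.step (subProgram tm m₀ ret)) n
      ⟨some (Sum.inr ⟨i, (tm i).main⟩), (v₀, fun i => (tm i).initialState),
        Function.update Z (Sum.inr ⟨i, (tm i).k₀⟩) a⟩
      ⟨some (Sum.inl (ret i)), (v₀, fun i => (tm i).initialState),
        Function.update Z (Sum.inr ⟨i, (tm i).k₁⟩) b⟩ := by
  have e : Z = subStore tm (fun k => Z (Sum.inl k)) (fun i k => Z (Sum.inr ⟨i, k⟩)) := by
    funext k
    rcases k with k | k <;> rfl
  have e' : (fun k => Z (Sum.inr ⟨i, k⟩)) = fun _ => [] := funext hZ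
  have := runsWithin_sub tm m₀ ret i h v₀ (fun k => Z (Sum.inl k))
    (fun i k => Z (Sum.inr ⟨i, k⟩))
  have e₂ := subStore_update_inr tm (fun k => Z (Sum.inl k)) (fun i k => Z (Sum.inr ⟨i, k⟩)) i
    (tm i).k₀ a
  have e₃ := subStore_update_inr tm (fun k => Z (Sum.inl k)) (fun i k => Z (Sum.inr ⟨i, k⟩)) i
    (tm i).k₁ b
  rw [e', ← e] at e₂ e₃
  exact (this.congr_left (congrArg (Cfg.mk _ _) e₂)).congr_right (congrArg (Cfg.mk _ _) e₃.symm)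

theorem map_symm_map {A B : Type} (e : A ≃ B) (x : Option A) : (x.map e).map e.symm = x := by
  cases x <;> simp

theorem bind_inl_map_inl {A B C : Type} (e : A ≃ B) (x : Option A) :
    ((x.map fun y => (Sum.inl (e y) : B ⊕ C)).bind fun y =>
      y.elim (fun y => some (e.symm y)) fun _ => none) = x := by
  cases x <;> simp

theorem bind_inr_map_inr {A B C : Type} (e : A ≃ B) (x : Option A) :
    ((x.map fun y => (Sum.inr (e y) : C ⊕ B)).bind fun y =>
      y.elim (fun _ => none) fun y => some (e.symm y)) = x := by
  cases x <;> simp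

theorem map_map_symm_reverse {A B : Type} (e : A ≃ B) (L : List B) :
    ((L.map e.symm).map e).reverse ++ [] = L.reverse := by
  simp

theorem map_reverse_reverse {A B : Type} (e : A → B) (L : List A) :
    (L.reverse.map e).reverse ++ [] = L.map e := by
  simp

attribute [local instance] FinTM2.kFin FinTM2.ΛFin FinTM2.σFin FinTM2.Γk₀Fin

section Comp
variable (t t' : FinTM2) [Inhabited β] [Fintype β] (o : t.Γ t.k₁ ≃ β) (i : t'.Γ t'.k₀ ≃ β)

instance twoMachines_fintypeK (b : Bool) : Fintype (twoMachines t t' b).K :=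
  (twoMachines t t' b).kFin

/-- The control program of the composition of two machines. -/
def compControl : Fin 3 → Stmt (SubΓ (twoMachines t t') fun _ : Unit => β)
    (SubΛ (twoMachines t t') (Fin 3)) (Subσ (twoMachines t t') (Option β))
  | 0 => moveStmt (Sum.inr ⟨false, t.k₁⟩) (Sum.inl ()) (fun v x => (x.map o, v.2))
      (fun v => v.1.map o.symm) (fun v => (v.1.getD default : β)) (Sum.inl 0) (Sum.inl 1)
  | 1 => moveStmt (Sum.inl ()) (Sum.inr ⟨true, t'.k₀⟩) (fun v x => (x, v.2)) (fun v => v.1)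
      (fun v => i.symm (v.1.getD default)) (Sum.inl 1) (Sum.inr ⟨true, t'.main⟩)
  | 2 => .halt

/-- The composition of two machines. -/
def compMachine : FinTM2 where
  K := Unit ⊕ Σ i, (twoMachines t t' i).K
  k₀ := Sum.inr ⟨false, t.k₀⟩
  k₁ := Sum.inr ⟨true, t'.k₁⟩
  Γ := SubΓ (twoMachines t t') fun _ : Unit => β
  Λ := SubΛ (twoMachines t t') (Fin 3)
  main := Sum.inr ⟨false, t.main⟩
  σ := Subσ (twoMachines t t') (Option β)
  initialState := (none, fun i => (twoMachines t t' i).initialState)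
  Γk₀Fin := t.Γk₀Fin
  m := subProgram (twoMachines t t') (compControl t t' o i)
    fun b => match b with | false => 0 | true => 2

/-- Between the two calls the intermediate string goes through the auxiliary stack; its two
reversals cancel and its letters are translated from one alphabet to the other. -/
theorem runsWithin_comp {n n' : ℕ} {a : List (t.Γ t.k₀)} {b : List β} {c : List (t'.Γ t'.k₁)}
    (h : RunsWithin t.step n (initList t a) (haltList t (b.map o.symm)))
    (h' : RunsWithin t'.step n' (initList t' (b.map i.symm)) (haltList t' c)) :
    RunsWithin (compMachine t t' o i).step (n + (b.length + 1) + (b.length + 1) + n' + 1)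
      (initList (compMachine t t' o i) a) (haltList (compMachine t t' o i) c) := by
  refine (congrArg₂ (RunsWithin (compMachine t t' o i).step _)
    (initList_eq (compMachine t t' o i) a) (haltList_eq (compMachine t t' o i) c)).mpr ?_
  have hn₁ : (b.map o.symm).length + 1 ≤ b.length + 1 := by simp
  have hn₂ : b.reverse.length + 1 ≤ b.length + 1 := by simp
  have s1 := runsWithin_sub' (twoMachines t t') (compControl t t' o i)
    (fun b => match b with | false => 0 | true => 2) false h none (fun _ => []) (fun _ => rfl)
  have s2 := runsWithin_move' (M := subProgram (twoMachines t t') (compControl t t' o i)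
    (fun b => match b with | false => 0 | true => 2)) (self := Sum.inl 0)
    (src := Sum.inr ⟨false, t.k₁⟩) (dst := Sum.inl ()) o rfl (by simp)
    (fun v x => map_symm_map o x) (fun v x y => rfl) (fun v a => rfl)
    (none, fun i => (twoMachines t t' i).initialState) (fun _ => []) rfl (b.map o.symm) b.reverse
    (map_map_symm_reverse o b) hn₁
  have s3 := runsWithin_move' (M := subProgram (twoMachines t t') (compControl t t' o i)
    (fun b => match b with | false => 0 | true => 2)) (self := Sum.inl 1)
    (src := Sum.inl ()) (dst := Sum.inr ⟨true, t'.k₀⟩) i.symm rfl (by simp)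
    (fun v x => rfl) (fun v x y => rfl) (fun v a => rfl)
    (none, fun i => (twoMachines t t' i).initialState) (fun _ => []) rfl b.reverse
    (b.map i.symm) (map_reverse_reverse i.symm b) hn₂
  have s4 := runsWithin_sub' (twoMachines t t') (compControl t t' o i)
    (fun b => match b with | false => 0 | true => 2) true h' none (fun _ => []) (fun _ => rfl)
  have s5 : RunsWithin (compMachine t t' o i).step 1
      ⟨some (Sum.inl 2), (compMachine t t' o i).initialState,
        Function.update (fun _ => []) (compMachine t t' o i).k₁ c⟩
      ⟨none, (compMachine t t' o i).initialState,
        Function.update (fun _ => []) (compMachine t t' o i).k₁ c⟩ := RunsWithin.single rfl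
  exact (((s1.trans s2).trans s3).trans s4).trans s5

end Comp

/-- The second machine is only ever run on strings `eb (φ x)`, so nothing is required of it on
strings that are not encodings. -/
theorem PolyTime.comp [Inhabited β] [Fintype β] {F : X → List β} {eb : Y → List β}
    {H : Y → List γ} (h : PolyTime ea F) (h' : PolyTime eb H) (φ : X → Y)
    (hφ : ∀ x, F x = eb (φ x)) : PolyTime ea fun x => H (φ x) := by
  obtain ⟨t, i, o, p, hp⟩ := h
  obtain ⟨t', i', o', p', hp'⟩ := h'
  obtain ⟨C, hC⟩ := exists_length_le t
  -- Bounds the length of the intermediate string: the input length plus a constant for each step of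
  -- the first machine.
  let B : Polynomial ℕ := .X + p * Polynomial.C C
  refine ⟨compMachine t t' o i', i, o', p + (B + 1) + (B + 1) + p'.comp B + 1, fun x => ?_⟩
  have h1 := hp x
  have h2 := hp' (φ x)
  rw [← hφ] at h2
  refine (runsWithin_comp t t' o i' h1 h2).mono ?_
  have h3 := hC _ _ _ h1
  simp only [List.length_map] at h3
  have h4 : (F x).length ≤ B.eval (ea x).length := by simpa [B] using h3
  have h5 := eval_le_eval p' h4
  simp only [Polynomial.eval_add, Polynomial.eval_one, Polynomial.eval_comp]
  omega

section Pair
variable (t t' : FinTM2) [Inhabited α] [Fintype α] [Fintype β] [Inhabited γ]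
  [Fintype γ] (i : t.Γ t.k₀ ≃ α) (i' : t'.Γ t'.k₀ ≃ α) (o : t.Γ t.k₁ ≃ β) (o' : t'.Γ t'.k₁ ≃ γ)

/-- The control program of `pairMachine`. -/
def pairControl : Fin 7 → Stmt (SubΓ (twoMachines t t') (PairΓ α β γ))
    (SubΛ (twoMachines t t') (Fin 7)) (Subσ (twoMachines t t') (Option α × Option (β ⊕ γ)))
  | 0 => moveStmt (Sum.inl .input) (Sum.inl .revInput) (fun v x => ((x, v.1.2), v.2))
      (fun v => v.1.1) (fun v => (v.1.1.getD default : α)) (Sum.inl 0) (Sum.inl 1)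
  | 1 => moveTwoStmt (Sum.inl .revInput) (Sum.inr ⟨false, t.k₀⟩) (Sum.inr ⟨true, t'.k₀⟩)
      (fun v x => ((x, v.1.2), v.2)) (fun v => v.1.1)
      (fun v => i.symm (v.1.1.getD default)) (fun v => i'.symm (v.1.1.getD default))
      (Sum.inl 1) (Sum.inr ⟨false, t.main⟩)
  | 2 => .goto fun _ => Sum.inr ⟨true, t'.main⟩
  | 3 => moveStmt (Sum.inr ⟨false, t.k₁⟩) (Sum.inl .revOutput)
      (fun v x => ((v.1.1, x.map fun y => Sum.inl (o y)), v.2))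
      (fun v => v.1.2.bind fun y => y.elim (fun y => some (o.symm y)) fun _ => none)
      (fun v => (v.1.2.getD default : β ⊕ γ)) (Sum.inl 3) (Sum.inl 4)
  | 4 => moveStmt (Sum.inr ⟨true, t'.k₁⟩) (Sum.inl .revOutput)
      (fun v x => ((v.1.1, x.map fun y => Sum.inr (o' y)), v.2))
      (fun v => v.1.2.bind fun y => y.elim (fun _ => none) fun y => some (o'.symm y))
      (fun v => (v.1.2.getD default : β ⊕ γ)) (Sum.inl 4) (Sum.inl 5)
  | 5 => moveStmt (Sum.inl .revOutput) (Sum.inl .output) (fun v x => ((v.1.1, x), v.2))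
      (fun v => v.1.2) (fun v => (v.1.2.getD default : β ⊕ γ)) (Sum.inl 5) (Sum.inl 6)
  | 6 => .halt

/-- The machine which runs two machines on the same input. -/
def pairMachine : FinTM2 where
  K := PairStack ⊕ Σ i, (twoMachines t t' i).K
  k₀ := Sum.inl .input
  k₁ := Sum.inl .output
  Γ := SubΓ (twoMachines t t') (PairΓ α β γ)
  Λ := SubΛ (twoMachines t t') (Fin 7)
  main := Sum.inl 0
  σ := Subσ (twoMachines t t') (Option α × Option (β ⊕ γ))
  initialState := ((none, none), fun i => (twoMachines t t' i).initialState)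
  Γk₀Fin := inferInstanceAs (Fintype α)
  m := subProgram (twoMachines t t') (pairControl t t' i i' o o')
    fun b => match b with | false => 2 | true => 3

/-- The input is reversed once so that the simultaneous copy to both machines restores its order.
The outputs are piled up on `revOutput`, the second above the first, and one further reversal puts
them in order. -/
theorem runsWithin_pair {n n' : ℕ} {a : List α} {b : List β} {c : List γ}
    (h : RunsWithin t.step n (initList t (a.map i.symm)) (haltList t (b.map o.symm)))
    (h' : RunsWithin t'.step n' (initList t' (a.map i'.symm)) (haltList t' (c.map o'.symm))) :
    RunsWithin (pairMachine t t' i i' o o').step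
      ((a.length + 1) + (a.length + 1) + n + 1 + n' + (b.length + 1) + (c.length + 1) +
        (c.length + b.length + 1) + 1)
      (initList (pairMachine t t' i i' o o') a)
      (haltList (pairMachine t t' i i' o o') (b.map Sum.inl ++ c.map Sum.inr)) := by
  refine (congrArg₂ (RunsWithin (pairMachine t t' i i' o o').step _)
    (initList_eq (pairMachine t t' i i' o o') a)
    (haltList_eq (pairMachine t t' i i' o o') (b.map Sum.inl ++ c.map Sum.inr))).mpr ?_
  set m₀ := pairControl t t' i i' o o' with hm₀
  let ret : Bool → Fin 7 := fun b => match b with | false => 2 | true => 3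
  let M := subProgram (twoMachines t t') m₀ ret
  let v₁ : ∀ i, (twoMachines t t' i).σ := fun i => (twoMachines t t' i).initialState
  have e₁ : (a.map id).reverse ++ [] = a.reverse := by simp
  have e₂ : ((b.map o.symm).map fun y => Sum.inl (o y)).reverse ++ [] =
      (b.map (Sum.inl : β → β ⊕ γ)).reverse := by simp [Function.comp_def]
  have e₃ : ((c.map o'.symm).map fun y => Sum.inr (o' y)).reverse ++ (b.map Sum.inl).reverse =
      ((c.map Sum.inr).reverse ++ (b.map Sum.inl).reverse : List (β ⊕ γ)) := by
    simp [Function.comp_def]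
  have e₄ : (((c.map Sum.inr).reverse ++ (b.map Sum.inl).reverse).map id).reverse ++ [] =
      (b.map Sum.inl ++ c.map Sum.inr : List (β ⊕ γ)) := by simp
  have n₁ : a.reverse.length + 1 ≤ a.length + 1 := by simp
  have n₂ : (b.map o.symm).length + 1 ≤ b.length + 1 := by simp
  have n₃ : (c.map o'.symm).length + 1 ≤ c.length + 1 := by simp
  have n₄ : ((c.map Sum.inr).reverse ++ (b.map Sum.inl).reverse : List (β ⊕ γ)).length + 1 ≤
    c.length + b.length + 1 := by simp
  have s1 := runsWithin_move' (M := M) (self := Sum.inl 0)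
    (src := Sum.inl .input) (dst := Sum.inl .revInput) id rfl (by simp)
    (fun v x => rfl) (fun v x y => rfl) (fun v a => rfl)
    ((none, none), v₁) (fun _ => []) rfl a a.reverse e₁ le_rfl
  have s2 := runsWithin_moveTwo' (M := M) (self := Sum.inl 1) (src := Sum.inl .revInput)
    (dst := Sum.inr ⟨false, t.k₀⟩) (dst' := Sum.inr ⟨true, t'.k₀⟩) i.symm i'.symm rfl (by simp)
    (by simp) (by simp)
    (fun v x => rfl) (fun v x y => rfl) (fun v a => rfl) (fun v a => rfl)
    ((none, none), v₁) (fun _ => []) rfl a.reverse (a.map i.symm) (a.map i'.symm)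
    (map_reverse_reverse i.symm a) (map_reverse_reverse i'.symm a) n₁
  have s3 := runsWithin_sub' (twoMachines t t') m₀ ret false h (none, none)
    (Function.update (fun _ => []) (Sum.inr ⟨true, t'.k₀⟩) (a.map i'.symm))
    (fun _ => Function.update_of_ne (by simp) ..)
  have s4 (Z) : RunsWithin (TM2.step M) 1 ⟨some (Sum.inl 2), ((none, none), v₁), Z⟩
      ⟨some (Sum.inr ⟨true, t'.main⟩), ((none, none), v₁), Z⟩ := RunsWithin.single rfl
  have s5 := runsWithin_sub' (twoMachines t t') m₀ ret true h' (none, none)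
    (Function.update (fun _ => []) (Sum.inr ⟨false, t.k₁⟩) (b.map o.symm))
    (fun _ => Function.update_of_ne (by simp) ..)
  have s5' := s5.congr_left (congrArg (Cfg.mk _ _) (Function.update_comm (by simp) ..))
  have s6 := (runsWithin_move' (M := M) (self := Sum.inl 3) (src := Sum.inr ⟨false, t.k₁⟩)
    (dst := Sum.inl .revOutput) (fun y => Sum.inl (o y)) rfl (by simp)
    (fun v x => bind_inl_map_inl o x) (fun v x y => rfl) (fun v a => rfl)
    ((none, none), v₁)
    (Function.update (fun _ => []) (Sum.inr ⟨true, t'.k₁⟩) (c.map o'.symm)) rfl (b.map o.symm)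
    (b.map Sum.inl).reverse e₂ n₂).congr_left
      (congrArg (Cfg.mk _ _) (Function.update_comm (by simp) ..))
  have s7 := ((runsWithin_move' (M := M) (self := Sum.inl 4) (src := Sum.inr ⟨true, t'.k₁⟩)
    (dst := Sum.inl .revOutput) (fun y => Sum.inr (o' y)) rfl (by simp)
    (fun v x => bind_inr_map_inr o' x) (fun v x y => rfl) (fun v a => rfl)
    ((none, none), v₁) (Function.update (fun _ => []) (Sum.inl .revOutput) (b.map Sum.inl).reverse)
    rfl (c.map o'.symm) ((c.map Sum.inr).reverse ++ (b.map Sum.inl).reverse) e₃ n₃).congr_left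
      (congrArg (Cfg.mk _ _) (Function.update_comm (by simp) ..))).congr_right
      (congrArg (Cfg.mk _ _) (Function.update_idem ..))
  have s8 := runsWithin_move' (M := M) (self := Sum.inl 5) (src := Sum.inl .revOutput)
    (dst := Sum.inl .output) id rfl (by simp)
    (fun v x => rfl) (fun v x y => rfl) (fun v a => rfl)
    ((none, none), v₁) (fun _ => []) rfl ((c.map Sum.inr).reverse ++ (b.map Sum.inl).reverse)
    (b.map Sum.inl ++ c.map Sum.inr) e₄ n₄
  have s9 : RunsWithin (TM2.step M) 1
      ⟨some (Sum.inl 6), ((none, none), v₁), Function.update (fun _ => [])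
        (Sum.inl .output) (b.map Sum.inl ++ c.map Sum.inr)⟩
      ⟨none, ((none, none), v₁), Function.update (fun _ => [])
        (Sum.inl .output) (b.map Sum.inl ++ c.map Sum.inr)⟩ :=
    RunsWithin.single rfl
  exact (((((((s1.trans s2).trans s3).trans (s4 _)).trans s5').trans s6).trans s7).trans s8).trans s9

end Pair

/-- The disjoint union of the alphabets makes a delimiter unnecessary: a one-pass transducer sees
from each letter which output it belongs to. -/
theorem PolyTime.pair [Inhabited α] [Fintype α] [Fintype β] [Inhabited γ]
    [Fintype γ] {F : X → List β} {H : X → List γ} (h : PolyTime ea F) (h' : PolyTime ea H) :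
    PolyTime ea fun x => (F x).map Sum.inl ++ (H x).map Sum.inr := by
  obtain ⟨t, i, o, p, hp⟩ := h
  obtain ⟨t', i', o', p', hp'⟩ := h'
  obtain ⟨C, hC⟩ := exists_length_le t
  let B : Polynomial ℕ := .X + p * Polynomial.C C
  obtain ⟨C', hC'⟩ := exists_length_le t'
  let B' : Polynomial ℕ := .X + p' * Polynomial.C C'
  refine ⟨pairMachine t t' i i' o o', Equiv.refl _, Equiv.refl _,
    (.X + 1) + (.X + 1) + p + 1 + p' + (B + 1) + (B' + 1) + (B' + B + 1) + 1, fun x => ?_⟩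
  have h1 := hp x
  have h2 := hp' x
  have h3 := hC _ _ _ h1
  have h3' := hC' _ _ _ h2
  simp only [List.length_map] at h3 h3'
  have h4 : (F x).length ≤ B.eval (ea x).length := by simpa [B] using h3
  have h4' : (H x).length ≤ B'.eval (ea x).length := by simpa [B'] using h3'
  refine (congrArg₂ (fun u w => RunsWithin (pairMachine t t' i i' o o').step _
    (initList (pairMachine t t' i i' o o') u) (haltList (pairMachine t t' i i' o o') w))
    (List.map_id (ea x)) (List.map_id ((F x).map Sum.inl ++ (H x).map Sum.inr))).mpr ?_
  refine (runsWithin_pair t t' i i' o o' h1 h2).mono ?_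
  simp only [Polynomial.eval_add, Polynomial.eval_one, Polynomial.eval_X]
  omega

end PolyTime
end QuantumIP

/-! ### One-pass transducers with unary counters, and their running time. -/

namespace QuantumIP

open Turing StateTransition
open Turing.TM2 (Stmt Cfg stepAux)

/-! ### Transducers with counters -/

/-- The commands of a transducer with counters `J` and output alphabet `β`. -/
inductive CounterCmd (J β : Type) where
  | emit (b : β)
  | inc (j : J)
  | dec (j : J)
  | copy (j : J) (b : β)
  | clear (j : J)

/-- A transducer with counters reads its input once; for each letter it executes commands. -/
structure CounterTransducer (α β J σ : Type) where
  init : σ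
  step : σ → α → σ × List (CounterCmd J β)
  final : σ → List (CounterCmd J β)

/-- Lists of at most `N` commands. -/
abbrev Pending (J β : Type) (N : ℕ) : Type := {l : List (CounterCmd J β) // l.length ≤ N}

section Transducer
variable {α β J σ : Type} [DecidableEq J]

/-- The effect of a command on the counters, and what it writes. -/
def CounterCmd.exec : CounterCmd J β → (J → ℕ) → (J → ℕ) × List β
  | .emit b, c => (c, [b])
  | .inc j, c => (Function.update c j (c j + 1), [])
  | .dec j, c => (Function.update c j (c j - 1), [])
  | .copy j b, c => (c, List.replicate (c j) b)
  | .clear j, c => (Function.update c j 0, [])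

/-- The effect of a list of commands on the counters, and what it writes. -/
def execCmds : List (CounterCmd J β) → (J → ℕ) → (J → ℕ) × List β
  | [], c => (c, [])
  | a :: l, c => ((execCmds l (a.exec c).1).1, (a.exec c).2 ++ (execCmds l (a.exec c).1).2)

theorem execCmds_append (l l' : List (CounterCmd J β)) (c : J → ℕ) :
    execCmds (l ++ l') c =
      ((execCmds l' (execCmds l c).1).1, (execCmds l c).2 ++ (execCmds l' (execCmds l c).1).2) := by
  induction l generalizing c with
  | nil => rfl
  | cons a l ih => simp [execCmds, ih]

/-- What a transducer writes from a given state on. -/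
def CounterTransducer.run (T : CounterTransducer α β J σ) : σ → (J → ℕ) → List α → List β
  | s, c, [] => (execCmds (T.final s) c).2
  | s, c, a :: l => (execCmds (T.step s a).2 c).2 ++
      T.run (T.step s a).1 (execCmds (T.step s a).2 c).1 l

/-- The map computed by a transducer. -/
def CounterTransducer.output (T : CounterTransducer α β J σ) (l : List α) : List β :=
  T.run T.init 0 l

theorem CounterCmd.exec_le (a : CounterCmd J β) {c : J → ℕ} {B : ℕ} (hc : ∀ j, c j ≤ B) (j : J) :
    (a.exec c).1 j ≤ B + 1 := by
  have := hc j
  cases a with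
  | emit b => simp only [exec]; omega
  | copy i b => simp only [exec]; omega
  | inc i => 
    by_cases h : j = i
    · subst h; simp [exec, this]
    · simp [exec, h]; omega
  | dec i =>
    by_cases h : j = i
    · subst h; simp [exec]; omega
    · simp [exec, h]; omega
  | clear i =>
    by_cases h : j = i
    · subst h; simp [exec]
    · simp [exec, h]; omega

theorem CounterCmd.length_exec_le (a : CounterCmd J β) {c : J → ℕ} {B : ℕ} (hc : ∀ j, c j ≤ B) :
    (a.exec c).2.length ≤ B + 1 := by
  cases a <;> simp [exec]
  case copy j b => have := hc j; omega

theorem execCmds_le (l : List (CounterCmd J β)) {c : J → ℕ} {b : ℕ} (hc : ∀ j, c j ≤ b) (j : J) :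
    (execCmds l c).1 j ≤ b + l.length := by
  induction l generalizing c b with
  | nil => exact hc j
  | cons a l ih =>
    have := ih (a.exec_le hc)
    simp only [execCmds, List.length_cons]
    omega

theorem length_execCmds_le (l : List (CounterCmd J β)) {c : J → ℕ} {b B : ℕ} (hc : ∀ j, c j ≤ b)
    (hB : b + l.length ≤ B) : (execCmds l c).2.length ≤ l.length * (B + 1) := by
  induction l generalizing c b with
  | nil => simp [execCmds]
  | cons a l ih =>
    simp only [List.length_cons] at hB
    have h1 := ih (a.exec_le hc) (by omega)
    have h2 := a.length_exec_le hc
    simp only [execCmds, List.length_cons, List.length_append]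
    nlinarith

theorem execCmds_clear (l : List J) (c : J → ℕ) :
    execCmds (l.map (CounterCmd.clear (β := β))) c = (fun j => if j ∈ l then 0 else c j, []) := by
  induction l generalizing c with
  | nil => simp [execCmds]
  | cons i l ih =>
    simp only [List.map_cons, execCmds, CounterCmd.exec, ih, List.nil_append, List.mem_cons]
    congr 1
    funext j
    by_cases h : j = i
    · subst h; simp
    · simp [h]

/-- The stacks of a transducer. -/
inductive TransducerStack (J : Type) where
  | input
  | rev
  | out
  | tmp
  | counter (j : J)
  deriving DecidableEq

instance [Finite J] : Finite (TransducerStack J) :=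
  Finite.of_injective (β := Option (Option (Option (Option J))))
    (fun k => match k with
      | .input => none
      | .rev => some none
      | .out => some (some none)
      | .tmp => some (some (some none))
      | .counter j => some (some (some (some j))))
    (by rintro (_ | _ | _ | _ | _) (_ | _ | _ | _ | _) <;> simp)

/-- The alphabets of the stacks of a transducer. -/
abbrev TransducerΓ (α β : Type) : TransducerStack J → Type
  | .input => α
  | .rev => β
  | .out => β
  | .tmp => Unit
  | .counter _ => Unit

/-- The contents of the stacks of a transducer. -/
def transducerStore (i : List α) (r o : List β) (t : ℕ) (c : J → ℕ) :
    ∀ k : TransducerStack J, List (TransducerΓ α β k)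
  | .input => i
  | .rev => r
  | .out => o
  | .tmp => List.replicate t ()
  | .counter j => List.replicate (c j) ()

variable (i i' : List α) (r r' o o' : List β) (t t' : ℕ) (c : J → ℕ)

theorem update_input : Function.update (transducerStore i r o t c) .input i' =
    transducerStore i' r o t c := by
  funext k
  cases k <;> first | exact Function.update_self .. | exact Function.update_of_ne (by simp) ..

theorem update_rev : Function.update (transducerStore i r o t c) .rev r' =
    transducerStore i r' o t c := by
  funext k
  cases k <;> first | exact Function.update_self .. | exact Function.update_of_ne (by simp) ..

theorem update_out : Function.update (transducerStore i r o t c) .out o' =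
    transducerStore i r o' t c := by
  funext k
  cases k <;> first | exact Function.update_self .. | exact Function.update_of_ne (by simp) ..

theorem update_tmp : Function.update (transducerStore i r o t c) .tmp (List.replicate t' ()) =
    transducerStore i r o t' c := by
  funext k
  cases k <;> first | exact Function.update_self .. | exact Function.update_of_ne (by simp) ..

theorem update_counter (j : J) (n : ℕ) :
    Function.update (transducerStore i r o t c) (.counter j) (List.replicate n ()) =
      transducerStore i r o t (Function.update c j n) := by
  funext k
  cases k
  case counter j' =>
    by_cases h : j' = j
    · subst h
      refine (Function.update_self ..).trans ?_
      simp [transducerStore]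
    · refine (Function.update_of_ne (by simpa using h) ..).trans ?_
      simp [transducerStore, h]
  all_goals exact Function.update_of_ne (by simp) ..

theorem transducerStore_input (L : List α) :
    Function.update (fun k : TransducerStack J => ([] : List (TransducerΓ α β k))) .input L =
      transducerStore (β := β) (J := J) L [] [] 0 (fun _ => 0) := by
  funext k
  cases k <;> first | exact Function.update_self .. | exact Function.update_of_ne (by simp) ..

theorem transducerStore_out (R : List β) :
    Function.update (fun k : TransducerStack J => ([] : List (TransducerΓ α β k))) .out R =
      transducerStore (α := α) (J := J) [] [] R 0 (fun _ => 0) := by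
  funext k
  cases k <;> first | exact Function.update_self .. | exact Function.update_of_ne (by simp) ..

/-- The labels of the machine of a transducer. -/
inductive TransducerLabel (β J σ : Type) (N : ℕ) where
  | read (s : σ)
  | exec (s : Option σ) (p : Pending J β N)
  | restore (j : J) (s : Option σ) (p : Pending J β N)
  | finish

instance [Finite J] [Finite β] : Finite (CounterCmd J β) :=
  Finite.of_injective (β := β ⊕ (J ⊕ (J ⊕ ((J × β) ⊕ J))))
    (fun k => match k with
      | .emit b => .inl b
      | .inc j => .inr (.inl j)
      | .dec j => .inr (.inr (.inl j))
      | .copy j b => .inr (.inr (.inr (.inl (j, b))))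
      | .clear j => .inr (.inr (.inr (.inr j))))
    (by rintro (_ | _ | _ | _ | _) (_ | _ | _ | _ | _) <;> simp)

instance [Finite J] [Finite β] (N : ℕ) : Finite (Pending J β N) :=
  Set.Finite.to_subtype (s := {l : List (CounterCmd J β) | l.length ≤ N})
    (List.finite_length_le (CounterCmd J β) N)

instance [Finite J] [Finite β] [Finite σ] (N : ℕ) : Finite (TransducerLabel β J σ N) :=
  Finite.of_injective
    (β := σ ⊕ ((Option σ × Pending J β N) ⊕ ((J × Option σ × Pending J β N) ⊕ Unit)))
    (fun k => match k with
      | .read s => .inl s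
      | .exec s p => .inr (.inl (s, p))
      | .restore j s p => .inr (.inr (.inl (j, s, p)))
      | .finish => .inr (.inr (.inr ())))
    (by rintro (_ | _ | _ | _) (_ | _ | _ | _) <;> simp)

/-- The internal states of the machine of a transducer. -/
abbrev TransducerState (α β : Type) : Type := Option α × Option β × Bool

variable [Fintype J]

/-- The commands which a transducer executes at the end, including a cleanup. -/
noncomputable def CounterTransducer.finalCmds (T : CounterTransducer α β J σ) (s : σ) :
    List (CounterCmd J β) :=
  T.final s ++ (Finset.univ.toList.map CounterCmd.clear)

variable [Inhabited β] (T : CounterTransducer α β J σ) (N : ℕ)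
  (hN : ∀ s a, (T.step s a).2.length ≤ N) (hN' : ∀ s, (T.finalCmds s).length ≤ N)

/-- The program of the machine of a transducer. -/
noncomputable def transducerProgram : TransducerLabel β J σ N →
    Stmt (TransducerΓ (J := J) α β) (TransducerLabel β J σ N) (TransducerState α β)
  | .read s => .pop .input (fun v x => (x, v.2)) (.goto fun v => match v.1 with
      | some a => .exec (some (T.step s a).1) ⟨(T.step s a).2, hN s a⟩
      | none => .exec none ⟨T.finalCmds s, hN' s⟩)
  | .exec s ⟨[], _⟩ => .goto fun _ => match s with
      | some s => .read s
      | none => .finish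
  | .exec s ⟨.emit b :: l, h⟩ => .push .rev (fun _ => b)
      (.goto fun _ => .exec s ⟨l, Nat.le_of_succ_le h⟩)
  | .exec s ⟨.inc j :: l, h⟩ => .push (.counter j) (fun _ => ())
      (.goto fun _ => .exec s ⟨l, Nat.le_of_succ_le h⟩)
  | .exec s ⟨.dec j :: l, h⟩ => .pop (.counter j) (fun v _ => v)
      (.goto fun _ => .exec s ⟨l, Nat.le_of_succ_le h⟩)
  | .exec s ⟨.clear j :: l, h⟩ => .pop (.counter j) (fun v x => (v.1, v.2.1, x.isSome))
      (.branch (fun v => v.2.2) (.goto fun _ => .exec s ⟨.clear j :: l, h⟩)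
        (.goto fun _ => .exec s ⟨l, Nat.le_of_succ_le h⟩))
  | .exec s ⟨.copy j b :: l, h⟩ => .pop (.counter j) (fun v x => (v.1, v.2.1, x.isSome))
      (.branch (fun v => v.2.2)
        (.push .tmp (fun _ => ()) (.push .rev (fun _ => b)
          (.goto fun _ => .exec s ⟨.copy j b :: l, h⟩)))
        (.goto fun _ => .restore j s ⟨l, Nat.le_of_succ_le h⟩))
  | .restore j s p => .pop .tmp (fun v x => (v.1, v.2.1, x.isSome))
      (.branch (fun v => v.2.2)
        (.push (.counter j) (fun _ => ()) (.goto fun _ => .restore j s p))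
        (.goto fun _ => .exec s p))
  | .finish => .pop .rev (fun v x => (v.1, x, v.2.2)) (.branch (fun v => v.2.1.isSome)
      (.push .out (fun v => v.2.1.getD default) (.goto fun _ => .finish)) .halt)

/-- The machine of a transducer. -/
noncomputable def transducerMachine [Fintype α] [Fintype β] [Fintype σ] : FinTM2 where
  K := TransducerStack J
  kFin := Fintype.ofFinite _
  k₀ := .input
  k₁ := .out
  Γ := TransducerΓ α β
  Λ := TransducerLabel β J σ N
  ΛFin := Fintype.ofFinite _
  main := .read T.init
  σ := TransducerState α β
  initialState := (none, none, false)
  Γk₀Fin := inferInstanceAs (Fintype α)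
  m := transducerProgram T N hN hN'

section Steps
variable {i r o t c} {N hN hN'} {s : Option σ} {l : List (CounterCmd J β)} {x : Option α}
  {y : Option β} {f : Bool}

theorem runsWithin_clear (j : J) (h : (CounterCmd.clear j :: l).length ≤ N) (n : ℕ)
    (hc : c j = n) :
    RunsWithin (TM2.step (transducerProgram T N hN hN')) (n + 1)
      ⟨some (.exec s ⟨.clear j :: l, h⟩), (x, y, f), transducerStore i r o t c⟩
      ⟨some (.exec s ⟨l, Nat.le_of_succ_le h⟩), (x, y, false),
        transducerStore i r o t (Function.update c j 0)⟩ := by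
  induction n generalizing c f with
  | zero =>
    have e : TM2.step (transducerProgram T N hN hN')
        ⟨some (.exec s ⟨.clear j :: l, h⟩), (x, y, f), transducerStore i r o t c⟩ =
      some (cond (List.replicate (c j) ()).head?.isSome
        ⟨some (.exec s ⟨.clear j :: l, h⟩), (x, y, (List.replicate (c j) ()).head?.isSome),
          Function.update (transducerStore i r o t c) (.counter j) (List.replicate (c j) ()).tail⟩
        ⟨some (.exec s ⟨l, Nat.le_of_succ_le h⟩), (x, y, (List.replicate (c j) ()).head?.isSome),
          Function.update (transducerStore i r o t c) (.counter j)
            (List.replicate (c j) ()).tail⟩) := rfl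
    rw [hc] at e
    exact (RunsWithin.single e).congr_right
      (congrArg (Cfg.mk _ _) (update_counter i r o t c j 0))
  | succ n ih =>
    have e : TM2.step (transducerProgram T N hN hN')
        ⟨some (.exec s ⟨.clear j :: l, h⟩), (x, y, f), transducerStore i r o t c⟩ =
      some (cond (List.replicate (c j) ()).head?.isSome
        ⟨some (.exec s ⟨.clear j :: l, h⟩), (x, y, (List.replicate (c j) ()).head?.isSome),
          Function.update (transducerStore i r o t c) (.counter j) (List.replicate (c j) ()).tail⟩
        ⟨some (.exec s ⟨l, Nat.le_of_succ_le h⟩), (x, y, (List.replicate (c j) ()).head?.isSome),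
          Function.update (transducerStore i r o t c) (.counter j)
            (List.replicate (c j) ()).tail⟩) := rfl
    rw [hc] at e
    have h1 := (RunsWithin.single e).congr_right
      (congrArg (Cfg.mk _ _) (update_counter i r o t c j n))
    have h2 := ih (f := true) (c := Function.update c j n) (by simp)
    rw [Function.update_idem] at h2
    exact (h1.trans h2).mono (by omega)

/-- Reading a unary counter destroys it. Its units are therefore parked on `tmp` while the copies
are written, and `runsWithin_restore` brings them back. -/
theorem runsWithin_copyDown (j : J) (b : β) (h : (CounterCmd.copy j b :: l).length ≤ N) (n : ℕ)
    (hc : c j = n) :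
    RunsWithin (TM2.step (transducerProgram T N hN hN')) (n + 1)
      ⟨some (.exec s ⟨.copy j b :: l, h⟩), (x, y, f), transducerStore i r o t c⟩
      ⟨some (.restore j s ⟨l, Nat.le_of_succ_le h⟩), (x, y, false),
        transducerStore i (List.replicate n b ++ r) o (t + n) (Function.update c j 0)⟩ := by
  induction n generalizing c f r t with
  | zero =>
    have e : TM2.step (transducerProgram T N hN hN')
        ⟨some (.exec s ⟨.copy j b :: l, h⟩), (x, y, f), transducerStore i r o t c⟩ =
      some (cond (List.replicate (c j) ()).head?.isSome
        (stepAux (.push .tmp (fun _ => ()) (.push .rev (fun _ => b)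
          (.goto fun _ => .exec s ⟨.copy j b :: l, h⟩)))
          (x, y, (List.replicate (c j) ()).head?.isSome)
          (Function.update (transducerStore i r o t c) (.counter j)
            (List.replicate (c j) ()).tail))
        ⟨some (.restore j s ⟨l, Nat.le_of_succ_le h⟩),
          (x, y, (List.replicate (c j) ()).head?.isSome),
          Function.update (transducerStore i r o t c) (.counter j)
            (List.replicate (c j) ()).tail⟩) := rfl
    rw [hc] at e
    exact (RunsWithin.single e).congr_right
      (congrArg (Cfg.mk _ _) (update_counter i r o t c j 0))
  | succ n ih =>
    have e : TM2.step (transducerProgram T N hN hN')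
        ⟨some (.exec s ⟨.copy j b :: l, h⟩), (x, y, f), transducerStore i r o t c⟩ =
      some (cond (List.replicate (c j) ()).head?.isSome
        (stepAux (.push .tmp (fun _ => ()) (.push .rev (fun _ => b)
          (.goto fun _ => .exec s ⟨.copy j b :: l, h⟩)))
          (x, y, (List.replicate (c j) ()).head?.isSome)
          (Function.update (transducerStore i r o t c) (.counter j)
            (List.replicate (c j) ()).tail))
        ⟨some (.restore j s ⟨l, Nat.le_of_succ_le h⟩),
          (x, y, (List.replicate (c j) ()).head?.isSome),
          Function.update (transducerStore i r o t c) (.counter j)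
            (List.replicate (c j) ()).tail⟩) := rfl
    rw [hc] at e
    have e' : stepAux (.push .tmp (fun _ => ()) (.push .rev (fun _ => b)
          (.goto fun _ => .exec s ⟨.copy j b :: l, h⟩))) (x, y, true)
          (Function.update (transducerStore i r o t c) (.counter j) (List.replicate n ())) =
        (⟨some (.exec s ⟨.copy j b :: l, h⟩), (x, y, true),
          transducerStore i (b :: r) o (t + 1) (Function.update c j n)⟩ :
          Cfg (TransducerΓ (J := J) α β) (TransducerLabel β J σ N) (TransducerState α β)) := by
      refine (congrArg (stepAux _ _) (update_counter i r o t c j n)).trans ?_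
      refine (congrArg (stepAux _ _)
        (update_tmp i r o t (t + 1) (Function.update c j n))).trans ?_
      exact congrArg (stepAux _ _) (update_rev i r (b :: r) o (t + 1) (Function.update c j n))
    have h1 := (RunsWithin.single e).congr_right e'
    have h2 := ih (f := true) (c := Function.update c j n) (r := b :: r) (t := t + 1) (by simp)
    rw [Function.update_idem, add_right_comm, add_assoc t] at h2
    have e'' : List.replicate n b ++ b :: r = List.replicate (n + 1) b ++ r := by
      rw [List.replicate_succ']; simp
    rw [e''] at h2
    exact (h1.trans h2).mono (by omega)

theorem runsWithin_restore (j : J) (p : Pending J β N) (n : ℕ) :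
    RunsWithin (TM2.step (transducerProgram T N hN hN')) (n + 1)
      ⟨some (.restore j s p), (x, y, f), transducerStore i r o n c⟩
      ⟨some (.exec s p), (x, y, false),
        transducerStore i r o 0 (Function.update c j (c j + n))⟩ := by
  induction n generalizing c f with
  | zero =>
    rw [add_zero, Function.update_eq_self]
    exact RunsWithin.single_congr (congrArg (Cfg.mk _ _) (update_tmp i r o 0 0 c)) rfl
  | succ n ih =>
    have e' : stepAux (.push (.counter j) (fun _ => ()) (.goto fun _ => .restore j s p))
          (x, y, true)
          (Function.update (transducerStore i r o (n + 1) c) .tmp (List.replicate n ())) =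
        (⟨some (.restore j s p), (x, y, true),
          transducerStore i r o n (Function.update c j (c j + 1))⟩ :
          Cfg (TransducerΓ (J := J) α β) (TransducerLabel β J σ N) (TransducerState α β)) := by
      refine (congrArg (stepAux _ _) (update_tmp i r o (n + 1) n c)).trans ?_
      exact congrArg (stepAux _ _) (update_counter i r o n c j (c j + 1))
    have h1 := (RunsWithin.single (f := TM2.step (transducerProgram T N hN hN'))
      (a := ⟨some (.restore j s p), (x, y, f), transducerStore i r o (n + 1) c⟩) rfl).congr_right e'
    have h2 := ih (f := true) (c := Function.update c j (c j + 1))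
    rw [Function.update_idem, Function.update_self, add_assoc, add_comm 1] at h2
    exact (h1.trans h2).mono (by omega)

/-- The most expensive command is `copy`, with at most `B + 1` steps down and `B + 1` steps back. -/
theorem runsWithin_cmd (a : CounterCmd J β) (h : (a :: l).length ≤ N) {B : ℕ}
    (hc : ∀ j, c j ≤ B) :
    RunsWithin (TM2.step (transducerProgram T N hN hN')) (2 * B + 2)
      ⟨some (.exec s ⟨a :: l, h⟩), (x, y, false), transducerStore i r o 0 c⟩
      ⟨some (.exec s ⟨l, Nat.le_of_succ_le h⟩), (x, y, false),
        transducerStore i ((a.exec c).2.reverse ++ r) o 0 (a.exec c).1⟩ := by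
  cases a with
  | emit b =>
    exact RunsWithin.mono (n := 1)
      (.single_congr (congrArg (Cfg.mk _ _) (update_rev i r (b :: r) o 0 c)) rfl) (by omega)
  | inc j =>
    exact RunsWithin.mono (n := 1)
      (.single_congr (congrArg (Cfg.mk _ _) (update_counter i r o 0 c j (c j + 1))) rfl) (by omega)
  | dec j =>
    have e := update_counter i r o 0 c j (c j - 1)
    rw [← List.tail_replicate] at e
    exact RunsWithin.mono (n := 1) (.single_congr (congrArg (Cfg.mk _ _) e) rfl) (by omega)
  | clear j =>
    have := hc j
    exact (runsWithin_clear T j h (c j) rfl).mono (by omega)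
  | copy j b =>
    have h1 := runsWithin_copyDown (hN := hN) (hN' := hN') (i := i) (r := r) (o := o) (t := 0)
      (s := s) (x := x) (y := y) (f := false) T j b h (c j) rfl
    have h2 := runsWithin_restore (hN := hN) (hN' := hN') (i := i)
      (r := List.replicate (c j) b ++ r) (o := o) (s := s) (x := x) (y := y) (f := false)
      (c := Function.update c j 0) T j ⟨l, Nat.le_of_succ_le h⟩ (0 + c j)
    rw [Function.update_self, Function.update_idem, zero_add, zero_add,
      Function.update_eq_self] at h2
    rw [zero_add] at h1
    have := hc j
    simp only [CounterCmd.exec, List.reverse_replicate]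
    exact (h1.trans h2).mono (by omega)

theorem runsWithin_cmds (l : List (CounterCmd J β)) (h : l.length ≤ N) {b B : ℕ}
    (hc : ∀ j, c j ≤ b) (hB : b + l.length ≤ B) :
    RunsWithin (TM2.step (transducerProgram T N hN hN')) (l.length * (2 * B + 2))
      ⟨some (.exec s ⟨l, h⟩), (x, y, false), transducerStore i r o 0 c⟩
      ⟨some (.exec s ⟨[], Nat.zero_le _⟩), (x, y, false),
        transducerStore i ((execCmds l c).2.reverse ++ r) o 0 (execCmds l c).1⟩ := by
  induction l generalizing c r b with
  | nil => exact RunsWithin.refl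
  | cons a l ih =>
    simp only [List.length_cons] at hB
    have h1 := runsWithin_cmd (hN := hN) (hN' := hN') (i := i) (r := r) (o := o) (s := s)
      (x := x) (y := y) T a h (B := B) (fun j => (hc j).trans (by omega))
    have h2 := ih (r := (a.exec c).2.reverse ++ r) (Nat.le_of_succ_le h) (a.exec_le hc) (by omega)
    simp only [execCmds, List.reverse_append, List.append_assoc]
    refine (h1.trans h2).mono ?_
    simp only [List.length_cons]
    nlinarith

/-- Each remaining letter, and the end of the input, triggers at most `N` commands, and a command
raises a counter by at most one; hence no counter ever exceeds `B`. The final clearing commands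
empty the counters, as halting demands. -/
theorem runsWithin_read (L : List α) (s : σ) {b B : ℕ} (hc : ∀ j, c j ≤ b)
    (hB : b + N * (L.length + 1) ≤ B) :
    ∃ R : List β, R.length ≤ N * (L.length + 1) * (B + 1) ∧ T.run s c L = R ∧
    RunsWithin (TM2.step (transducerProgram T N hN hN'))
      ((L.length + 1) * (N * (2 * B + 2) + 2))
      ⟨some (.read s), (x, none, false), transducerStore L r [] 0 c⟩
      ⟨some .finish, (none, none, false), transducerStore [] (R.reverse ++ r) [] 0 (fun _ => 0)⟩ := by
  induction L generalizing s c r b x with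
  | nil =>
    have hclear : execCmds (T.finalCmds s) c = ((fun _ => 0), (execCmds (T.final s) c).2) := by
      rw [CounterTransducer.finalCmds, execCmds_append, execCmds_clear]
      simp
    have hle := hN' s
    have hB' : b + (T.finalCmds s).length ≤ B := by simp at hB; omega
    have h1 : RunsWithin (TM2.step (transducerProgram T N hN hN')) 1
      ⟨some (.read s), (x, none, false), transducerStore ([] : List α) r [] 0 c⟩
      ⟨some (.exec none ⟨T.finalCmds s, hN' s⟩), (none, none, false),
        transducerStore [] r [] 0 c⟩ :=
      .single_congr (congrArg (Cfg.mk _ _) (update_input [] [] r [] 0 c)) rfl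
    have h2 := runsWithin_cmds (hN := hN) (hN' := hN') (i := []) (r := r) (o := []) (s := none)
      (x := none) (y := none) T (T.finalCmds s) (hN' s) hc hB'
    rw [hclear] at h2
    refine ⟨_, ?_, rfl, ((h1.trans h2).trans (RunsWithin.single (f :=
      TM2.step (transducerProgram T N hN hN')) rfl)).mono ?_⟩
    · have := length_execCmds_le (T.finalCmds s) hc hB'
      rw [hclear] at this
      refine this.trans ?_
      simp only [List.length_nil, zero_add, mul_one]
      gcongr
    · simp only [List.length_nil, zero_add, one_mul]
      nlinarith
  | cons a L ih =>
    have hle := hN s a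
    simp only [List.length_cons] at hB
    have hB' : b + (T.step s a).2.length ≤ B := by nlinarith
    have h1 : RunsWithin (TM2.step (transducerProgram T N hN hN')) 1
      ⟨some (.read s), (x, none, false), transducerStore (a :: L) r [] 0 c⟩
      ⟨some (.exec (some (T.step s a).1) ⟨(T.step s a).2, hN s a⟩), (some a, none, false),
        transducerStore L r [] 0 c⟩ :=
      .single_congr (congrArg (Cfg.mk _ _) (update_input (a :: L) L r [] 0 c)) rfl
    have h2 := runsWithin_cmds (hN := hN) (hN' := hN') (i := L) (r := r) (o := [])
      (s := some (T.step s a).1) (x := some a) (y := none) T (T.step s a).2 (hN s a) hc hB'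
    have h3 : RunsWithin (TM2.step (transducerProgram T N hN hN')) 1
      ⟨some (.exec (some (T.step s a).1) ⟨[], Nat.zero_le _⟩), (some a, none, false),
        transducerStore L ((execCmds (T.step s a).2 c).2.reverse ++ r) [] 0
          (execCmds (T.step s a).2 c).1⟩
      ⟨some (.read (T.step s a).1), (some a, none, false),
        transducerStore L ((execCmds (T.step s a).2 c).2.reverse ++ r) [] 0
          (execCmds (T.step s a).2 c).1⟩ := RunsWithin.single rfl
    obtain ⟨R, hR, hrun, h4⟩ := ih (r := (execCmds (T.step s a).2 c).2.reverse ++ r)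
      (x := some a) (T.step s a).1 (execCmds_le (T.step s a).2 hc) (by nlinarith)
    refine ⟨(execCmds (T.step s a).2 c).2 ++ R, ?_, by rw [← hrun]; rfl, ?_⟩
    · have := length_execCmds_le (T.step s a).2 hc hB'
      rw [List.length_append, List.length_cons]
      nlinarith [Nat.mul_le_mul_right (B + 1) hle]
    · rw [List.reverse_append, List.append_assoc]
      refine (((h1.trans h2).trans h3).trans h4).mono ?_
      rw [List.length_cons]
      nlinarith [Nat.mul_le_mul_right (2 * B + 2) hle]

theorem runsWithin_finish (R : List β) (o : List β) :
    RunsWithin (TM2.step (transducerProgram T N hN hN')) (R.length + 1)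
      ⟨some .finish, (none, y, false), transducerStore [] R o 0 (fun _ => 0)⟩
      ⟨none, (none, none, false), transducerStore [] [] (R.reverse ++ o) 0 (fun _ => 0)⟩ := by
  induction R generalizing y o with
  | nil =>
    exact RunsWithin.single_congr
      (congrArg (Cfg.mk _ _) (update_rev (α := α) [] [] [] o 0 (fun _ : J => 0))) rfl
  | cons b R ih =>
    have e' : stepAux (.push .out (fun v => v.2.1.getD default) (.goto fun _ => .finish))
          (none, some b, false)
          (Function.update (transducerStore [] (b :: R) o 0 (fun _ => 0)) .rev R) =
        (⟨some .finish, (none, some b, false),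
          transducerStore [] R (b :: o) 0 (fun _ => 0)⟩ :
          Cfg (TransducerΓ (J := J) α β) (TransducerLabel β J σ N) (TransducerState α β)) := by
      refine (congrArg (stepAux _ _) (update_rev [] (b :: R) R o 0 (fun _ => 0))).trans ?_
      exact congrArg (Cfg.mk _ _) (update_out [] R o (b :: o) 0 (fun _ => 0))
    have h1 := (RunsWithin.single (f := TM2.step (transducerProgram T N hN hN'))
      (a := ⟨some .finish, (none, y, false), transducerStore [] (b :: R) o 0 (fun _ => 0)⟩)
      rfl).congr_right e'
    have h2 := ih (y := some b) (b :: o)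
    simp only [List.reverse_cons, List.append_assoc, List.singleton_append, List.length_cons]
    exact (h1.trans h2).mono (by omega)

end Steps

theorem polyTime_transducer [Fintype α] [Fintype β] [Fintype σ] :
    PolyTime (id : List α → List α) T.output := by
  obtain ⟨N₁, hN₁⟩ : ∃ N, ∀ s a, (T.step s a).2.length ≤ N :=
    ⟨∑ s, ∑ a, (T.step s a).2.length, fun s a =>
      (Finset.single_le_sum (f := fun a => (T.step s a).2.length) (fun _ _ => Nat.zero_le _)
        (Finset.mem_univ a)).trans
      (Finset.single_le_sum (f := fun s => ∑ a, (T.step s a).2.length) (fun _ _ => Nat.zero_le _)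
        (Finset.mem_univ s))⟩
  obtain ⟨N₂, hN₂⟩ : ∃ N, ∀ s, (T.finalCmds s).length ≤ N :=
    ⟨∑ s, (T.finalCmds s).length, fun s =>
      (Finset.single_le_sum (f := fun s => (T.finalCmds s).length) (fun _ _ => Nat.zero_le _)
        (Finset.mem_univ s))⟩
  let N := N₁ + N₂
  have hN : ∀ s a, (T.step s a).2.length ≤ N := fun s a => (hN₁ s a).trans (by omega)
  have hN' : ∀ s, (T.finalCmds s).length ≤ N := fun s => (hN₂ s).trans (by omega)
  let B : Polynomial ℕ := Polynomial.C N * (.X + 1)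
  -- The last summand pays for reversing the output: at most `B` commands are executed in all, and
  -- each writes at most `B + 1` letters.
  refine ⟨transducerMachine T N hN hN', Equiv.refl _, Equiv.refl _,
    (.X + 1) * (Polynomial.C N * (2 * B + 2) + 2) + (B * (B + 1) + 1), fun L => ?_⟩
  refine (congrArg₂ (fun u w => RunsWithin (transducerMachine T N hN hN').step _
    (initList (transducerMachine T N hN hN') u) (haltList (transducerMachine T N hN hN') w))
    (List.map_id L) (List.map_id (T.output L))).mpr ?_
  refine (congrArg₂ (RunsWithin (transducerMachine T N hN hN').step _)
    (initList_eq (transducerMachine T N hN hN') L)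
    (haltList_eq (transducerMachine T N hN hN') (T.output L))).mpr ?_
  obtain ⟨R, hR, hrun, h1⟩ := runsWithin_read (hN := hN) (hN' := hN') (r := []) (x := none)
    (c := fun _ => 0) (b := 0) (B := N * (L.length + 1)) T L T.init (fun _ => le_rfl) (by omega)
  have h2 := runsWithin_finish (hN := hN) (hN' := hN') (y := none) T R.reverse []
  rw [List.append_nil] at h1 h2
  rw [List.reverse_reverse] at h2
  have e : T.output L = R := hrun
  rw [e]
  refine (((h1.trans h2).congr_left (congrArg (Cfg.mk _ _) (transducerStore_input L))).congr_right
    (congrArg (Cfg.mk _ _) (transducerStore_out R).symm)).mono ?_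
  simp only [Polynomial.eval_add, Polynomial.eval_mul, Polynomial.eval_X, Polynomial.eval_one,
    Polynomial.eval_C, Polynomial.eval_ofNat, B, id, List.length_reverse]
  gcongr

end Transducer

end QuantumIP

/-! ### Operators on some of the qubits, padding by |0⟩, and measurement weights. -/

namespace QuantumIP

set_option linter.unusedSectionVars false

open Matrix

/-! ### Operators on some of the qubits -/

section OnQubits
variable {κ κ' ι ι' : Type} [Fintype κ] [DecidableEq κ] [Fintype κ'] [DecidableEq κ'] [Fintype ι]
  [DecidableEq ι] [Fintype ι'] [DecidableEq ι']

theorem extend_comp (w : κ ↪ ι) (u : κ → Bool) (x : ι → Bool) :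
    (fun k => Function.extend w u x (w k)) = u :=
  funext fun k => w.injective.extend_apply u x k

theorem extend_eq_self (w : κ ↪ ι) (x : ι → Bool) : Function.extend w (fun k => x (w k)) x = x := by
  funext i
  by_cases h : ∃ k, w k = i
  · obtain ⟨k, rfl⟩ := h
    exact w.injective.extend_apply _ _ _
  · exact Function.extend_apply' _ _ _ h

theorem extend_extend (w : κ ↪ ι) (u u' : κ → Bool) (x : ι → Bool) :
    Function.extend w u (Function.extend w u' x) = Function.extend w u x := by
  funext i
  by_cases h : ∃ k, w k = i
  · obtain ⟨k, rfl⟩ := h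
    simp [w.injective.extend_apply]
  · simp [Function.extend_apply' _ _ _ h]

/-- The strings agreeing with `x` off the image of `w` are exactly the `Function.extend w u x`, one
for each `u`. This formula reduces the algebra of `onQubits` to identities between overwritten
strings. -/
theorem onQubits_mulVec (w : κ ↪ ι) (U : Op κ) (ψ : (ι → Bool) → ℂ) (x : ι → Bool) :
    (onQubits w U *ᵥ ψ) x =
      ∑ u, U (fun k => x (w k)) u * ψ (Function.extend w u x) := by
  simp only [Matrix.mulVec, dotProduct, onQubits, Matrix.of_apply, ite_mul, zero_mul]
  rw [← Finset.sum_filter]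
  refine Finset.sum_bij' (fun y _ k => y (w k)) (fun u _ => Function.extend w u x)
    (fun _ _ => Finset.mem_univ _) ?_ ?_ ?_ ?_
  · intro u _
    simp only [Finset.mem_filter, Finset.mem_univ, true_and]
    intro i hi
    rw [Function.extend_apply' _ _ _ (by simpa using hi)]
  · intro y hy
    simp only [Finset.mem_filter, Finset.mem_univ, true_and] at hy
    funext i
    by_cases h : ∃ k, w k = i
    · obtain ⟨k, rfl⟩ := h
      exact w.injective.extend_apply _ _ _
    · rw [Function.extend_apply' _ _ _ h, hy i (by simpa using h)]
  · intro u _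
    exact extend_comp w u x
  · intro y hy
    simp only [Finset.mem_filter, Finset.mem_univ, true_and] at hy
    congr 2
    funext i
    by_cases h : ∃ k, w k = i
    · obtain ⟨k, rfl⟩ := h
      exact (w.injective.extend_apply (fun k => y (w k)) x k).symm
    · rw [Function.extend_apply' _ _ _ h, hy i (by simpa using h)]

theorem ext_mulVec {A B : Op ι} (h : ∀ ψ, A *ᵥ ψ = B *ᵥ ψ) : A = B :=
  Matrix.mulVec_injective (funext h)

theorem onQubits_one (w : κ ↪ ι) : onQubits w (1 : Op κ) = 1 := by
  refine ext_mulVec fun ψ => funext fun x => ?_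
  rw [onQubits_mulVec, Finset.sum_eq_single (fun k => x (w k))]
  · simp [extend_eq_self]
  · intro u _ hu
    simp [Matrix.one_apply_ne hu.symm]
  · simp

theorem onQubits_mul (w : κ ↪ ι) (U U' : Op κ) :
    onQubits w (U * U') = onQubits w U * onQubits w U' := by
  refine ext_mulVec fun ψ => funext fun x => ?_
  rw [← Matrix.mulVec_mulVec, onQubits_mulVec, onQubits_mulVec]
  simp only [onQubits_mulVec, extend_extend, extend_comp, Matrix.mul_apply, Finset.sum_mul,
    Finset.mul_sum]
  rw [Finset.sum_comm]
  simp only [mul_assoc]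

theorem extend_trans (w' : κ ↪ κ') (w : κ' ↪ ι) (u : κ → Bool) (x : ι → Bool) :
    Function.extend w (Function.extend w' u fun k => x (w k)) x =
      Function.extend (w'.trans w) u x := by
  funext i
  by_cases h : ∃ k, w k = i
  · obtain ⟨k, rfl⟩ := h
    rw [w.injective.extend_apply]
    by_cases h' : ∃ j, w' j = k
    · obtain ⟨j, rfl⟩ := h'
      rw [w'.injective.extend_apply]
      exact ((w'.trans w).injective.extend_apply _ _ j).symm
    · rw [Function.extend_apply' _ _ _ h', Function.extend_apply']
      rintro ⟨j, hj⟩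
      exact h' ⟨j, w.injective hj⟩
  · rw [Function.extend_apply' _ _ _ h, Function.extend_apply']
    rintro ⟨j, hj⟩
    exact h ⟨w' j, hj⟩

theorem onQubits_onQubits (w' : κ ↪ κ') (w : κ' ↪ ι) (U : Op κ) :
    onQubits w (onQubits w' U) = onQubits (w'.trans w) U := by
  ext x y
  simp only [onQubits, Matrix.of_apply, Function.Embedding.trans_apply]
  by_cases h : ∀ i, (∀ k, w k ≠ i) → x i = y i
  · rw [if_pos h]
    refine if_congr ⟨fun h' i hi => ?_, fun h' i hi => h' _ fun k hk => hi k (w.injective hk)⟩ rfl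
      rfl
    by_cases hw : ∃ k, w k = i
    · obtain ⟨k, rfl⟩ := hw
      exact h' k fun j hj => hi j (by rw [hj])
    · exact h i (by simpa using hw)
  · rw [if_neg h, if_neg]
    exact fun h' => h fun i hi => h' i fun k => hi _

theorem onQubits_conjTranspose (w : κ ↪ ι) (U : Op κ) :
    (onQubits w U)ᴴ = onQubits w Uᴴ := by
  ext x y
  simp only [onQubits, Matrix.of_apply, Matrix.conjTranspose_apply]
  rw [apply_ite star, star_zero]
  exact if_congr (by simp only [eq_comm]) rfl rfl

theorem onQubits_mem_unitaryGroup (w : κ ↪ ι) {U : Op κ}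
    (hU : U ∈ Matrix.unitaryGroup (κ → Bool) ℂ) :
    onQubits w U ∈ Matrix.unitaryGroup (ι → Bool) ℂ := by
  rw [Matrix.mem_unitaryGroup_iff, Matrix.star_eq_conjTranspose] at hU ⊢
  rw [onQubits_conjTranspose, ← onQubits_mul, hU, onQubits_one]

/-- Overwriting bits at disjoint places commutes, and neither operation changes the bits which the
other one reads. -/
theorem onQubits_commute (w : κ ↪ ι) (w' : κ' ↪ ι) (h : ∀ k k', w k ≠ w' k') (U : Op κ)
    (U' : Op κ') : onQubits w U * onQubits w' U' = onQubits w' U' * onQubits w U := by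
  have e : ∀ (u : κ → Bool) (u' : κ' → Bool) (x : ι → Bool),
      Function.extend w u (Function.extend w' u' x) =
        Function.extend w' u' (Function.extend w u x) := by
    intro u u' x
    funext i
    by_cases h₁ : ∃ k, w k = i
    · obtain ⟨k, rfl⟩ := h₁
      rw [w.injective.extend_apply, Function.extend_apply' (f := w') _ _ _ (by grind),
        w.injective.extend_apply]
    · rw [Function.extend_apply' _ _ _ h₁]
      by_cases h₂ : ∃ k, w' k = i
      · obtain ⟨k, rfl⟩ := h₂
        rw [w'.injective.extend_apply, w'.injective.extend_apply]
      · rw [Function.extend_apply' _ _ _ h₂, Function.extend_apply' _ _ _ h₂,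
          Function.extend_apply' _ _ _ h₁]
  have e₁ : ∀ (u : κ → Bool) (x : ι → Bool),
      (fun k => Function.extend w u x (w' k)) = fun k => x (w' k) := fun u x =>
    funext fun k => Function.extend_apply' _ _ _ (by grind)
  have e₂ : ∀ (u : κ' → Bool) (x : ι → Bool),
      (fun k => Function.extend w' u x (w k)) = fun k => x (w k) := fun u x =>
    funext fun k => Function.extend_apply' _ _ _ (by grind)
  refine ext_mulVec fun ψ => funext fun x => ?_
  rw [← Matrix.mulVec_mulVec, ← Matrix.mulVec_mulVec, onQubits_mulVec, onQubits_mulVec]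
  simp only [onQubits_mulVec, e₁, e₂, Finset.mul_sum]
  rw [Finset.sum_comm]
  refine Finset.sum_congr rfl fun u _ => Finset.sum_congr rfl fun u' _ => ?_
  rw [e]
  ring

/-- The state of the qubits `ι` in which the qubits outside of the image of `w` are in `|0⟩`. -/
def padVec (w : κ ↪ ι) (φ : (κ → Bool) → ℂ) : (ι → Bool) → ℂ := fun x =>
  if ∀ i, (∀ k, w k ≠ i) → x i = false then φ fun k => x (w k) else 0

/-- Zeros outside the image of `w` survive, so a computation confined to that image can be replaced
by the computation on fewer qubits. -/
theorem onQubits_padVec (w : κ ↪ ι) (U : Op κ) (φ : (κ → Bool) → ℂ) :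
    onQubits w U *ᵥ padVec w φ = padVec w (U *ᵥ φ) := by
  funext x
  rw [onQubits_mulVec]
  have h : ∀ u, padVec w φ (Function.extend w u x) =
      if ∀ i, (∀ k, w k ≠ i) → x i = false then φ u else 0 := by
    intro u
    simp only [padVec, extend_comp]
    refine if_congr (forall_congr' fun i => imp_congr_right fun hi => ?_) rfl rfl
    rw [Function.extend_apply' _ _ _ (by simpa using hi)]
  simp only [h]
  simp only [padVec]
  split_ifs
  · rfl
  · simp

theorem padVec_padVec (w' : κ ↪ κ') (w : κ' ↪ ι) (φ : (κ → Bool) → ℂ) :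
    padVec w (padVec w' φ) = padVec (w'.trans w) φ := by
  funext x
  simp only [padVec, Function.Embedding.trans_apply]
  by_cases h : ∀ i, (∀ k, w k ≠ i) → x i = false
  · rw [if_pos h]
    refine if_congr ⟨fun h' i hi => ?_, fun h' i hi => h' _ fun k hk => hi k (w.injective hk)⟩ rfl
      rfl
    by_cases hw : ∃ k, w k = i
    · obtain ⟨k, rfl⟩ := hw
      exact h' k fun j hj => hi j (by rw [hj])
    · exact h i (by simpa using hw)
  · rw [if_neg h, if_neg]
    exact fun h' => h fun i hi => h' i fun k => hi _

/-- The expectation of `g`, when the (not necessarily normalized) state `ψ` is measured. -/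
noncomputable def weight (g : (ι → Bool) → ℝ) (ψ : (ι → Bool) → ℂ) : ℝ :=
  ∑ z, g z * ‖ψ z‖ ^ 2

theorem weight_congr {g g' : (ι → Bool) → ℝ} {ψ : (ι → Bool) → ℂ}
    (h : ∀ z, ψ z ≠ 0 → g z = g' z) : weight g ψ = weight g' ψ := by
  refine Finset.sum_congr rfl fun z _ => ?_
  by_cases hz : ψ z = 0
  · simp [hz]
  · rw [h z hz]

theorem weight_mono {g g' : (ι → Bool) → ℝ} {ψ : (ι → Bool) → ℂ}
    (h : ∀ z, ψ z ≠ 0 → g z ≤ g' z) : weight g ψ ≤ weight g' ψ := by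
  refine Finset.sum_le_sum fun z _ => ?_
  by_cases hz : ψ z = 0
  · simp [hz]
  · exact mul_le_mul_of_nonneg_right (h z hz) (by positivity)

theorem weight_padVec (w : κ ↪ ι) (g : (ι → Bool) → ℝ) (φ : (κ → Bool) → ℂ) :
    weight g (padVec w φ) = weight (fun y => g (Function.extend w y fun _ => false)) φ := by
  have : ∀ z, g z * ‖padVec w φ z‖ ^ 2 = if ∀ i, (∀ k, w k ≠ i) → z i = false then
      g z * ‖φ fun k => z (w k)‖ ^ 2 else 0 := by
    intro z
    simp only [padVec]
    split_ifs <;> simp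
  simp only [weight, this]
  rw [← Finset.sum_filter]
  have ext : ∀ z : ι → Bool, (∀ i, (∀ k, w k ≠ i) → z i = false) →
      Function.extend w (fun k => z (w k)) (fun _ => false) = z := by
    intro z hz
    funext i
    by_cases h : ∃ k, w k = i
    · obtain ⟨k, rfl⟩ := h
      exact w.injective.extend_apply _ _ _
    · rw [Function.extend_apply' _ _ _ h, hz i (by simpa using h)]
  refine Finset.sum_bij' (fun z _ k => z (w k)) (fun y _ => Function.extend w y fun _ => false)
    (fun _ _ => Finset.mem_univ _) ?_ ?_ ?_ ?_
  · intro u _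
    simp only [Finset.mem_filter, Finset.mem_univ, true_and]
    intro i hi
    rw [Function.extend_apply' _ _ _ (by simpa using hi)]
  · intro z hz
    simp only [Finset.mem_filter, Finset.mem_univ, true_and] at hz
    exact ext z hz
  · intro u _
    exact extend_comp w u _
  · intro z hz
    simp only [Finset.mem_filter, Finset.mem_univ, true_and] at hz
    rw [ext z hz]

theorem weight_one_eq (ψ : (ι → Bool) → ℂ) :
    ((weight (fun _ => 1) ψ : ℝ) : ℂ) = star ψ ⬝ᵥ ψ := by
  simp only [weight, one_mul, dotProduct, Complex.ofReal_sum, Pi.star_apply]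
  refine Finset.sum_congr rfl fun z _ => ?_
  rw [RCLike.star_def, Complex.conj_mul']
  simp

theorem weight_one_mulVec {U : Op ι} (hU : U ∈ Matrix.unitaryGroup (ι → Bool) ℂ)
    (ψ : (ι → Bool) → ℂ) : weight (fun _ => 1) (U *ᵥ ψ) = weight (fun _ => 1) ψ := by
  have : ((weight (fun _ => 1) (U *ᵥ ψ) : ℝ) : ℂ) = (weight (fun _ => 1) ψ : ℝ) := by
    rw [weight_one_eq, weight_one_eq, Matrix.star_mulVec, Matrix.dotProduct_mulVec,
      Matrix.vecMul_vecMul, ← Matrix.star_eq_conjTranspose,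
      Matrix.mem_unitaryGroup_iff'.mp hU, Matrix.vecMul_one]
  exact_mod_cast this

theorem weight_smul (g : (ι → Bool) → ℝ) (ψ : (ι → Bool) → ℂ) {ζ : ℂ} (hζ : ‖ζ‖ = 1) :
    weight g (ζ • ψ) = weight g ψ := by
  simp [weight, hζ]

end OnQubits

/-! ### Circuits -/

section Circuits
variable {G : GateSet} {ι ι' : Type} [Fintype ι] [DecidableEq ι] [Fintype ι'] [DecidableEq ι']

/-- The application of a gate to other qubits. -/
def GateApp.relabel (e : ι ↪ ι') (a : GateApp G ι) : GateApp G ι' := ⟨a.name, a.wires.trans e⟩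

theorem circuitOp_append (C C' : Circuit G ι) :
    circuitOp (C ++ C') = circuitOp C' * circuitOp C := by
  induction C with
  | nil => simp [circuitOp]
  | cons a C ih => simp [circuitOp, ih, Matrix.mul_assoc]

theorem circuitOp_relabel (e : ι ↪ ι') (C : Circuit G ι) :
    circuitOp (C.map (GateApp.relabel e)) = onQubits e (circuitOp C) := by
  induction C with
  | nil => simp [circuitOp, onQubits_one]
  | cons a C ih =>
    rw [List.map_cons, circuitOp, circuitOp, ih, onQubits_mul, GateApp.op, GateApp.op,
      onQubits_onQubits]
    rfl

theorem circuitOp_mem_unitaryGroup (C : Circuit G ι) :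
    circuitOp C ∈ Matrix.unitaryGroup (ι → Bool) ℂ := by
  induction C with
  | nil => exact one_mem _
  | cons a C ih => exact mul_mem ih (onQubits_mem_unitaryGroup _ (G.gate a.name).2)

end Circuits

end QuantumIP

/-! ### Exactly implemented gates and the law of the final test. -/

namespace QuantumIP

set_option linter.unusedSectionVars false

open Matrix

/-! ### Exact implementations of gates -/

/-- An exact implementation of an operator, as in `ExactlyImplementable`. -/
structure Implementation (G : GateSet) {k : ℕ} (U : Op (Fin k)) where
  anc : ℕ
  circuit : Circuit G (Fin k ⊕ Fin anc)
  phase : ℂ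
  norm_phase : ‖phase‖ = 1
  spec : ∀ (x y : Fin k → Bool) (u : Fin anc → Bool),
    circuitOp circuit (Sum.elim x u) (Sum.elim y fun _ => false) =
      if u = (fun _ => false) then phase * U x y else 0

theorem ExactlyImplementable.nonempty {G : GateSet} {k : ℕ} {U : Op (Fin k)}
    (h : ExactlyImplementable G U) : Nonempty (Implementation G U) := by
  obtain ⟨a, C, ζ, h, h'⟩ := h
  exact ⟨⟨a, C, ζ, h, h'⟩⟩

/-- The classical reversible transformation which adds a function of the other bits to the first
bit. -/
def xorPerm {k : ℕ} (f : (Fin k → Bool) → Bool) : Equiv.Perm (Fin (k + 1) → Bool) where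
  toFun z := Fin.cons (z 0 ^^ f (Fin.tail z)) (Fin.tail z)
  invFun z := Fin.cons (z 0 ^^ f (Fin.tail z)) (Fin.tail z)
  left_inv z := by simp
  right_inv z := by simp

section
variable {G : GateSet} {ι : Type} [Fintype ι] [DecidableEq ι] {k : ℕ}

/-- The specification concerns basis states with ancillas in |0⟩. By linearity it determines the
circuit on every state supported there, with all remaining qubits as spectators. -/
theorem Implementation.mulVec {U : Op (Fin k)} (I : Implementation G U)
    (e : Fin k ⊕ Fin I.anc ↪ ι) {ψ : (ι → Bool) → ℂ}
    (hψ : ∀ z, ψ z ≠ 0 → ∀ j, z (e (Sum.inr j)) = false) :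
    circuitOp (I.circuit.map (GateApp.relabel e)) *ᵥ ψ =
      I.phase • (onQubits (Function.Embedding.inl.trans e) U *ᵥ ψ) := by
  rw [circuitOp_relabel]
  funext x
  rw [onQubits_mulVec, Pi.smul_apply, onQubits_mulVec, smul_eq_mul,
    ← (Equiv.sumArrowEquivProdArrow (Fin k) (Fin I.anc) Bool).symm.sum_comp, Fintype.sum_prod_type,
    Finset.mul_sum]
  refine Finset.sum_congr rfl fun y _ => ?_
  have hx : (fun k => x (e k)) =
      Sum.elim (fun k => x (e (Sum.inl k))) (fun j => x (e (Sum.inr j))) := by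
    funext k; cases k <;> rfl
  rw [Finset.sum_eq_single (fun _ => false)]
  · change circuitOp I.circuit (fun k => x (e k)) (Sum.elim y fun _ => false) *
      ψ (Function.extend e (Sum.elim y fun _ => false) x) = _
    rw [hx, I.spec]
    split_ifs with h
    · have : Function.extend e (Sum.elim y fun _ => false) x =
          Function.extend (Function.Embedding.inl.trans e) y x := by
        funext i
        by_cases h₁ : ∃ k, e k = i
        · obtain ⟨k | j, rfl⟩ := h₁
          · rw [e.injective.extend_apply]
            exact ((Function.Embedding.inl.trans e).injective.extend_apply y x k).symm
          · rw [e.injective.extend_apply, Function.extend_apply']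
            · exact (congrFun h j).symm
            · rintro ⟨k, hk⟩
              simpa using e.injective hk
        · rw [Function.extend_apply' _ _ _ h₁, Function.extend_apply']
          rintro ⟨k, hk⟩
          exact h₁ ⟨Sum.inl k, hk⟩
      rw [this, mul_assoc]
      rfl
    · have : ψ (Function.extend (Function.Embedding.inl.trans e) y x) = 0 := by
        by_contra hne
        refine h (funext fun j => ?_)
        rw [← hψ _ hne j, Function.extend_apply']
        rintro ⟨k, hk⟩
        simpa using e.injective hk
      rw [this]
      simp
  · intro u _ hu
    have : ψ (Function.extend e
        ((Equiv.sumArrowEquivProdArrow (Fin k) (Fin I.anc) Bool).symm (y, u)) x) = 0 := by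
      by_contra hne
      refine hu (funext fun j => ?_)
      rw [← hψ _ hne j, e.injective.extend_apply]
      rfl
    rw [this, mul_zero]
  · simp

theorem classicalOp_mulVec {f : (Fin k → Bool) → Bool} (w : Fin (k + 1) ↪ ι)
    (ψ : (ι → Bool) → ℂ) (x : ι → Bool) :
    (onQubits w (classicalOp (xorPerm f)) *ᵥ ψ) x =
      ψ (Function.update x (w 0) (x (w 0) ^^ f fun i => x (w i.succ))) := by
  rw [onQubits_mulVec, Finset.sum_eq_single (xorPerm f fun k => x (w k))]
  · have h : (fun k => x (w k)) = xorPerm f (xorPerm f fun k => x (w k)) :=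
      ((xorPerm f).left_inv _).symm
    rw [classicalOp, Matrix.of_apply, if_pos h, one_mul]
    congr 1
    funext i
    by_cases hi : ∃ k, w k = i
    · obtain ⟨j, rfl⟩ := hi
      rw [w.injective.extend_apply]
      rcases Fin.eq_zero_or_eq_succ j with rfl | ⟨j, rfl⟩
      · rw [Function.update_self]; rfl
      · rw [Function.update_of_ne (by simp)]; rfl
    · rw [Function.extend_apply' _ _ _ hi, Function.update_of_ne]
      exact fun h => hi ⟨0, h.symm⟩
  · intro u _ hu
    rw [classicalOp, Matrix.of_apply, if_neg, zero_mul]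
    intro h
    exact hu (by rw [h]; exact ((xorPerm f).left_inv u).symm)
  · simp

/-- The gate permutes basis states up to a phase of modulus one, so its effect on an expectation is
a substitution in the measured function. -/
theorem weight_classical {f : (Fin k → Bool) → Bool}
    (I : Implementation G (classicalOp (xorPerm f))) (e : Fin (k + 1) ⊕ Fin I.anc ↪ ι)
    {ψ : (ι → Bool) → ℂ} (hψ : ∀ z, ψ z ≠ 0 → ∀ j, z (e (Sum.inr j)) = false)
    (g : (ι → Bool) → ℝ) :
    weight g (circuitOp (I.circuit.map (GateApp.relabel e)) *ᵥ ψ) =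
      weight (fun z => g (Function.update z (e (Sum.inl 0))
        (z (e (Sum.inl 0)) ^^ f fun i => z (e (Sum.inl i.succ))))) ψ := by
  rw [I.mulVec e hψ, weight_smul _ _ I.norm_phase]
  let τ : (ι → Bool) → ι → Bool := fun z => Function.update z (e (Sum.inl 0))
        (z (e (Sum.inl 0)) ^^ f fun i => z (e (Sum.inl i.succ)))
  have hτ : Function.Involutive τ := by
    intro z
    have : (fun i : Fin k => τ z (e (Sum.inl i.succ))) = fun i => z (e (Sum.inl i.succ)) :=
      funext fun i => Function.update_of_ne (by simp) ..
    simp only [τ] at this ⊢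
    rw [this]
    simp
  simp only [weight, classicalOp_mulVec]
  rw [← Equiv.sum_comp hτ.toPerm]
  refine Finset.sum_congr rfl fun z _ => ?_
  change g (τ z) * ‖ψ (τ (τ z))‖ ^ 2 = g (τ z) * ‖ψ z‖ ^ 2
  rw [hτ]

/-- Only the target bit can change. Hence ancillas return to |0⟩ and can be reused by the next gate,
and fresh qubits remain fresh. -/
theorem support_classical {f : (Fin k → Bool) → Bool}
    (I : Implementation G (classicalOp (xorPerm f))) (e : Fin (k + 1) ⊕ Fin I.anc ↪ ι)
    {ψ : (ι → Bool) → ℂ} (hψ : ∀ z, ψ z ≠ 0 → ∀ j, z (e (Sum.inr j)) = false)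
    {i : ι} (hi : i ≠ e (Sum.inl 0)) (h : ∀ z, ψ z ≠ 0 → z i = false) (z : ι → Bool)
    (hz : (circuitOp (I.circuit.map (GateApp.relabel e)) *ᵥ ψ) z ≠ 0) : z i = false := by
  rw [I.mulVec e hψ, Pi.smul_apply, classicalOp_mulVec] at hz
  have := h _ (right_ne_zero_of_smul hz)
  exact (Function.update_of_ne hi _ z).symm.trans this

theorem hadamard_mulVec (w : Fin 1 ↪ ι) {ψ : (ι → Bool) → ℂ}
    (hψ : ∀ z, ψ z ≠ 0 → z (w 0) = false) (x : ι → Bool) :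
    (onQubits w hadamard *ᵥ ψ) x =
      (Real.sqrt 2 : ℂ)⁻¹ * ψ (Function.update x (w 0) false) := by
  have h : ∀ b, Function.extend w (fun _ => b) x = Function.update x (w 0) b := by
    intro b
    funext i
    by_cases hi : i = w 0
    · subst hi; rw [w.injective.extend_apply]; simp
    · rw [Function.extend_apply', Function.update_of_ne hi]
      rintro ⟨k, hk⟩
      exact hi (by rw [← hk, Subsingleton.elim k 0])
  rw [onQubits_mulVec, Finset.sum_eq_single (fun _ => false)]
  · rw [h, hadamard]
    simp
  · intro u _ hu
    have hu' : u = fun _ => true := by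
      funext k
      by_contra hk
      refine hu (funext fun j => ?_)
      rw [Subsingleton.elim j k]
      simpa using hk
    have : ψ (Function.extend w u x) = 0 := by
      by_contra hne
      have := hψ _ hne
      rw [hu', h] at this
      simp at this
    rw [this, mul_zero]
  · simp

theorem sum_eq_sum_update (i : ι) (F : (ι → Bool) → ℝ) :
    ∑ x, F x = ∑ x, if x i = false then F x + F (Function.update x i true) else 0 := by
  let τ : (ι → Bool) → ι → Bool := fun z => Function.update z i (!z i)
  have hτ : Function.Involutive τ := by intro z; simp [τ]
  have h₁ : ∀ x, (if x i = false then F x + F (Function.update x i true) else 0) =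
      (if x i = false then F x else 0) + if x i = false then F (τ x) else 0 := by
    intro x
    split_ifs with h
    · simp [τ, h]
    · simp
  simp only [h₁, Finset.sum_add_distrib]
  rw [← Equiv.sum_comp hτ.toPerm fun x => if x i = false then F (τ x) else 0, ← Finset.sum_add_distrib]
  refine Finset.sum_congr rfl fun x _ => ?_
  change F x = (if x i = false then F x else 0) + if τ x i = false then F (τ (τ x)) else 0
  rw [hτ]
  cases h : x i <;> simp [τ, h]

/-- Pair each string with its flip at the coin. Before the gate only the string with coin 0 carries
amplitude; afterwards both carry it with factor 1/√2. With respect to measurement in the standard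
basis this is a fair coin. -/
theorem weight_hadamard (I : Implementation G hadamard) (e : Fin 1 ⊕ Fin I.anc ↪ ι)
    {ψ : (ι → Bool) → ℂ} (hψ : ∀ z, ψ z ≠ 0 → ∀ j, z (e (Sum.inr j)) = false)
    (hψ' : ∀ z, ψ z ≠ 0 → z (e (Sum.inl 0)) = false) (g : (ι → Bool) → ℝ) :
    weight g (circuitOp (I.circuit.map (GateApp.relabel e)) *ᵥ ψ) =
      weight (fun z => (g (Function.update z (e (Sum.inl 0)) false) +
        g (Function.update z (e (Sum.inl 0)) true)) / 2) ψ := by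
  rw [I.mulVec e hψ, weight_smul _ _ I.norm_phase]
  simp only [weight]
  rw [sum_eq_sum_update (e (Sum.inl 0))]
  refine Finset.sum_congr rfl fun x _ => ?_
  rw [hadamard_mulVec (Function.Embedding.inl.trans e) hψ',
    hadamard_mulVec (Function.Embedding.inl.trans e) hψ']
  have hs : ‖(Real.sqrt 2 : ℂ)⁻¹‖ ^ 2 = 1 / 2 := by
    rw [norm_inv, Complex.norm_real, Real.norm_of_nonneg (Real.sqrt_nonneg 2), inv_pow,
      Real.sq_sqrt (by norm_num)]
    norm_num
  have he : (Function.Embedding.inl.trans e : Fin 1 ↪ ι) 0 = e (Sum.inl 0) := rfl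
  rw [he]
  split_ifs with h
  · rw [Function.update_idem, ← h, Function.update_eq_self, norm_mul, mul_pow, hs]
    ring
  · have : ψ x = 0 := by
      by_contra hne
      exact h (hψ' x hne)
    simp [this]

theorem support_hadamard (I : Implementation G hadamard) (e : Fin 1 ⊕ Fin I.anc ↪ ι)
    {ψ : (ι → Bool) → ℂ} (hψ : ∀ z, ψ z ≠ 0 → ∀ j, z (e (Sum.inr j)) = false)
    (hψ' : ∀ z, ψ z ≠ 0 → z (e (Sum.inl 0)) = false)
    {i : ι} (hi : i ≠ e (Sum.inl 0)) (h : ∀ z, ψ z ≠ 0 → z i = false) (z : ι → Bool)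
    (hz : (circuitOp (I.circuit.map (GateApp.relabel e)) *ᵥ ψ) z ≠ 0) : z i = false := by
  rw [I.mulVec e hψ, Pi.smul_apply,
    hadamard_mulVec (Function.Embedding.inl.trans e) hψ'] at hz
  have := h _ (right_ne_zero_of_mul (right_ne_zero_of_smul hz))
  exact (Function.update_of_ne hi _ z).symm.trans this

end

/-! ### The final test -/

/-- The function which computes the next bit of a comparison. -/
def mixFn (a : Bool) (z : Fin 2 → Bool) : Bool := if a then z 0 || !z 1 else z 0 && !z 1

/-- The function which decides upon acceptance. -/
def acceptFn (z : Fin 4 → Bool) : Bool := !z 0 && if z 1 then z 2 else !z 3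

/-- Implementations of all gates of the final test. -/
structure TestKit (G : GateSet) where
  had : Implementation G hadamard
  mix : (a : Bool) → Implementation G (classicalOp (xorPerm (mixFn a)))
  accept : Implementation G (classicalOp (xorPerm acceptFn))

theorem Admissible.nonempty_testKit {G : GateSet} (hG : Admissible G) : Nonempty (TestKit G) :=
  ⟨⟨hG.1.nonempty.some, fun a => (hG.2 _ (xorPerm (mixFn a))).nonempty.some,
    (hG.2 _ (xorPerm acceptFn)).nonempty.some⟩⟩

/-- The number of ancilla qubits which suffices for all gates. -/
def TestKit.anc {G : GateSet} (T : TestKit G) : ℕ :=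
  T.had.anc + (T.mix false).anc + (T.mix true).anc + T.accept.anc

theorem TestKit.mix_anc_le {G : GateSet} (T : TestKit G) (a : Bool) : (T.mix a).anc ≤ T.anc := by
  cases a <;> simp only [anc] <;> omega

/-- The qubits of the final test: the new output qubit, the original output qubit, the qubit which
allows the prover to give up, ancillas, random bits, and the results of the comparisons. -/
inductive Slot (A m : ℕ) where
  | out
  | orig
  | flag
  | anc (j : Fin A)
  | coin (i : Fin (m + 1))
  | bit (i : Fin (m + 1))

/-- The shift of the random bits and comparison results by `i`. -/
def Slot.shift {A m K : ℕ} (i : ℕ) (h : i + m ≤ K) : Slot A m ↪ Slot A K where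
  toFun
    | .out => .out
    | .orig => .orig
    | .flag => .flag
    | .anc j => .anc j
    | .coin j => .coin ⟨i + j, by omega⟩
    | .bit j => .bit ⟨i + j, by omega⟩
  inj' := by
    rintro (_ | _ | _ | _ | _ | _) (_ | _ | _ | _ | _ | _) <;> simp [Fin.ext_iff]

section
variable {G : GateSet} (T : TestKit G)

/-- The qubits of the Hadamard gate. -/
def hadSlots : Fin 1 ⊕ Fin T.had.anc ↪ Slot T.anc 1 where
  toFun := Sum.elim (fun _ => .coin 1) fun j =>
    .anc (Fin.castLE (by simp only [TestKit.anc]; omega) j)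
  inj' := by
    rintro (i | i) (j | j) <;> simp [Fin.ext_iff]

/-- The qubits of the comparison gate. -/
def mixSlots (a : Bool) : Fin 3 ⊕ Fin (T.mix a).anc ↪ Slot T.anc 1 where
  toFun := Sum.elim ![.bit 1, .bit 0, .coin 1] fun j => .anc (Fin.castLE (T.mix_anc_le a) j)
  inj' := by
    rintro (i | i) (j | j)
    · fin_cases i <;> fin_cases j <;> simp
    · fin_cases i <;> simp
    · fin_cases j <;> simp
    · simp [Fin.ext_iff]

/-- The qubits of the gate which decides upon acceptance. -/
def acceptSlots : Fin 5 ⊕ Fin T.accept.anc ↪ Slot T.anc 0 where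
  toFun := Sum.elim ![.out, .flag, .coin 0, .orig, .bit 0] fun j =>
    .anc (Fin.castLE (by simp only [TestKit.anc]; omega) j)
  inj' := by
    rintro (i | i) (j | j)
    · fin_cases i <;> fin_cases j <;> simp
    · fin_cases i <;> simp
    · fin_cases j <;> simp
    · simp [Fin.ext_iff]

/-- One step of the comparison of a random number with a given number. -/
def stepCircuit (a : Bool) : Circuit G (Slot T.anc 1) :=
  T.had.circuit.map (GateApp.relabel (hadSlots T)) ++
    (T.mix a).circuit.map (GateApp.relabel (mixSlots T a))

/-- The decision upon acceptance. -/
def acceptCircuit : Circuit G (Slot T.anc 0) :=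
  T.accept.circuit.map (GateApp.relabel (acceptSlots T))

/-- The final test, from the comparison of bit `i` on; the given list holds the remaining bits. -/
def testCircuit {K : ℕ} : (l : List Bool) → (i : ℕ) → i + l.length = K → Circuit G (Slot T.anc K)
  | [], i, h => (acceptCircuit T).map (GateApp.relabel (Slot.shift i (by simpa using h.le)))
  | a :: l, i, h =>
    (stepCircuit T a).map
        (GateApp.relabel (Slot.shift i (by simp only [List.length_cons] at h; omega))) ++
      testCircuit l (i + 1) (by simp only [List.length_cons] at h; omega)

/-- The probability that the final test leads to acceptance, given the results of the last
comparison, the last random bit, the original output and the flag. -/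
noncomputable def testProb : List Bool → Bool → Bool → Bool → Bool → ℝ
  | [], b, h, o, f => if acceptFn ![f, h, o, b] then 1 else 0
  | a :: l, b, _, o, f =>
    (testProb l (mixFn a ![b, false]) false o f + testProb l (mixFn a ![b, true]) true o f) / 2

variable {ι : Type} [Fintype ι] [DecidableEq ι]

theorem relabel_relabel {κ κ' : Type} (e : κ ↪ κ') (e' : κ' ↪ ι) (C : Circuit G κ) :
    (C.map (GateApp.relabel e)).map (GateApp.relabel e') = C.map (GateApp.relabel (e.trans e')) :=
  List.map_map ..

theorem weight_step (a : Bool) (e : Slot T.anc 1 ↪ ι) {ψ : (ι → Bool) → ℂ}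
    (hanc : ∀ z, ψ z ≠ 0 → ∀ j, z (e (.anc j)) = false)
    (hcoin : ∀ z, ψ z ≠ 0 → z (e (.coin 1)) = false) (g : (ι → Bool) → ℝ) :
    weight g (circuitOp ((stepCircuit T a).map (GateApp.relabel e)) *ᵥ ψ) =
      weight (fun z =>
        (g (Function.update (Function.update z (e (.coin 1)) false) (e (.bit 1))
            (z (e (.bit 1)) ^^ mixFn a ![z (e (.bit 0)), false])) +
          g (Function.update (Function.update z (e (.coin 1)) true) (e (.bit 1))
            (z (e (.bit 1)) ^^ mixFn a ![z (e (.bit 0)), true]))) / 2) ψ := by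
  have h₁ : ∀ z, ψ z ≠ 0 → ∀ j, z (((hadSlots T).trans e) (Sum.inr j)) = false :=
    fun z hz j => hanc z hz _
  have h₂ : ∀ z, ψ z ≠ 0 → z (((hadSlots T).trans e) (Sum.inl 0)) = false :=
    fun z hz => hcoin z hz
  rw [stepCircuit, List.map_append, circuitOp_append, ← Matrix.mulVec_mulVec, relabel_relabel,
    relabel_relabel, weight_classical, weight_hadamard _ _ h₁ h₂]
  · refine congrArg (fun g => weight g ψ) (funext fun z => ?_)
    have hc : ((hadSlots T).trans e) (Sum.inl 0) = e (.coin 1) := rfl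
    have hb : ((mixSlots T a).trans e) (Sum.inl 0) = e (.bit 1) := rfl
    have hn : e (.bit 1) ≠ e (.coin 1) := fun h => by simpa using e.injective h
    have hn' : e (.bit 0) ≠ e (.coin 1) := fun h => by simpa using e.injective h
    have hf : ∀ b, (fun i : Fin 2 => Function.update z (e (.coin 1)) b
        (((mixSlots T a).trans e) (Sum.inl i.succ))) = ![z (e (.bit 0)), b] := by
      intro b
      funext i
      fin_cases i
      · exact Function.update_of_ne hn' ..
      · exact Function.update_self ..
    simp only [hc, hb, hf, Function.update_of_ne hn]
  · exact fun z hz j => support_hadamard _ _ h₁ h₂ (i := e (.anc _))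
      (fun h => by cases e.injective h) (fun z hz => hanc z hz _) z hz

theorem support_step (a : Bool) (e : Slot T.anc 1 ↪ ι) {ψ : (ι → Bool) → ℂ}
    (hanc : ∀ z, ψ z ≠ 0 → ∀ j, z (e (.anc j)) = false)
    (hcoin : ∀ z, ψ z ≠ 0 → z (e (.coin 1)) = false) {i : ι} (hi : i ≠ e (.coin 1))
    (hi' : i ≠ e (.bit 1)) (h : ∀ z, ψ z ≠ 0 → z i = false) (z : ι → Bool)
    (hz : (circuitOp ((stepCircuit T a).map (GateApp.relabel e)) *ᵥ ψ) z ≠ 0) : z i = false := by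
  have h₁ : ∀ z, ψ z ≠ 0 → ∀ j, z (((hadSlots T).trans e) (Sum.inr j)) = false :=
    fun z hz j => hanc z hz _
  have h₂ : ∀ z, ψ z ≠ 0 → z (((hadSlots T).trans e) (Sum.inl 0)) = false :=
    fun z hz => hcoin z hz
  rw [stepCircuit, List.map_append, circuitOp_append, ← Matrix.mulVec_mulVec, relabel_relabel,
    relabel_relabel] at hz
  refine support_classical _ _ ?_ hi' ?_ z hz
  · exact fun z hz j => support_hadamard _ _ h₁ h₂ (i := e (.anc _))
      (fun h => by cases e.injective h) (fun z hz => hanc z hz _) z hz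
  · exact support_hadamard _ _ h₁ h₂ hi h

/-- Each digit uses the fresh coin and the fresh bit number `i + 1` and only reads bit `i`. So the
induction needs |0⟩ just at the ancillas, the output, and the coins and bits beyond `i`, and the
steps average over one coin after another. -/
theorem weight_test {K : ℕ} (e : Slot T.anc K ↪ ι) (l : List Bool) (i : ℕ) (h : i + l.length = K)
    {ψ : (ι → Bool) → ℂ} (hanc : ∀ z, ψ z ≠ 0 → ∀ j, z (e (.anc j)) = false)
    (hout : ∀ z, ψ z ≠ 0 → z (e .out) = false)
    (hcoin : ∀ z, ψ z ≠ 0 → ∀ j : Fin (K + 1), i < j → z (e (.coin j)) = false)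
    (hbit : ∀ z, ψ z ≠ 0 → ∀ j : Fin (K + 1), i < j → z (e (.bit j)) = false) :
    weight (fun z => if z (e .out) = true then 1 else 0)
        (circuitOp ((testCircuit T l i h).map (GateApp.relabel e)) *ᵥ ψ) =
      weight (fun z => testProb l (z (e (.bit ⟨i, by omega⟩))) (z (e (.coin ⟨i, by omega⟩)))
        (z (e .orig)) (z (e .flag))) ψ := by
  induction l generalizing i ψ with
  | nil =>
    rw [testCircuit, acceptCircuit, relabel_relabel, relabel_relabel, weight_classical]
    · refine weight_congr fun z hz => ?_
      have hf : (fun j : Fin 4 => z (((acceptSlots T).trans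
          ((Slot.shift i (by simpa using h.le)).trans e)) (Sum.inl j.succ))) =
          ![z (e .flag), z (e (.coin ⟨i, by omega⟩)), z (e .orig), z (e (.bit ⟨i, by omega⟩))] := by
        funext j
        fin_cases j <;> rfl
      have ho : ((acceptSlots T).trans ((Slot.shift i (by simpa using h.le)).trans e))
          (Sum.inl 0) = e .out := rfl
      simp only [testProb]
      rw [hf, ho, hout z hz, Function.update_self, Bool.false_xor]
    · exact fun z hz j => hanc z hz _
  | cons a l ih =>
    have hK : i + 1 ≤ K := by simp only [List.length_cons] at h; omega
    have hanc' : ∀ z, ψ z ≠ 0 → ∀ j, z (((Slot.shift i hK).trans e) (.anc j)) = false :=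
      fun z hz j => hanc z hz j
    have hcoin' : ∀ z, ψ z ≠ 0 → z (((Slot.shift i hK).trans e) (.coin 1)) = false :=
      fun z hz => hcoin z hz ⟨i + 1, by omega⟩ (by simp)
    have supp : ∀ s : Slot T.anc K, s ≠ .coin ⟨i + 1, by omega⟩ → s ≠ .bit ⟨i + 1, by omega⟩ →
        (∀ z, ψ z ≠ 0 → z (e s) = false) → ∀ z,
        (circuitOp ((stepCircuit T a).map (GateApp.relabel ((Slot.shift i hK).trans e))) *ᵥ ψ) z
          ≠ 0 → z (e s) = false := fun s h₁ h₂ h₃ =>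
      support_step T a _ hanc' hcoin' (e.injective.ne h₁) (e.injective.ne h₂) h₃
    rw [testCircuit, List.map_append, circuitOp_append, ← Matrix.mulVec_mulVec, relabel_relabel,
      ih, weight_step T a _ hanc' hcoin']
    · refine weight_congr fun z hz => ?_
      have e₁ : ((Slot.shift i hK).trans e) (.coin 1) = e (.coin ⟨i + 1, by omega⟩) := rfl
      have e₂ : ((Slot.shift i hK).trans e) (.bit 1) = e (.bit ⟨i + 1, by omega⟩) := rfl
      have e₃ : ((Slot.shift i hK).trans e) (.bit 0) = e (.bit ⟨i, by omega⟩) := rfl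
      have hb := hbit z hz ⟨i + 1, by omega⟩ (by simp)
      have n₁ : e (.coin ⟨i + 1, by omega⟩) ≠ e (.bit ⟨i + 1, by omega⟩) :=
        e.injective.ne (by simp)
      have n₂ : e .orig ≠ e (.bit ⟨i + 1, by omega⟩) := e.injective.ne (by simp)
      have n₃ : e .orig ≠ e (.coin ⟨i + 1, by omega⟩) := e.injective.ne (by simp)
      have n₄ : e .flag ≠ e (.bit ⟨i + 1, by omega⟩) := e.injective.ne (by simp)
      have n₅ : e .flag ≠ e (.coin ⟨i + 1, by omega⟩) := e.injective.ne (by simp)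
      simp only [e₁, e₂, e₃, hb, Bool.false_xor, Function.update_self, Function.update_of_ne n₁,
        Function.update_of_ne n₂, Function.update_of_ne n₃, Function.update_of_ne n₄,
        Function.update_of_ne n₅, testProb]
    · exact fun z hz j => supp (.anc j) (by simp) (by simp) (fun z hz => hanc z hz j) z hz
    · exact supp .out (by simp) (by simp) hout
    · intro z hz j hj
      exact supp (.coin j) (by simp [Fin.ext_iff]; omega) (by simp)
        (fun z hz => hcoin z hz j (by omega)) z hz
    · intro z hz j hj
      exact supp (.bit j) (by simp) (by simp [Fin.ext_iff]; omega)
        (fun z hz => hbit z hz j (by omega)) z hz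

end

/-- The number with the given binary digits, the least significant one first. -/
def bitsValue : List Bool → ℕ
  | [] => 0
  | a :: l => a.toNat + 2 * bitsValue l

/-- The comparison bit says whether the number r formed by the coins so far is below the number
formed by the digits so far; `mixFn` updates this at the next more significant digit, and an initial
bit `b` amounts to raising the threshold by `b`. The last coin has two roles. If it is 1, `acceptFn`
consults the original output. If it is 0, then r is uniform below `2 ^ l.length`, and acceptance
means that r has reached the threshold. Truncated subtraction gives the right count 0 for thresholds
out of range. -/
theorem testProb_cons (a : Bool) (l : List Bool) (b h o f : Bool) :
    testProb (a :: l) b h o f = if f then 0 else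
      (if o then 1 else 0) / 2 +
        ((2 ^ l.length - (bitsValue (a :: l) + b.toNat) : ℕ) : ℝ) / 2 ^ l.length / 2 := by
  induction l generalizing a b h with
  | nil =>
    cases a <;> cases b <;> cases o <;> cases f <;>
      simp [testProb, mixFn, acceptFn, bitsValue]
    all_goals norm_num
  | cons a' l ih =>
    rw [testProb, ih, ih]
    cases f
    · simp only [Bool.false_eq_true, if_false]
      -- Count the numbers that reach the threshold according to their lowest bit: each value of
      -- that bit leaves a comparison of the higher digits with borrow `mixFn`.
      have key : ((2 ^ (a' :: l).length - (bitsValue (a :: a' :: l) + b.toNat) : ℕ) : ℝ) =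
          ((2 ^ l.length - (bitsValue (a' :: l) + (mixFn a ![b, false]).toNat) : ℕ) : ℝ) +
          ((2 ^ l.length - (bitsValue (a' :: l) + (mixFn a ![b, true]).toNat) : ℕ) : ℝ) := by
        norm_cast
        rw [bitsValue, List.length_cons, pow_succ]
        generalize 2 ^ l.length = M
        generalize bitsValue (a' :: l) = n
        cases a <;> cases b <;> simp [mixFn] <;> omega
      rw [key, List.length_cons, pow_succ]
      have : (2 : ℝ) ^ l.length ≠ 0 := by positivity
      field_simp
      ring
    · simp

end QuantumIP

/-! ### The extended verifier, pure initial states, and protocols embedded in more qubits. -/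

namespace QuantumIP

set_option linter.unusedSectionVars false

open Matrix

/-! ### The extended verifier -/

/-- The list of circuits with `X` appended to the last one. -/
def appendLast {G : GateSet} {ι : Type} (X : Circuit G ι) : List (Circuit G ι) → List (Circuit G ι)
  | [] => []
  | [C] => [C ++ X]
  | C :: C' :: L => C :: appendLast X (C' :: L)

section
variable {G : GateSet} {ι : Type} (X : Circuit G ι)

theorem length_appendLast (L : List (Circuit G ι)) : (appendLast X L).length = L.length := by
  induction L with
  | nil => rfl
  | cons C L ih => cases L <;> simp_all [appendLast]

theorem getD_appendLast (L : List (Circuit G ι)) (i : ℕ) (hi : i < L.length) :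
    (appendLast X L).getD i [] = L.getD i [] ++ if i + 1 = L.length then X else [] := by
  induction L generalizing i with
  | nil => simp at hi
  | cons C L ih =>
    cases L with
    | nil =>
      obtain rfl : i = 0 := by simpa using hi
      simp [appendLast]
    | cons C' L =>
      cases i with
      | zero => simp [appendLast]
      | succ i =>
        rw [appendLast, List.getD_cons_succ, List.getD_cons_succ, ih i (by simpa using hi)]
        simp

/-- A circuit is marked by an opening token and has no closing one, so appending gates to the last
circuit means appending their tokens to the whole string. -/
theorem flatMap_appendLast {v q : ℕ} (X : Circuit G (VerifierQubits v q))
    (L : List (Circuit G (VerifierQubits v q))) (hL : L ≠ []) :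
    (appendLast X L).flatMap encodeCircuit =
      L.flatMap encodeCircuit ++ X.flatMap encodeGateApp := by
  induction L with
  | nil => exact absurd rfl hL
  | cons C L ih =>
    cases L with
    | nil => simp [appendLast, encodeCircuit]
    | cons C' L => rw [appendLast, List.flatMap_cons, ih (by simp)]; simp

end

/-- The number of additional private qubits. -/
def extraQubits (A K : ℕ) : ℕ := 1 + A + 2 * (K + 1)

/-- The inclusion of the qubits of a verifier among those of the extended verifier. -/
def oldQubit (v q E : ℕ) : VerifierQubits v q ↪ VerifierQubits (v + E) (q + 1) :=
  (Fin.castAddEmb E).sumMap Fin.castSuccEmb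

/-- The qubits of the final test among those of the extended verifier. -/
def testQubit {v : ℕ} (q A K : ℕ) (o : Fin v) :
    Slot A K ↪ VerifierQubits (v + extraQubits A K) (q + 1) where
  toFun
    | .out => .inl (Fin.natAdd v ⟨0, by simp only [extraQubits]; omega⟩)
    | .orig => .inl (Fin.castAdd _ o)
    | .flag => .inr (Fin.last q)
    | .anc j => .inl (Fin.natAdd v ⟨1 + j, by simp only [extraQubits]; omega⟩)
    | .coin i => .inl (Fin.natAdd v ⟨1 + A + 2 * i, by simp only [extraQubits]; omega⟩)
    | .bit i => .inl (Fin.natAdd v ⟨1 + A + 2 * i + 1, by simp only [extraQubits]; omega⟩)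
  inj' := by
    have ho := o.isLt
    rintro (_ | _ | _ | _ | _ | _) (_ | _ | _ | _ | _ | _) h <;>
      simp only [Sum.inl.injEq, reduceCtorEq, Fin.ext_iff, Fin.val_natAdd, Fin.val_castAdd,
        Slot.anc.injEq, Slot.coin.injEq, Slot.bit.injEq] at h ⊢ <;> omega

/-- The verifier which, after the given one, performs the final test with the number whose binary
digits are given. -/
abbrev extendVerifier {G : GateSet} (T : TestKit G) (D : VerifierDescription G) (w : List Bool) :
    VerifierDescription G where
  privateQubits := D.privateQubits + extraQubits T.anc w.length
  messageQubits := D.messageQubits + 1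
  output := Fin.natAdd D.privateQubits ⟨0, by simp only [extraQubits]; omega⟩
  circuits := appendLast
    ((testCircuit T w 0 (Nat.zero_add _)).map
      (GateApp.relabel (testQubit D.messageQubits T.anc w.length D.output)))
    (D.circuits.map (List.map (GateApp.relabel (oldQubit _ _ _))))

/-! ### Pure initial states -/

section
variable {G : GateSet} (D : VerifierDescription G) (P : Prover D.messageQubits) (m : ℕ)

/-- The probability of acceptance with the (not necessarily normalized) initial state `v` of the
prover. -/
noncomputable def pureProb (v : (Fin P.privateQubits → Bool) → ℂ) : ℝ :=
  weight (fun z => if z (Sum.inl (Sum.inl D.output)) = true then 1 else 0)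
    (protocolOp D P m *ᵥ padVec Function.Embedding.inr v)

theorem initialState_vecMulVec (v : (Fin P.privateQubits → Bool) → ℂ) :
    initialState D P (vecMulVec v (star v)) =
      vecMulVec (padVec Function.Embedding.inr v) (star (padVec Function.Embedding.inr v)) := by
  have h : ∀ x : TotalQubits D P → Bool,
      (∀ i, (∀ k, (Function.Embedding.inr : Fin P.privateQubits ↪ TotalQubits D P) k ≠ i) →
        x i = false) ↔ ∀ i, x (Sum.inl i) = false := by
    intro x
    simp
  ext x y
  simp only [initialState, Matrix.of_apply, vecMulVec_apply, Pi.star_apply, padVec, h]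
  split_ifs with h₁ h₂ h₃ h₄ h₅ <;> simp_all

/-- Acceptance is linear in the initial state. This reduces density operators to unnormalized pure
states, for which the calculations below are made. -/
theorem acceptProb_sum {n : ℕ} (v : Fin n → (Fin P.privateQubits → Bool) → ℂ) :
    acceptProb D P m (∑ i, vecMulVec (v i) (star (v i))) = ∑ i, pureProb D P m (v i) := by
  have h : initialState D P (∑ i, vecMulVec (v i) (star (v i))) =
      ∑ i, initialState D P (vecMulVec (v i) (star (v i))) := by
    ext x y
    simp only [initialState, Matrix.of_apply, Matrix.sum_apply]
    split_ifs <;> simp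
  simp only [acceptProb, h, Matrix.mul_sum, Matrix.sum_mul, Matrix.sum_apply, pureProb, weight]
  rw [Complex.re_sum, Finset.sum_comm]
  refine Finset.sum_congr rfl fun z _ => ?_
  split_ifs
  · rw [Complex.re_sum]
    refine Finset.sum_congr rfl fun i _ => ?_
    rw [initialState_vecMulVec, mul_vecMulVec, vecMulVec_mul, ← Matrix.star_mulVec,
      vecMulVec_apply, Pi.star_apply, RCLike.star_def, Complex.mul_conj', one_mul]
    norm_cast
  · simp

theorem IsDensity.exists_eq_sum {r : ℕ} {ρ : Op (Fin r)} (hρ : IsDensity ρ) :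
    ∃ (n : ℕ) (v : Fin n → (Fin r → Bool) → ℂ), ρ = ∑ i, vecMulVec (v i) (star (v i)) ∧
      ∑ i, weight (fun _ => 1) (v i) = 1 := by
  obtain ⟨n, v, rfl⟩ := Matrix.posSemidef_iff_eq_sum_vecMulVec.mp hρ.1
  refine ⟨n, v, rfl, ?_⟩
  have := hρ.2
  rw [Matrix.trace_sum] at this
  have h : ((∑ i, weight (fun _ => 1) (v i) : ℝ) : ℂ) = 1 := by
    rw [← this, Complex.ofReal_sum]
    refine Finset.sum_congr rfl fun i _ => ?_
    rw [weight_one_eq, Matrix.trace_vecMulVec, dotProduct_comm]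
  exact_mod_cast h

theorem isDensity_sum {r n : ℕ} {v : Fin n → (Fin r → Bool) → ℂ}
    (h : ∑ i, weight (fun _ => 1) (v i) = 1) :
    IsDensity (∑ i, vecMulVec (v i) (star (v i))) := by
  refine ⟨Matrix.posSemidef_iff_eq_sum_vecMulVec.mpr ⟨n, v, rfl⟩, ?_⟩
  rw [Matrix.trace_sum]
  have h' : ((∑ i, weight (fun _ => 1) (v i) : ℝ) : ℂ) = 1 := by rw [h]; simp
  rw [← h', Complex.ofReal_sum]
  refine Finset.sum_congr rfl fun i _ => ?_
  rw [weight_one_eq, Matrix.trace_vecMulVec, dotProduct_comm]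

theorem padVec_smul {κ ι : Type} (w : κ ↪ ι) [Fintype κ] [DecidableEq κ] [Fintype ι]
    [DecidableEq ι] (a : ℂ) (φ : (κ → Bool) → ℂ) : padVec w (a • φ) = a • padVec w φ := by
  funext x
  simp [padVec]

theorem weight_smul' {ι : Type} [Fintype ι] [DecidableEq ι] (g : (ι → Bool) → ℝ) (a : ℂ)
    (ψ : (ι → Bool) → ℂ) : weight g (a • ψ) = ‖a‖ ^ 2 * weight g ψ := by
  simp only [weight, Finset.mul_sum]
  refine Finset.sum_congr rfl fun z _ => ?_
  simp only [Pi.smul_apply, smul_eq_mul, norm_mul]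
  ring

theorem pureProb_smul (a : ℂ) (v : (Fin P.privateQubits → Bool) → ℂ) :
    pureProb D P m (a • v) = ‖a‖ ^ 2 * pureProb D P m v := by
  rw [pureProb, padVec_smul, Matrix.mulVec_smul, weight_smul']
  rfl

theorem continuous_weight {ι : Type} [Fintype ι] [DecidableEq ι] (g : (ι → Bool) → ℝ) :
    Continuous (weight g) := by
  unfold weight
  fun_prop

theorem continuous_pureProb : Continuous (pureProb D P m) := by
  have h : Continuous (padVec (Function.Embedding.inr : Fin P.privateQubits ↪ TotalQubits D P)) := by
    refine continuous_pi fun x => ?_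
    unfold padVec
    split_ifs <;> fun_prop
  exact (continuous_weight _).comp (Continuous.matrix_mulVec continuous_const h)

/-- Some initial state is optimal. -/
theorem exists_optimal : ∃ v : (Fin P.privateQubits → Bool) → ℂ, weight (fun _ => 1) v = 1 ∧
    ∀ u, pureProb D P m u ≤ pureProb D P m v * weight (fun _ => 1) u := by
  let S : Set ((Fin P.privateQubits → Bool) → ℂ) := {v | weight (fun _ => 1) v = 1}
  have hS : IsCompact S := by
    refine Metric.isCompact_of_isClosed_isBounded
      (isClosed_eq (continuous_weight _) continuous_const) ?_
    refine (Metric.isBounded_closedBall (x := 0) (r := 1)).subset fun v hv => ?_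
    rw [mem_closedBall_zero_iff, pi_norm_le_iff_of_nonneg zero_le_one]
    intro z
    have h : ‖v z‖ ^ 2 ≤ weight (fun _ => 1) v := by
      simp only [weight, one_mul]
      exact Finset.single_le_sum (f := fun z => ‖v z‖ ^ 2) (fun _ _ => by positivity)
        (Finset.mem_univ z)
    rw [show weight (fun _ => 1) v = 1 from hv] at h
    exact (sq_le_one_iff₀ (norm_nonneg _)).mp h
  have hne : S.Nonempty := by
    refine ⟨Pi.single (fun _ => false) 1, ?_⟩
    change weight _ _ = 1
    rw [weight, Finset.sum_eq_single (fun _ => false)]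
    · simp
    · intro b _ hb
      simp [Pi.single_eq_of_ne hb]
    · simp
  obtain ⟨v, hv, hmax⟩ := hS.exists_isMaxOn hne (continuous_pureProb D P m).continuousOn
  refine ⟨v, hv, fun u => ?_⟩
  have h0 : 0 ≤ weight (fun _ => 1) u := Finset.sum_nonneg fun _ _ => by positivity
  rcases h0.eq_or_lt with h | h
  · have hu : u = 0 := by
      funext z
      have := (Finset.sum_eq_zero_iff_of_nonneg fun z _ => by positivity).mp h.symm z
        (Finset.mem_univ z)
      simpa using this
    rw [hu]
    have := pureProb_smul D P m 0 0
    simp only [smul_zero, norm_zero] at this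
    rw [this, ← hu, ← h]
    simp
  -- Normalization of `u`; both sides of the inequality are homogeneous of degree two.
  · set a : ℂ := (((Real.sqrt (weight (fun _ => 1) u))⁻¹ : ℝ) : ℂ) with ha
    have hn : ‖a‖ ^ 2 = (weight (fun _ => 1) u)⁻¹ := by
      rw [ha, Complex.norm_real, Real.norm_eq_abs, sq_abs, inv_pow, Real.sq_sqrt h0]
    have hm := hmax (show a • u ∈ S by
      change weight _ _ = 1
      rw [weight_smul', hn, inv_mul_cancel₀ h.ne'])
    change pureProb D P m (a • u) ≤ pureProb D P m v at hm
    rw [pureProb_smul, hn, inv_mul_le_iff₀ h] at hm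
    linarith

end

/-! ### Protocols on more qubits -/

section
variable {G : GateSet} {D D' : VerifierDescription G} {P : Prover D.messageQubits}
  {P' : Prover D'.messageQubits}

/-- `X` stands for what the verifier adds after its last turn, `R` for what the prover adds before
its first. Only `R` has to be moved, past the verifier's opening turn when `m` is even. -/
theorem protocolOp_extend {m : ℕ} (hm : 0 < m) (e : TotalQubits D P ↪ TotalQubits D' P')
    (X R : Op (TotalQubits D' P'))
    (hV : ∀ i ≤ m / 2, verifierOp D' P' i =
      (if i = m / 2 then X else 1) * onQubits e (verifierOp D P i))
    (hP : ∀ i, proverOp D' P' i = onQubits e (proverOp D P i) * if i = 0 then R else 1)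
    (hR : ∀ U, R * onQubits e U = onQubits e U * R) :
    protocolOp D' P' m = X * onQubits e (protocolOp D P m) * R := by
  have hT : 0 < (m + 1) / 2 := by omega
  have h0 : partialOp D' P' m 0 = onQubits e (partialOp D P m 0) := by
    simp only [partialOp]
    split_ifs with h
    -- For even `m > 0` the opening turn of the verifier is not its last, so `X` is absent here.
    · rw [hV 0 (by omega), if_neg (by rw [Nat.even_iff] at h; omega), one_mul]
    · rw [onQubits_one]
  -- For either parity, the verifier's turn that follows the prover's last one has index `m / 2`.
  have hV' : ∀ j < (m + 1) / 2, verifierOp D' P' (if Even m then j + 1 else j) =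
      (if j + 1 = (m + 1) / 2 then X else 1) *
        onQubits e (verifierOp D P (if Even m then j + 1 else j)) := by
    intro j hj
    rw [hV _ (by split_ifs with h <;> rw [Nat.even_iff] at h <;> omega)]
    congr 1
    refine if_congr ?_ rfl rfl
    split_ifs with h <;> rw [Nat.even_iff] at h <;> omega
  have key : ∀ j < (m + 1) / 2, partialOp D' P' m (j + 1) =
      (if j + 1 = (m + 1) / 2 then X else 1) * onQubits e (partialOp D P m (j + 1)) * R := by
    intro j hj
    induction j with
    | zero =>
      rw [partialOp, hV' _ hj, hP, if_pos rfl, h0, partialOp.eq_2 D P m 0, onQubits_mul,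
        onQubits_mul]
      simp only [Matrix.mul_assoc, hR]
    | succ j ih =>
      rw [partialOp, hV' _ hj, hP, if_neg (Nat.succ_ne_zero j), ih (by omega),
        if_neg (show ¬ j + 1 = (m + 1) / 2 by omega),
        partialOp.eq_2 D P m (j + 1), onQubits_mul, onQubits_mul]
      simp only [Matrix.mul_assoc, Matrix.one_mul]
  have := key ((m + 1) / 2 - 1) (by omega)
  rw [Nat.sub_add_cancel hT, if_pos rfl] at this
  exact this

end

end QuantumIP

/-! ### Acceptance by the extended verifier from pure initial states. -/

namespace QuantumIP

set_option linter.unusedSectionVars false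

open Matrix

/-! ### The acceptance probability of the extended verifier -/

/-- The probability that a random number of `w.length - 1` bits is at least the number with the
binary digits `w`. -/
noncomputable def testBias (w : List Bool) : ℝ :=
  ((2 ^ (w.length - 1) - bitsValue w : ℕ) : ℝ) / 2 ^ (w.length - 1)

theorem testProb_eq {w : List Bool} (hw : w ≠ []) (o f : Bool) :
    testProb w false false o f =
      if f then 0 else (if o then 1 else 0) / 2 + testBias w / 2 := by
  cases w with
  | nil => exact absurd rfl hw
  | cons a l => rw [testProb_cons, testBias]; simp

section
variable {κ ι : Type} [Fintype κ] [DecidableEq κ] [Fintype ι] [DecidableEq ι]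

theorem support_onQubits (w : κ ↪ ι) (U : Op κ) {ψ : (ι → Bool) → ℂ} {i : ι}
    (hi : ∀ k, w k ≠ i) (h : ∀ z, ψ z ≠ 0 → z i = false) (z : ι → Bool)
    (hz : (onQubits w U *ᵥ ψ) z ≠ 0) : z i = false := by
  rw [onQubits_mulVec] at hz
  obtain ⟨u, -, hu⟩ := Finset.exists_ne_zero_of_sum_ne_zero hz
  have := h _ (right_ne_zero_of_mul hu)
  rwa [Function.extend_apply' _ _ _ (by simpa using hi)] at this

theorem support_padVec (w : κ ↪ ι) {φ : (κ → Bool) → ℂ} {i : ι}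
    (hi : ∀ k, w k ≠ i) (z : ι → Bool) (hz : padVec w φ z ≠ 0) : z i = false := by
  by_contra h
  exact hz (if_neg fun h' => h (h' i hi))

/-- The unitary transformation which applies `U` to some of the qubits. -/
def liftUnitary (w : κ ↪ ι) (U : Matrix.unitaryGroup (κ → Bool) ℂ) :
    Matrix.unitaryGroup (ι → Bool) ℂ :=
  ⟨onQubits w U, onQubits_mem_unitaryGroup w U.2⟩

/-- A reflection of a single qubit. -/
noncomputable def reflection (a b : ℝ) : Op (Fin 1) :=
  Matrix.of fun x y => if x 0 = y 0 then (if x 0 then -(a : ℂ) else a) else b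

theorem reflection_mem_unitaryGroup {a b : ℝ} (h : a ^ 2 + b ^ 2 = 1) :
    reflection a b ∈ Matrix.unitaryGroup (Fin 1 → Bool) ℂ := by
  have h' : (a : ℂ) ^ 2 + (b : ℂ) ^ 2 = 1 := by exact_mod_cast h
  have h1 : ((a : ℂ) * a + b * b) = 1 := by rw [← h']; ring
  have h2 : ((b : ℂ) * b + a * a) = 1 := by rw [← h']; ring
  rw [Matrix.mem_unitaryGroup_iff]
  ext x y
  rw [Matrix.mul_apply, ← (Equiv.funUnique (Fin 1) Bool).symm.sum_comp]
  have hxy : x = y ↔ x 0 = y 0 :=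
    ⟨fun h => by rw [h], fun h => funext fun i => by rw [Subsingleton.elim i 0, h]⟩
  simp only [Fintype.sum_bool, Matrix.star_apply, reflection, Matrix.of_apply, Matrix.one_apply,
    hxy]
  cases x 0 <;> cases y 0 <;> simp [h1, h2] <;> ring

/-- The reflection sends |0⟩ to a|0⟩ + b|1⟩, and `g` ignores the second branch. -/
theorem weight_reflection (i : Fin 1 ↪ ι) (a b : ℝ) {ψ : (ι → Bool) → ℂ}
    (hψ : ∀ z, ψ z ≠ 0 → z (i 0) = false) {g : (ι → Bool) → ℝ}
    (hg : ∀ z, z (i 0) = true → g z = 0) :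
    weight g (onQubits i (reflection a b) *ᵥ ψ) = a ^ 2 * weight g ψ := by
  simp only [weight, Finset.mul_sum]
  refine Finset.sum_congr rfl fun z _ => ?_
  cases hz : z (i 0)
  · have : (onQubits i (reflection a b) *ᵥ ψ) z = a * ψ z := by
      rw [onQubits_mulVec, Finset.sum_eq_single (fun k => z (i k))]
      · rw [extend_eq_self]
        simp [reflection, hz]
      · intro u _ hu
        have h : ψ (Function.extend i u z) = 0 := by
          by_contra hne
          have := hψ _ hne
          rw [i.injective.extend_apply] at this
          refine hu (funext fun k => ?_)
          rw [Subsingleton.elim k 0, this, hz]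
        rw [h, mul_zero]
      · simp
    rw [this, norm_mul, mul_pow, Complex.norm_real, Real.norm_eq_abs, sq_abs]
    ring
  · simp [hg z hz]

end

section
variable {G : GateSet} (T : TestKit G) (D : VerifierDescription G) (w : List Bool)

/-- The operator of the final test. -/
def testOp (P' : Prover (extendVerifier T D w).messageQubits) :
    Op (TotalQubits (extendVerifier T D w) P') :=
  circuitOp ((testCircuit T w 0 (Nat.zero_add _)).map (GateApp.relabel
    ((testQubit D.messageQubits T.anc w.length D.output).trans Function.Embedding.inl)))

theorem verifierOp_extendVerifier {P : Prover D.messageQubits}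
    {P' : Prover (extendVerifier T D w).messageQubits}
    (e : TotalQubits D P ↪ TotalQubits (extendVerifier T D w) P')
    (he : ∀ i, e (Sum.inl i) = Sum.inl (oldQubit _ _ _ i)) {l i : ℕ}
    (hl : D.circuits.length = l + 1) (hi : i ≤ l) :
    verifierOp (extendVerifier T D w) P' i =
      (if i = l then testOp T D w P' else 1) * onQubits e (verifierOp D P i) := by
  have hi' : i < D.circuits.length := by omega
  have h₁ : (extendVerifier T D w).circuits.getD i [] =
      (D.circuits.getD i []).map (GateApp.relabel (oldQubit _ _ _)) ++
        if i = l then (testCircuit T w 0 (Nat.zero_add _)).map (GateApp.relabel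
          (testQubit D.messageQubits T.anc w.length D.output)) else [] := by
    refine (getD_appendLast _ _ _ (by simpa using hi')).trans ?_
    simp [hl, List.getElem?_eq_getElem hi']
  have h₂ : onQubits e (verifierOp D P i) = onQubits Function.Embedding.inl
      (circuitOp ((D.circuits.getD i []).map (GateApp.relabel
        (oldQubit D.privateQubits D.messageQubits (extraQubits T.anc w.length))))) := by
    rw [verifierOp, circuitOp_relabel, onQubits_onQubits, onQubits_onQubits]
    congr 1
    ext i : 1
    exact he i
  rw [h₂, verifierOp, h₁, circuitOp_append, onQubits_mul]
  congr 1
  split_ifs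
  · rw [← circuitOp_relabel, relabel_relabel]
    rfl
  · rw [circuitOp, onQubits_one]

/-- A digit is needed because the last coin also chooses between the two tests; all added private
qubits must still be in |0⟩ when the test begins. -/
theorem weight_testOp (hw : w ≠ []) (P' : Prover (extendVerifier T D w).messageQubits)
    {ψ : (TotalQubits (extendVerifier T D w) P' → Bool) → ℂ}
    (hψ : ∀ z, ψ z ≠ 0 → ∀ j : Fin (extraQubits T.anc w.length),
      z (Sum.inl (Sum.inl (Fin.natAdd D.privateQubits j))) = false) :
    weight (fun z => if z (Sum.inl (Sum.inl (extendVerifier T D w).output)) = true then 1 else 0)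
      (testOp T D w P' *ᵥ ψ) =
    weight (fun z => if z (Sum.inl (Sum.inr (Fin.last D.messageQubits))) then 0 else
      (if z (Sum.inl (Sum.inl (Fin.castAdd _ D.output))) then 1 else 0) / 2 + testBias w / 2) ψ := by
  have := weight_test T ((testQubit D.messageQubits T.anc w.length D.output).trans
    Function.Embedding.inl) w 0 (Nat.zero_add _) (ψ := ψ) (fun z hz j => hψ z hz _)
    (fun z hz => hψ z hz _) (fun z hz j _ => hψ z hz _) (fun z hz j _ => hψ z hz _)
  refine this.trans (weight_congr fun z hz => ?_)
  rw [← testProb_eq hw]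
  congr 1
  · exact hψ z hz _
  · exact hψ z hz _

end

section
variable {κ ι : Type} [Fintype κ] [DecidableEq κ] [Fintype ι] [DecidableEq ι]

theorem weight_affine (g : (ι → Bool) → ℝ) (t : ℝ) (ψ : (ι → Bool) → ℂ) :
    weight (fun z => g z / 2 + t / 2) ψ = weight g ψ / 2 + t / 2 * weight (fun _ => 1) ψ := by
  simp only [weight, Finset.mul_sum, Finset.sum_div, ← Finset.sum_add_distrib]
  exact Finset.sum_congr rfl fun z _ => by ring

theorem protocolOp_mem_unitaryGroup {G : GateSet} (D : VerifierDescription G)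
    (P : Prover D.messageQubits) (m : ℕ) :
    protocolOp D P m ∈ Matrix.unitaryGroup (TotalQubits D P → Bool) ℂ := by
  have hV : ∀ j, verifierOp D P j ∈ Matrix.unitaryGroup (TotalQubits D P → Bool) ℂ :=
    fun j => onQubits_mem_unitaryGroup _ (circuitOp_mem_unitaryGroup _)
  rw [protocolOp]
  induction (m + 1) / 2 with
  | zero =>
    rw [partialOp]
    split_ifs
    exacts [hV 0, one_mem _]
  | succ j ih =>
    exact mul_mem (mul_mem (hV _) (onQubits_mem_unitaryGroup _ (P.turn j).2)) ih

end

section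
variable {G : GateSet} (T : TestKit G) (D : VerifierDescription G) (w : List Bool)

/-- The constant part of the test contributes in proportion to the squared norm, which the unitary
protocol preserves. -/
theorem weight_padVec_accept {P : Prover D.messageQubits}
    {P' : Prover (extendVerifier T D w).messageQubits}
    (e : TotalQubits D P ↪ TotalQubits (extendVerifier T D w) P')
    (he : ∀ i, e (Sum.inl i) = Sum.inl (oldQubit _ _ _ i))
    (m : ℕ) (v : (Fin P.privateQubits → Bool) → ℂ) :
    weight (fun z => (if z (Sum.inl (Sum.inl (Fin.castAdd _ D.output))) then 1 else 0) / 2 +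
      testBias w / 2) (padVec e (protocolOp D P m *ᵥ padVec Function.Embedding.inr v)) =
    pureProb D P m v / 2 + testBias w / 2 * weight (fun _ => 1) v := by
  rw [weight_affine, weight_padVec, weight_padVec,
    weight_one_mulVec (protocolOp_mem_unitaryGroup D P m), weight_padVec, pureProb]
  congr 3
  funext y
  have : Function.extend e y (fun _ => false) (Sum.inl (Sum.inl (Fin.castAdd _ D.output))) =
      y (Sum.inl (Sum.inl D.output)) := by
    rw [← e.injective.extend_apply y (fun _ => false), he]
    rfl
  rw [this]

/-- The qubits of a prover of the extended verifier, with the additional message qubit regarded as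
private. -/
def absorbQubit (q r : ℕ) : Fin (q + 1) ⊕ Fin r ↪ Fin q ⊕ Fin (r + 1) where
  toFun := Sum.elim (Fin.lastCases (.inr 0) .inl) fun k => .inr k.succ
  inj' := by
    have h : ∀ (i : Fin (q + 1)) (k : Fin r),
        (Fin.lastCases (.inr 0) .inl i : Fin q ⊕ Fin (r + 1)) ≠ .inr k.succ := by
      intro i k
      refine Fin.lastCases ?_ (fun i => ?_) i
      · simpa using (Fin.succ_ne_zero k).symm
      · simp
    rintro (i | i) (j | j) hij
    · revert hij
      refine Fin.lastCases ?_ (fun i => ?_) i <;> refine Fin.lastCases ?_ (fun j => ?_) j <;>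
        simp
    · exact absurd hij (h i j)
    · exact absurd hij.symm (h j i)
    · simpa using hij

/-- The prover of the original verifier which simulates a prover of the extended one. -/
abbrev absorbProver (P' : Prover (extendVerifier T D w).messageQubits) : Prover D.messageQubits where
  privateQubits := P'.privateQubits + 1
  turn i := liftUnitary (absorbQubit D.messageQubits P'.privateQubits) (P'.turn i)

/-- The qubits of the protocol with the simulating prover. -/
def absorbEmb (v q r E : ℕ) :
    VerifierQubits v q ⊕ Fin (r + 1) ↪ VerifierQubits (v + E) (q + 1) ⊕ Fin r where
  toFun := Sum.elim (fun i => .inl (oldQubit v q E i)) (Fin.cases (.inl (.inr (Fin.last q))) .inr)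
  inj' := by
    have h : ∀ (i : VerifierQubits v q) (k : Fin (r + 1)),
        (.inl (oldQubit v q E i) : VerifierQubits (v + E) (q + 1) ⊕ Fin r) ≠
          Fin.cases (.inl (.inr (Fin.last q))) .inr k := by
      intro i k
      refine Fin.cases ?_ (fun k => ?_) k
      · rcases i with i | i <;> simp [oldQubit]
      · simp
    rintro (i | i) (j | j) hij
    · simpa using hij
    · exact absurd hij (h i j)
    · exact absurd hij.symm (h j i)
    · revert hij
      refine Fin.cases ?_ (fun i => ?_) i <;> refine Fin.cases ?_ (fun j => ?_) j <;> simp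

theorem castAdd_ne_natAdd {n E : ℕ} (i : Fin n) (j : Fin E) : Fin.castAdd E i ≠ Fin.natAdd n j := by
  intro h
  have h₁ := congrArg Fin.val h
  have h₂ := i.isLt
  simp only [Fin.val_castAdd, Fin.val_natAdd] at h₁
  omega

theorem absorbEmb_ne (v q r E : ℕ) (k : VerifierQubits v q ⊕ Fin (r + 1)) (j : Fin E) :
    absorbEmb v q r E k ≠ .inl (.inl (Fin.natAdd v j)) := by
  rcases k with (k | k) | k
  · exact fun h => castAdd_ne_natAdd k j (Sum.inl.inj (Sum.inl.inj h))
  · exact fun h => by cases Sum.inl.inj h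
  · change (Fin.cases (.inl (.inr (Fin.last q))) .inr k : VerifierQubits (v + E) (q + 1) ⊕ Fin r) ≠ _
    refine Fin.cases ?_ (fun k => ?_) k <;> simp

theorem absorbQubit_last (q r : ℕ) : absorbQubit q r (.inl (Fin.last q)) = .inr 0 := by
  change (Fin.lastCases (.inr 0) .inl (Fin.last q) : Fin q ⊕ Fin (r + 1)) = _
  rw [Fin.lastCases_last]

theorem absorbQubit_castSucc (q r : ℕ) (i : Fin q) :
    absorbQubit q r (.inl i.castSucc) = .inl i := by
  change (Fin.lastCases (.inr 0) .inl i.castSucc : Fin q ⊕ Fin (r + 1)) = _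
  rw [Fin.lastCases_castSucc]

theorem absorbEmb_absorbQubit (v q r E : ℕ) :
    (absorbQubit q r).trans ((Function.Embedding.sumMap Function.Embedding.inr
      (Function.Embedding.refl _)).trans (absorbEmb v q r E)) =
    Function.Embedding.sumMap Function.Embedding.inr (Function.Embedding.refl _) := by
  ext i : 1
  rcases i with i | i
  · refine Fin.lastCases ?_ (fun i => ?_) i
    · rw [Function.Embedding.trans_apply, absorbQubit_last]
      rfl
    · rw [Function.Embedding.trans_apply, absorbQubit_castSucc]
      rfl
  · rfl

/-- The simulating prover keeps the flag as its private qubit 0, started in |0⟩. The old verifier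
does not look at the flag, and this can only help the prover, whence an inequality. -/
theorem pureProb_extendVerifier_le (hw : w ≠ []) {m : ℕ} (hm : 0 < m)
    (hl : D.circuits.length = m / 2 + 1) (P' : Prover (extendVerifier T D w).messageQubits)
    (v : (Fin P'.privateQubits → Bool) → ℂ) :
    pureProb (extendVerifier T D w) P' m v ≤
      pureProb D (absorbProver T D w P') m (padVec (Fin.succEmb _) v) / 2 +
        testBias w / 2 * weight (fun _ => 1) v := by
  let e : TotalQubits D (absorbProver T D w P') ↪ TotalQubits (extendVerifier T D w) P' :=
    absorbEmb _ _ _ _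
  have he : ∀ i, e (Sum.inl i) = Sum.inl (oldQubit _ _ _ i) := fun _ => rfl
  have h := protocolOp_extend hm e (testOp T D w P') 1
    (fun i hi => verifierOp_extendVerifier T D w _ he hl hi)
    (fun i => by
      rw [ite_self, mul_one]
      change onQubits _ _ = onQubits e (onQubits _ (onQubits (absorbQubit _ _) _))
      rw [onQubits_onQubits, onQubits_onQubits]
      exact congrArg (fun w => onQubits w _) (absorbEmb_absorbQubit _ _ _ _).symm)
    (fun U => by rw [one_mul, mul_one])
  have hv : padVec Function.Embedding.inr v =
      padVec e (padVec Function.Embedding.inr (padVec (Fin.succEmb _) v)) := by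
    rw [padVec_padVec, padVec_padVec]
    rfl
  rw [pureProb, h, mul_one, ← Matrix.mulVec_mulVec, hv, onQubits_padVec, weight_testOp T D w hw,
    ← weight_padVec (Fin.succEmb P'.privateQubits) (fun _ => 1) v,
    ← weight_padVec_accept T D w e he]
  -- A raised flag contributes 0 on the left and a nonnegative amount on the right.
  · refine weight_mono fun z _ => ?_
    split_ifs <;> simp [testBias] <;> positivity
  · exact fun z hz j => support_padVec _ (fun k => absorbEmb_ne _ _ _ _ k j) z hz

/-- The additional message qubit. -/
def flagQubit (q r : ℕ) : Fin 1 ↪ Fin (q + 1) ⊕ Fin r :=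
  ⟨fun _ => .inl (Fin.last q), fun _ _ _ => Subsingleton.elim _ _⟩

/-- The prover of the extended verifier which gives up with a certain probability, and otherwise
acts like the given prover. -/
noncomputable abbrev rotateProver (P : Prover D.messageQubits) {a b : ℝ} (h : a ^ 2 + b ^ 2 = 1) :
    Prover (extendVerifier T D w).messageQubits where
  privateQubits := P.privateQubits
  turn i := liftUnitary (Fin.castSuccEmb.sumMap (Function.Embedding.refl _)) (P.turn i) *
    if i = 0 then liftUnitary (flagQubit _ _) ⟨reflection a b, reflection_mem_unitaryGroup h⟩
    else 1

/-- The qubits of a protocol of the original verifier among those of the extended one. -/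
def extendEmb (v q r E : ℕ) : VerifierQubits v q ⊕ Fin r ↪ VerifierQubits (v + E) (q + 1) ⊕ Fin r :=
  (oldQubit v q E).sumMap (Function.Embedding.refl _)

theorem extendEmb_ne_natAdd (v q r E : ℕ) (k : VerifierQubits v q ⊕ Fin r) (j : Fin E) :
    extendEmb v q r E k ≠ .inl (.inl (Fin.natAdd v j)) := by
  rcases k with (k | k) | k
  · exact fun h => castAdd_ne_natAdd k j (Sum.inl.inj (Sum.inl.inj h))
  · simp [extendEmb, oldQubit]
  · simp [extendEmb]

theorem extendEmb_ne_last (v q r E : ℕ) (k : VerifierQubits v q ⊕ Fin r) :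
    extendEmb v q r E k ≠ .inl (.inr (Fin.last q)) := by
  rcases k with (k | k) | k
  · simp [extendEmb, oldQubit]
  · simp [extendEmb, oldQubit]
  · simp [extendEmb]

/-- The embedded old protocol avoids the flag, so the reflection commutes with it and may be applied
just before the test, where it multiplies acceptance by `a ^ 2`. The factor is the same for every
initial state. -/
theorem pureProb_rotateProver (hw : w ≠ []) {m : ℕ} (hm : 0 < m)
    (hl : D.circuits.length = m / 2 + 1) (P : Prover D.messageQubits) {a b : ℝ}
    (h : a ^ 2 + b ^ 2 = 1) (v : (Fin P.privateQubits → Bool) → ℂ) :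
    pureProb (extendVerifier T D w) (rotateProver T D w P h) m v =
      a ^ 2 * (pureProb D P m v / 2 + testBias w / 2 * weight (fun _ => 1) v) := by
  let e : TotalQubits D P ↪ TotalQubits (extendVerifier T D w) (rotateProver T D w P h) :=
    extendEmb _ _ _ _
  have he : ∀ i, e (Sum.inl i) = Sum.inl (oldQubit _ _ _ i) := fun _ => rfl
  let f : Fin 1 ↪ TotalQubits (extendVerifier T D w) (rotateProver T D w P h) :=
    ⟨fun _ => .inl (.inr (Fin.last _)), fun _ _ _ => Subsingleton.elim _ _⟩
  have hR : ∀ U, onQubits f (reflection a b) * onQubits e U =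
      onQubits e U * onQubits f (reflection a b) := fun U =>
    onQubits_commute _ _ (fun _ k => (extendEmb_ne_last _ _ _ _ k).symm) _ _
  have hp := protocolOp_extend hm e (testOp T D w _) (onQubits f (reflection a b))
    (fun i hi => verifierOp_extendVerifier T D w _ he hl hi)
    (fun i => by
      have h₁ : onQubits e (proverOp D P i) =
          onQubits (Function.Embedding.sumMap Function.Embedding.inr (Function.Embedding.refl _))
            (onQubits (Fin.castSuccEmb.sumMap (Function.Embedding.refl (Fin P.privateQubits)))
              (P.turn i : Op _)) := by
        rw [proverOp, onQubits_onQubits, onQubits_onQubits]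
        congr 1
        ext i : 1
        rcases i with i | i <;> rfl
      rw [h₁, proverOp]
      change onQubits _ (_ * _) = _
      rw [onQubits_mul]
      congr 1
      split_ifs
      · change onQubits _ (onQubits (flagQubit _ _) _) = _
        rw [onQubits_onQubits]
        rfl
      · exact onQubits_one _)
    hR
  have hv : padVec Function.Embedding.inr v = padVec e (padVec Function.Embedding.inr v) := by
    rw [padVec_padVec]
    rfl
  rw [pureProb, hp, Matrix.mul_assoc, ← hR, ← Matrix.mulVec_mulVec, ← Matrix.mulVec_mulVec, hv,
    onQubits_padVec, weight_testOp T D w hw, weight_reflection,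
    ← weight_padVec_accept T D w e he]
  -- Before the reflection the flag lies outside the embedded qubits, hence is in |0⟩ on the
  -- support.
  · refine congrArg _ (weight_congr fun z hz => ?_)
    rw [support_padVec _ (extendEmb_ne_last _ _ _ _) z hz]
    simp
  · exact support_padVec _ (extendEmb_ne_last _ _ _ _)
  · intro z hz
    exact if_pos hz
  · intro z hz j
    refine support_onQubits _ _ (fun k h => by cases Sum.inl.inj h) (fun z hz => ?_) z hz
    exact support_padVec _ (fun k => extendEmb_ne_natAdd _ _ _ _ k j) z hz

end

end QuantumIP

/-! ### Mixed initial states, the value exactly 1/2, and the rounding of the threshold. -/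

namespace QuantumIP

set_option linter.unusedSectionVars false

open Matrix

section
variable {G : GateSet} (T : TestKit G) (D : VerifierDescription G) {w : List Bool}

/-- The simulating prover does not depend on the initial state. The padded pure components of `ρ`
thus form a single density operator for it, to which the old soundness applies. -/
theorem acceptProb_extendVerifier_le (hw : w ≠ []) {m : ℕ} (hm : 0 < m)
    (hl : D.circuits.length = m / 2 + 1) {s : ℝ}
    (hs : ∀ (P : Prover D.messageQubits) (ρ : Op (Fin P.privateQubits)), IsDensity ρ →
      acceptProb D P m ρ ≤ s)
    (P' : Prover (extendVerifier T D w).messageQubits) (ρ : Op (Fin P'.privateQubits))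
    (hρ : IsDensity ρ) :
    acceptProb (extendVerifier T D w) P' m ρ ≤ s / 2 + testBias w / 2 := by
  obtain ⟨n, v, rfl, hv⟩ := hρ.exists_eq_sum
  rw [acceptProb_sum]
  let v' : Fin n → (Fin (absorbProver T D w P').privateQubits → Bool) → ℂ :=
    fun i => padVec (Fin.succEmb P'.privateQubits) (v i)
  have hv' : ∑ i, weight (fun _ => 1) (v' i) = 1 := by
    exact (Finset.sum_congr rfl fun i _ => weight_padVec (Fin.succEmb P'.privateQubits) _ _).trans hv
  have h := hs (absorbProver T D w P') _ (isDensity_sum hv')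
  rw [acceptProb_sum] at h
  calc ∑ i, pureProb (extendVerifier T D w) P' m (v i)
      ≤ ∑ i, (pureProb D (absorbProver T D w P') m (v' i) / 2 +
          testBias w / 2 * weight (fun _ => 1) (v i)) :=
        Finset.sum_le_sum fun i _ => pureProb_extendVerifier_le T D w hw hm hl P' (v i)
    _ = (∑ i, pureProb D (absorbProver T D w P') m (v' i)) / 2 + testBias w / 2 := by
        rw [Finset.sum_add_distrib, ← Finset.sum_div, ← Finset.mul_sum, hv, mul_one]
    _ ≤ s / 2 + testBias w / 2 := by linarith

theorem exists_isGreatest_acceptProb (hw : w ≠ []) {m : ℕ} (hm : 0 < m)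
    (hl : D.circuits.length = m / 2 + 1) {c : ℝ} (hc : 1 - c ≤ testBias w)
    (h : ∃ (P : Prover D.messageQubits) (ρ : Op (Fin P.privateQubits)), IsDensity ρ ∧
      c ≤ acceptProb D P m ρ) :
    ∃ P' : Prover (extendVerifier T D w).messageQubits,
      IsGreatest {p : ℝ | ∃ ρ : Op (Fin P'.privateQubits), IsDensity ρ ∧
        p = acceptProb (extendVerifier T D w) P' m ρ} (1 / 2) := by
  obtain ⟨P, ρ, hρ, hcρ⟩ := h
  obtain ⟨v, hv, hmax⟩ := exists_optimal D P m
  have bound : ∀ {n : ℕ} (u : Fin n → (Fin P.privateQubits → Bool) → ℂ),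
      ∑ i, weight (fun _ => 1) (u i) = 1 → ∑ i, pureProb D P m (u i) ≤ pureProb D P m v := by
    intro n u hu
    calc ∑ i, pureProb D P m (u i) ≤ ∑ i, pureProb D P m v * weight (fun _ => 1) (u i) :=
          Finset.sum_le_sum fun i _ => hmax (u i)
      _ = pureProb D P m v := by rw [← Finset.mul_sum, hu, mul_one]
  -- Without giving up, the best initial state is accepted with probability `L / 2`. Since `L ≥ 1`,
  -- the number `1 / L` is a possible probability of not giving up, and it scales `L / 2` to 1/2.
  set L : ℝ := pureProb D P m v + testBias w with hL
  have hL1 : 1 ≤ L := by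
    obtain ⟨n, u, rfl, hu⟩ := hρ.exists_eq_sum
    rw [acceptProb_sum] at hcρ
    have := bound u hu
    linarith
  have hL0 : L ≠ 0 := by linarith
  have ha : Real.sqrt (1 / L) ^ 2 = 1 / L := Real.sq_sqrt (by positivity)
  have hb : Real.sqrt (1 / L) ^ 2 + Real.sqrt (1 - 1 / L) ^ 2 = 1 := by
    rw [ha, Real.sq_sqrt]
    · ring
    · rw [sub_nonneg, div_le_one (by linarith)]
      exact hL1
  -- The state that is optimal for `P` stays optimal after the uniform scaling; it is written as a
  -- sum with one term to fit `acceptProb_sum`.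
  refine ⟨rotateProver T D w P hb, ⟨∑ i : Fin 1, vecMulVec v (star v), ?_, ?_⟩, ?_⟩
  · exact isDensity_sum (v := fun _ : Fin 1 => v) (by simpa using hv)
  · refine Eq.trans ?_ (acceptProb_sum _ (rotateProver T D w P hb) m (fun _ : Fin 1 => v)).symm
    rw [Fin.sum_univ_one, pureProb_rotateProver T D w hw hm hl P hb, ha, hv]
    rw [show pureProb D P m v / 2 + testBias w / 2 * 1 = L / 2 by rw [hL]; ring]
    field_simp
  · rintro p ⟨ρ', hρ', rfl⟩
    obtain ⟨n, u, rfl, hu⟩ := hρ'.exists_eq_sum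
    rw [acceptProb_sum]
    have h₁ : ∀ i, pureProb (extendVerifier T D w) (rotateProver T D w P hb) m (u i) =
        1 / L * (pureProb D P m (u i) / 2 + testBias w / 2 * weight (fun _ => 1) (u i)) := by
      intro i
      refine (pureProb_rotateProver T D w hw hm hl P hb (u i)).trans ?_
      rw [ha]
    rw [Finset.sum_congr rfl fun i _ => h₁ i, ← Finset.mul_sum, Finset.sum_add_distrib,
      ← Finset.sum_div, ← Finset.mul_sum, hu, mul_one]
    have := bound u hu
    calc 1 / L * ((∑ i, pureProb D P m (u i)) / 2 + testBias w / 2) ≤ 1 / L * (L / 2) := by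
          refine mul_le_mul_of_nonneg_left ?_ (by positivity)
          linarith
      _ = 1 / 2 := by field_simp

end

/-! ### The choice of the threshold -/

/-- The approximation `a` is within 1 of `c * 2 ^ k`. Using `a - 1` as threshold makes the error
one-sided: the bias is never below `1 - c`, at the price of an excess of at most two units. -/
theorem testBias_bounds {c : ℝ} (hc : c ∈ Set.Icc (0 : ℝ) 1) {a k : ℕ} {w : List Bool}
    (hw : w.length = k + 1) (hv : bitsValue w = a - 1)
    (ha : |(a : ℝ) / 2 ^ k - c| ≤ 1 / 2 ^ k) :
    1 - c ≤ testBias w ∧ testBias w ≤ 1 - c + 2 / 2 ^ k := by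
  have h2 : (0 : ℝ) < 2 ^ k := by positivity
  have hmul : (a : ℝ) / 2 ^ k * 2 ^ k = a := by field_simp
  rw [abs_le] at ha
  have h₁ : (a : ℝ) ≤ c * 2 ^ k + 1 := by
    have : (a : ℝ) / 2 ^ k ≤ c + 1 / 2 ^ k := by linarith
    rw [← hmul]
    calc _ ≤ (c + 1 / 2 ^ k) * 2 ^ k := mul_le_mul_of_nonneg_right this h2.le
      _ = _ := by field_simp
  have h₂ : c * 2 ^ k - 1 ≤ a := by
    have : c - 1 / 2 ^ k ≤ (a : ℝ) / 2 ^ k := by linarith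
    rw [← hmul]
    calc _ = (c - 1 / 2 ^ k) * 2 ^ k := by field_simp
      _ ≤ _ := mul_le_mul_of_nonneg_right this h2.le
  have hc' : c * 2 ^ k ≤ 2 ^ k := by nlinarith [hc.2]
  have ha' : a ≤ 2 ^ k + 1 := by
    have : (a : ℝ) ≤ ((2 ^ k + 1 : ℕ) : ℝ) := by push_cast; linarith
    exact_mod_cast this
  rw [testBias, hw, hv, Nat.add_sub_cancel]
  have e : ((2 ^ k - (a - 1) : ℕ) : ℝ) = 2 ^ k - ((a - 1 : ℕ) : ℝ) := by
    rw [Nat.cast_sub (by have := Nat.one_le_two_pow (n := k); omega)]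
    push_cast
    rfl
  rw [e, le_div_iff₀ h2, div_le_iff₀ h2]
  have e' : (1 - c + 2 / 2 ^ k) * 2 ^ k = 2 ^ k - c * 2 ^ k + 2 := by field_simp
  rw [e']
  -- For `a = 0` the threshold is 0 instead of -1; this is harmless because then `0 ≤ c * 2 ^ k ≤
  -- 1`.
  rcases Nat.eq_zero_or_pos a with rfl | h
  · have : 0 ≤ c * 2 ^ k := mul_nonneg hc.1 h2.le
    simp only [Nat.zero_sub, Nat.cast_zero] at h₁ h₂ ⊢
    constructor <;> nlinarith
  · rw [Nat.cast_sub h, Nat.cast_one]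
    constructor <;> nlinarith

/-- Rounding may push `a` up to `2 ^ k + 1`, which still fits into `k + 1` digits as soon as `k >
0`. -/
theorem lt_two_pow_of_abs_sub_le {c : ℝ} (hc : c ∈ Set.Icc (0 : ℝ) 1) {a k : ℕ} (hk : 0 < k)
    (ha : |(a : ℝ) / 2 ^ k - c| ≤ 1 / 2 ^ k) : a < 2 ^ (k + 1) := by
  have h2 : (0 : ℝ) < 2 ^ k := by positivity
  rw [abs_le] at ha
  have h₁ : (a : ℝ) / 2 ^ k ≤ 1 + 1 / 2 ^ k := by linarith [hc.2]
  rw [div_le_iff₀ h2, add_mul, one_div_mul_cancel h2.ne', one_mul] at h₁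
  have h₂ : a ≤ 2 ^ k + 1 := by exact_mod_cast h₁
  have h₃ : 1 < 2 ^ k := Nat.one_lt_two_pow hk.ne'
  rw [pow_succ]
  omega

theorem four_mul_le_two_pow (p : ℕ) : 4 * p ≤ 2 ^ (p + 2) := by
  have := Nat.lt_two_pow_self (n := p)
  rw [pow_add]
  omega

/-- With `p + 2` bits the excess of the bias is at most 1/(2p) ≤ (c - s)/2. The test halves it, so
(c - s)/4 of the margin (c - s)/2 is lost. -/
theorem soundness_bound {c s : ℝ} {p : ℕ} (hp : 0 < p) (hgap : 1 / (p : ℝ) ≤ c - s) {t : ℝ}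
    (ht : t ≤ 1 - c + 2 / 2 ^ (p + 2)) : s / 2 + t / 2 ≤ 1 / 2 - (c - s) / 4 := by
  have h : ((4 * p : ℕ) : ℝ) ≤ ((2 ^ (p + 2) : ℕ) : ℝ) := by exact_mod_cast four_mul_le_two_pow p
  push_cast at h
  have hp' : (0 : ℝ) < p := by exact_mod_cast hp
  have : (2 : ℝ) / 2 ^ (p + 2) ≤ 1 / p / 2 := by
    rw [div_div, div_le_div_iff₀ (by positivity) (by positivity)]
    linarith
  linarith

end QuantumIP

/-! ### Polynomial-time computation of the digits of the threshold. -/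

namespace QuantumIP

set_option linter.unusedSectionVars false

open Computability

/-! ### Some polynomial-time transformations of strings -/

theorem unaryEncodeNat_eq (n : ℕ) : unaryEncodeNat n = List.replicate n true := by
  induction n with
  | zero => rfl
  | succ n ih => rw [unaryEncodeNat, ih, List.replicate_succ]

section
variable {α β J : Type} [DecidableEq J]

/-- The transducer with a single state. -/
def simpleTransducer (f : α → List (CounterCmd J β)) (g : List (CounterCmd J β)) :
    CounterTransducer α β J Unit where
  init := ()
  step _ a := ((), f a)
  final _ := g

theorem output_simpleTransducer (f : α → List (CounterCmd J β)) (g : List (CounterCmd J β))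
    (l : List α) : (simpleTransducer f g).output l = (execCmds (l.flatMap f ++ g) 0).2 := by
  have : ∀ c, (simpleTransducer f g).run () c l = (execCmds (l.flatMap f ++ g) c).2 := by
    induction l with
    | nil => exact fun c => rfl
    | cons a l ih =>
      intro c
      rw [List.flatMap_cons, List.append_assoc, execCmds_append, ← ih]
      rfl
  exact this 0

theorem execCmds_flatMap_of_const {γ : Type} {f : γ → List (CounterCmd J β)} {g : γ → List β}
    {c : J → ℕ} {l : List γ} (h : ∀ a ∈ l, execCmds (f a) c = (c, g a)) :
    execCmds (l.flatMap f) c = (c, l.flatMap g) := by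
  induction l with
  | nil => rfl
  | cons a l ih =>
    rw [List.flatMap_cons, execCmds_append, h a (by simp), ih fun a ha => h a (by simp [ha])]
    rfl

theorem execCmds_replicate_emit (n : ℕ) (b : β) (c : J → ℕ) :
    execCmds (List.replicate n (.emit b)) c = (c, List.replicate n b) := by
  induction n with
  | zero => rfl
  | succ n ih => rw [List.replicate_succ, execCmds, CounterCmd.exec, ih]; rfl

theorem execCmds_replicate_inc (n : ℕ) (j : J) (c : J → ℕ) :
    execCmds (List.replicate n (.inc j : CounterCmd J β)) c =
      (Function.update c j (c j + n), []) := by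
  induction n generalizing c with
  | zero => simp [execCmds]
  | succ n ih =>
    rw [List.replicate_succ, execCmds, CounterCmd.exec, ih]
    simp [add_assoc, add_comm 1]

end

/-- Subtraction of a bit from the number with the given binary digits. -/
def subBit : Bool → List Bool → List Bool
  | _, [] => []
  | b, d :: l => (d ^^ b) :: subBit (b && !d) l

/-- The binary digits of `a - 1`, padded to the given length. -/
def predDigits (K a : ℕ) : List Bool :=
  subBit true (encodeNat a) ++ List.replicate (K - (encodeNat a).length) false

theorem length_subBit (b : Bool) (l : List Bool) : (subBit b l).length = l.length := by
  induction l generalizing b with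
  | nil => rfl
  | cons d l ih => simp [subBit, ih]

/-- The bit is a borrow, passed on as long as the digits are 0; the hypothesis guarantees that some
digit absorbs it. -/
theorem bitsValue_subBit (b : Bool) (l : List Bool) (h : b.toNat ≤ bitsValue l) :
    bitsValue (subBit b l) = bitsValue l - b.toNat := by
  induction l generalizing b with
  | nil => simp_all [subBit, bitsValue]
  | cons d l ih =>
    rw [bitsValue] at h ⊢
    rw [subBit, bitsValue, ih]
    · cases b <;> cases d <;> simp at h ⊢ <;> omega
    · cases b <;> cases d <;> simp at h ⊢ <;> omega

theorem bitsValue_append_zeros (l : List Bool) (n : ℕ) :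
    bitsValue (l ++ List.replicate n false) = bitsValue l := by
  induction l with
  | nil =>
    induction n with
    | zero => rfl
    | succ n ih =>
      rw [List.nil_append] at ih ⊢
      change 0 + 2 * bitsValue (List.replicate n false) = 0
      rw [ih]
      rfl
  | cons d l ih => rw [List.cons_append, bitsValue, ih, bitsValue]

theorem bitsValue_encodePosNum (n : PosNum) : bitsValue (encodePosNum n) = n := by
  induction n with
  | one => rfl
  | bit0 n ih => rw [encodePosNum, bitsValue, ih, PosNum.cast_bit0]; simp [two_mul]
  | bit1 n ih => rw [encodePosNum, bitsValue, ih, PosNum.cast_bit1]; simp [two_mul, add_comm]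

theorem bitsValue_encodeNat (n : ℕ) : bitsValue (encodeNat n) = n := by
  conv_rhs => rw [← Num.to_of_nat n]
  rw [encodeNat]
  cases (n : Num) with
  | zero => rfl
  | pos p => exact bitsValue_encodePosNum p

theorem two_pow_length_encodePosNum_le (n : PosNum) :
    2 ^ (encodePosNum n).length ≤ 2 * bitsValue (encodePosNum n) := by
  induction n with
  | one => rfl
  | bit0 n ih => rw [encodePosNum, bitsValue, List.length_cons, pow_succ, Bool.toNat_false]; omega
  | bit1 n ih => rw [encodePosNum, bitsValue, List.length_cons, pow_succ, Bool.toNat_true]; omega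

theorem length_encodeNat_le {n K : ℕ} (h : n < 2 ^ K) : (encodeNat n).length ≤ K := by
  by_contra! hK
  have h₁ : 2 ^ (encodeNat n).length ≤ 2 * bitsValue (encodeNat n) := by
    revert hK
    rw [encodeNat]
    cases (n : Num) with
    | zero => intro hK; exact absurd hK (Nat.not_lt_zero K)
    | pos p => exact fun _ => two_pow_length_encodePosNum_le p
  have h₂ : 2 ^ (K + 1) ≤ 2 ^ (encodeNat n).length := Nat.pow_le_pow_right (by norm_num) hK
  rw [bitsValue_encodeNat] at h₁
  rw [pow_succ] at h₂
  omega

theorem length_predDigits {K a : ℕ} (h : a < 2 ^ K) : (predDigits K a).length = K := by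
  have := length_encodeNat_le h
  rw [predDigits, List.length_append, length_subBit, List.length_replicate]
  omega

theorem bitsValue_predDigits (K a : ℕ) : bitsValue (predDigits K a) = a - 1 := by
  rw [predDigits, bitsValue_append_zeros]
  rcases Nat.eq_zero_or_pos a with rfl | h
  · rfl
  · rw [bitsValue_subBit _ _ (by rw [bitsValue_encodeNat]; exact h), bitsValue_encodeNat,
      Bool.toNat_true]

section
variable {X α : Type} {ea : X → List α}

theorem PolyTime.congr {β : Type} {F H : X → List β} (h : PolyTime ea F) (hFH : ∀ x, F x = H x) :
    PolyTime ea H :=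
  (funext hFH : F = H) ▸ h

theorem PolyTime.transducer {β γ J σ : Type} [DecidableEq J] [Fintype J] [Fintype β] [Inhabited β]
    [Fintype γ] [Inhabited γ] [Fintype σ] {F : X → List β} (h : PolyTime ea F)
    (T : CounterTransducer β γ J σ) {H : X → List γ} (hH : ∀ x, T.output (F x) = H x) :
    PolyTime ea H :=
  PolyTime.congr (h.comp (polyTime_transducer T) F fun _ => rfl) hH

theorem PolyTime.length_add {β : Type} [Inhabited β] [Fintype β] {F : X → List β}
    (h : PolyTime ea F) (k : ℕ) : PolyTime ea fun x => unaryEncodeNat ((F x).length + k) := by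
  let T : CounterTransducer β Bool Empty Unit :=
    simpleTransducer (fun _ => [.emit true]) (List.replicate k (.emit true))
  refine h.transducer T fun x => ?_
  rw [output_simpleTransducer, execCmds_append,
    execCmds_flatMap_of_const (g := fun _ => [true]) fun _ _ => rfl, execCmds_replicate_emit,
    unaryEncodeNat_eq, List.replicate_add]
  refine congrArg (fun l => l ++ List.replicate k true) ?_
  generalize F x = l
  induction l with
  | nil => rfl
  | cons a l ih => simpa [List.replicate_succ] using ih

variable [Inhabited α] [Fintype α] {k : X → ℕ}

/-- The block of length `k x + 1` is read before the block that must be written first, so it is kept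
in a counter. The hypothesis has `k x + 1` so that one string can supply both the number of digits
and, after `dec`, the precision. -/
theorem PolyTime.unaryPair (h : PolyTime ea fun x => unaryEncodeNat (k x + 1)) {n : X → ℕ}
    (h' : PolyTime ea fun x => unaryEncodeNat (n x)) :
    PolyTime ea fun x => unaryPair (n x, k x) := by
  let T : CounterTransducer (Bool ⊕ Bool) Bool Unit Unit :=
    simpleTransducer (Sum.elim (fun _ => [.inc ()]) fun _ => [.emit true])
      [.emit false, .dec (), .copy () true]
  refine (h.pair h').transducer T fun x => ?_
  rw [output_simpleTransducer, unaryEncodeNat_eq, unaryEncodeNat_eq, List.map_replicate,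
    List.map_replicate, List.flatMap_append, List.append_assoc, QuantumIP.unaryPair,
    unaryEncodeNat_eq, unaryEncodeNat_eq]
  have e₁ : ∀ n : ℕ, (List.replicate n (Sum.inl true : Bool ⊕ Bool)).flatMap
      (Sum.elim (fun _ => [.inc ()]) fun _ => [.emit true] : _ → List (CounterCmd Unit Bool)) =
      List.replicate n (.inc ()) := fun n => by
    induction n with
    | zero => rfl
    | succ n ih => rw [List.replicate_succ, List.flatMap_cons, ih]; rfl
  have e₂ : ∀ n : ℕ, (List.replicate n (Sum.inr true : Bool ⊕ Bool)).flatMap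
      (Sum.elim (fun _ => [.inc ()]) fun _ => [.emit true] : _ → List (CounterCmd Unit Bool)) =
      List.replicate n (.emit true) := fun n => by
    induction n with
    | zero => rfl
    | succ n ih => rw [List.replicate_succ, List.flatMap_cons, ih]; rfl
  rw [e₁, e₂, execCmds_append, execCmds_append, execCmds_replicate_inc, execCmds_replicate_emit]
  simp [execCmds, CounterCmd.exec]

/-- The transducer which computes `predDigits`. -/
def predTransducer : CounterTransducer (Bool ⊕ Bool) Bool Unit Bool where
  init := true
  step b
    | .inl _ => (b, [.inc ()])
    | .inr d => (b && !d, [.emit (d ^^ b), .dec ()])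
  final _ := [.copy () false]

theorem run_predTransducer_inl (n m : ℕ) (l : List (Bool ⊕ Bool)) :
    predTransducer.run true (fun _ => m) (List.replicate n (.inl true) ++ l) =
      predTransducer.run true (fun _ => m + n) l := by
  induction n generalizing m with
  | zero => rfl
  | succ n ih =>
    rw [List.replicate_succ, List.cons_append, CounterTransducer.run]
    have : (execCmds (predTransducer.step true (.inl true)).2 fun _ => m).1 = fun _ => m + 1 := by
      funext i
      simp [predTransducer, execCmds, CounterCmd.exec]
    rw [this]
    refine (ih (m + 1)).trans ?_
    rw [add_assoc, add_comm 1]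

/-- The state is the borrow, and the counter holds the number of digits still to be written; what is
left of it at the end becomes the padding. -/
theorem run_predTransducer_inr (b : Bool) (n : ℕ) (l : List Bool) :
    predTransducer.run b (fun _ => n) (l.map .inr) =
      subBit b l ++ List.replicate (n - l.length) false := by
  induction l generalizing b n with
  | nil => simp [CounterTransducer.run, predTransducer, execCmds, CounterCmd.exec, subBit]
  | cons d l ih =>
    rw [List.map_cons, CounterTransducer.run]
    have : (execCmds (predTransducer.step b (.inr d)).2 fun _ => n).1 = fun _ => n - 1 := by
      funext i
      simp [predTransducer, execCmds, CounterCmd.exec]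
    rw [this]
    have e : n - 1 - l.length = n - (l.length + 1) := by omega
    rw [show (predTransducer.step b (.inr d)).1 = (b && !d) from rfl, ih, e]
    rfl

theorem PolyTime.predDigits (h : PolyTime ea fun x => unaryEncodeNat (k x)) {a : X → ℕ}
    (h' : PolyTime ea fun x => encodeNat (a x)) :
    PolyTime ea fun x => predDigits (k x) (a x) := by
  refine (h.pair h').transducer predTransducer fun x => ?_
  rw [CounterTransducer.output, unaryEncodeNat_eq, List.map_replicate]
  refine (run_predTransducer_inl (k x) 0 _).trans ?_
  rw [run_predTransducer_inr, Nat.zero_add]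
  rfl

end

end QuantumIP

/-! ### Writing the description of the extended verifier in one pass. -/

namespace QuantumIP

set_option linter.unusedSectionVars false

/-! ### The description of the extended verifier -/

/-- The counters used to write the description of the extended verifier: they hold the number of
random bits and comparison results, the number of private qubits, the position of the current
random bit, the output qubit, and the number of message qubits. -/
inductive DescriptionCounter where
  | extra
  | priv
  | pos
  | out
  | msg
  deriving DecidableEq

instance : Fintype DescriptionCounter :=
  ⟨{.extra, .priv, .pos, .out, .msg}, by rintro (_ | _ | _ | _ | _) <;> simp⟩

/-- The parts of a description. -/
inductive DescriptionPart where
  | start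
  | priv
  | msg
  | out
  | circuits
  deriving DecidableEq

instance : Fintype DescriptionPart :=
  ⟨{.start, .priv, .msg, .out, .circuits}, by rintro (_ | _ | _ | _ | _) <;> simp⟩

section
variable {G : GateSet} (T : TestKit G)

/-- The commands of the transducer which describes the extended verifier. -/
abbrev DescriptionCmd (G : GateSet) : Type := CounterCmd DescriptionCounter (Token G)

/-- The commands which describe a qubit of the final test. -/
def slotCmds {A m : ℕ} : Slot A m → List (DescriptionCmd G)
  | .out => [.emit .priv, .copy .priv .one]
  | .orig => [.emit .priv, .copy .out .one]
  | .flag => [.emit .msg, .copy .msg .one]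
  | .anc j => [.emit .priv, .copy .priv .one] ++ List.replicate (1 + j) (.emit .one)
  | .coin i => [.emit .priv, .copy .pos .one] ++ List.replicate (1 + A + 2 * i) (.emit .one)
  | .bit i => [.emit .priv, .copy .pos .one] ++ List.replicate (1 + A + 2 * i + 1) (.emit .one)

/-- The commands which describe a gate of the final test. -/
def gateCmds {A m : ℕ} (a : GateApp G (Slot A m)) : List (DescriptionCmd G) :=
  .emit (.gate a.name) :: (List.ofFn a.wires).flatMap slotCmds

/-- The transducer which describes the extended verifier. It reads the digits of the threshold, the
description of the verifier, and again the digits of the threshold. -/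
def descriptionTransducer :
    CounterTransducer ((Bool ⊕ Token G) ⊕ Bool) (Token G) DescriptionCounter DescriptionPart where
  init := .start
  step
    -- Every digit brings two new private qubits, a coin and a comparison bit.
    | s, .inl (.inl _) => (s, [.inc .extra, .inc .extra])
    | .start, .inl (.inr _) => (.priv, [.emit .priv])
    | .priv, .inl (.inr .one) => (.priv, [.emit .one, .inc .priv, .inc .pos])
    | .priv, .inl (.inr _) =>
      -- The 3 counts the new output qubit together with coin 0 and bit 0.
      (.msg, .copy .extra .one :: List.replicate (T.anc + 3) (.emit .one) ++ [.emit .msg])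
    | .msg, .inl (.inr .one) => (.msg, [.emit .one, .inc .msg])
    -- The additional `one` is the flag; the index of the new output qubit is the old number of
    -- private qubits.
    | .msg, .inl (.inr _) => (.out, [.emit .one, .emit .priv, .copy .priv .one])
    | .out, .inl (.inr .one) => (.out, [.inc .out])
    | .out, .inl (.inr t) => (.circuits, [.emit t])
    | .circuits, .inl (.inr t) => (.circuits, [.emit t])
    | s, .inr b => (s, (stepCircuit T b).flatMap gateCmds ++ [.inc .pos, .inc .pos])
  final _ := (acceptCircuit T).flatMap gateCmds

section
variable {v q A m K : ℕ} (o : Fin v) (i : ℕ) (h : i + m ≤ K) {c : DescriptionCounter → ℕ}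

/-- Coins and bits alternate behind the ancillas, so shifting them by `i` adds `2 * i` to the index.
The counter `pos` contains this amount, which lets a constant list of commands describe the gates at
every position. -/
theorem execCmds_slotCmds (hv : c .priv = v) (hp : c .pos = v + 2 * i) (ho : c .out = o)
    (hq : c .msg = q) (s : Slot A m) :
    execCmds (slotCmds s : List (DescriptionCmd G)) c =
      (c, encodeQubit (testQubit q A K o (Slot.shift i h s))) := by
  have e : ∀ (j : DescriptionCounter) (n : ℕ), execCmds
      ([.emit .priv, .copy j .one] ++ List.replicate n (.emit .one) : List (DescriptionCmd G)) c =
      (c, Token.priv :: encodeUnary (c j + n)) := by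
    intro j n
    rw [execCmds_append, encodeUnary, List.replicate_add]
    simp [execCmds, CounterCmd.exec, execCmds_replicate_emit]
  cases s with
  | out =>
    have := e .priv 0
    rw [List.replicate_zero, List.append_nil] at this
    rw [slotCmds, this, hv]
    rfl
  | orig =>
    have := e .out 0
    rw [List.replicate_zero, List.append_nil] at this
    rw [slotCmds, this, ho]
    rfl
  | flag =>
    simp only [slotCmds, execCmds, CounterCmd.exec, hq, List.append_nil]
    rfl
  | anc j =>
    rw [slotCmds, e, hv]
    rfl
  | coin j =>
    rw [slotCmds, e, hp, show v + 2 * i + (1 + A + 2 * (j : ℕ)) = v + (1 + A + 2 * (i + j)) by ring]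
    rfl
  | bit j =>
    rw [slotCmds, e, hp,
      show v + 2 * i + (1 + A + 2 * (j : ℕ) + 1) = v + (1 + A + 2 * (i + j) + 1) by ring]
    rfl

theorem execCmds_gateCmds (hv : c .priv = v) (hp : c .pos = v + 2 * i) (ho : c .out = o)
    (hq : c .msg = q) (C : Circuit G (Slot A m)) :
    execCmds (C.flatMap gateCmds) c =
      (c, ((C.map (GateApp.relabel (Slot.shift i h))).map
        (GateApp.relabel (testQubit q A K o))).flatMap encodeGateApp) := by
  rw [relabel_relabel, List.flatMap_map]
  refine execCmds_flatMap_of_const fun a _ => ?_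
  have e : execCmds ((List.ofFn a.wires).flatMap slotCmds : List (DescriptionCmd G)) c =
      (c, (List.ofFn a.wires).flatMap fun s =>
        encodeQubit (testQubit q A K o (Slot.shift i h s))) :=
    execCmds_flatMap_of_const fun s _ => execCmds_slotCmds o i h hv hp ho hq s
  have e' : List.ofFn ((testQubit q A K o ∘ Slot.shift i h) ∘ a.wires) =
      (List.ofFn a.wires).map (testQubit q A K o ∘ Slot.shift i h) := List.map_ofFn.symm
  rw [gateCmds, execCmds, CounterCmd.exec, e, encodeGateApp]
  change _ = (c, Token.gate a.name ::
    (List.ofFn ((testQubit q A K o ∘ Slot.shift i h) ∘ a.wires)).flatMap encodeQubit)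
  rw [e', List.flatMap_map]
  rfl

/-- The circuits of the test kit do not depend on the input; from digit to digit only the choice by
the digit and the counter `pos` vary. -/
theorem run_testCircuit (l : List Bool) (hl : i + l.length = K) (s : DescriptionPart)
    (hv : c .priv = v) (hp : c .pos = v + 2 * i) (ho : c .out = o) (hq : c .msg = q) :
    (descriptionTransducer T).run s c (l.map .inr) =
      ((testCircuit T l i hl).map (GateApp.relabel (testQubit q T.anc K o))).flatMap
        encodeGateApp := by
  induction l generalizing i c s with
  | nil =>
    exact congrArg Prod.snd (execCmds_gateCmds o i (by simpa using hl.le) hv hp ho hq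
      (acceptCircuit T))
  | cons a l ih =>
    have hK : i + 1 ≤ K := by simp only [List.length_cons] at hl; omega
    have e : execCmds ((descriptionTransducer T).step s (.inr a)).2 c =
        (Function.update c .pos (v + 2 * (i + 1)),
          (((stepCircuit T a).map (GateApp.relabel (Slot.shift i hK))).map
            (GateApp.relabel (testQubit q T.anc K o))).flatMap encodeGateApp) := by
      have : ((descriptionTransducer T).step s (.inr a)).2 =
          (stepCircuit T a).flatMap gateCmds ++ [.inc .pos, .inc .pos] := by cases s <;> rfl
      rw [this, execCmds_append, execCmds_gateCmds o i hK hv hp ho hq]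
      simp [execCmds, CounterCmd.exec, hp, mul_add, add_assoc]
    rw [List.map_cons, CounterTransducer.run, e, testCircuit, List.map_append,
      List.flatMap_append, ih (i + 1)]
    · simpa using hv
    · simp
    · simpa using ho
    · simpa using hq

end

/-- The values of the counters. -/
def counterValues (e v p o q : ℕ) : DescriptionCounter → ℕ
  | .extra => e
  | .priv => v
  | .pos => p
  | .out => o
  | .msg => q

theorem run_digits (l : List Bool) (r : List ((Bool ⊕ Token G) ⊕ Bool)) (e v p o q : ℕ) :
    (descriptionTransducer T).run .start (counterValues e v p o q)
        ((l.map .inl).map .inl ++ r) =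
      (descriptionTransducer T).run .start (counterValues (e + 2 * l.length) v p o q) r := by
  induction l generalizing e with
  | nil => rfl
  | cons b l ih =>
    have : Function.update (Function.update (counterValues e v p o q) .extra (e + 1)) .extra
        (e + 1 + 1) = counterValues (e + 2) v p o q := by
      funext j
      cases j <;> rfl
    rw [List.length_cons, show e + 2 * (l.length + 1) = e + 2 + 2 * l.length by ring, ← ih, ← this]
    rfl

theorem run_privateQubits (n : ℕ) (r : List ((Bool ⊕ Token G) ⊕ Bool)) (e v p o q : ℕ) :
    (descriptionTransducer T).run .priv (counterValues e v p o q)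
        (((encodeUnary n).map .inr).map .inl ++ r) =
      encodeUnary n ++ (descriptionTransducer T).run .priv (counterValues e (v + n) (p + n) o q) r := by
  induction n generalizing v p with
  | zero => rfl
  | succ n ih =>
    have : Function.update (Function.update (counterValues e v p o q) .priv (v + 1)) .pos (p + 1) =
        counterValues e (v + 1) (p + 1) o q := by
      funext j
      cases j <;> rfl
    rw [add_comm n 1, ← add_assoc, ← add_assoc, encodeUnary, List.replicate_add, List.append_assoc,
      ← encodeUnary, ← encodeUnary, ← ih, ← this]
    rfl

theorem run_messageQubits (n : ℕ) (r : List ((Bool ⊕ Token G) ⊕ Bool)) (e v p o q : ℕ) :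
    (descriptionTransducer T).run .msg (counterValues e v p o q)
        (((encodeUnary n).map .inr).map .inl ++ r) =
      encodeUnary n ++ (descriptionTransducer T).run .msg (counterValues e v p o (q + n)) r := by
  induction n generalizing q with
  | zero => rfl
  | succ n ih =>
    have : Function.update (counterValues e v p o q) .msg (q + 1) =
        counterValues e v p o (q + 1) := by
      funext j
      cases j <;> rfl
    rw [add_comm n 1, ← add_assoc, encodeUnary, List.replicate_add, List.append_assoc,
      ← encodeUnary, ← encodeUnary, ← ih, ← this]
    rfl

theorem run_output (n : ℕ) (r : List ((Bool ⊕ Token G) ⊕ Bool)) (e v p o q : ℕ) :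
    (descriptionTransducer T).run .out (counterValues e v p o q)
        (((encodeUnary n).map .inr).map .inl ++ r) =
      (descriptionTransducer T).run .out (counterValues e v p (o + n) q) r := by
  induction n generalizing o with
  | zero => rfl
  | succ n ih =>
    have : Function.update (counterValues e v p o q) .out (o + 1) =
        counterValues e v p (o + 1) q := by
      funext j
      cases j <;> rfl
    rw [add_comm n 1, ← add_assoc, encodeUnary, List.replicate_add, ← encodeUnary, ← encodeUnary,
      ← ih, ← this]
    rfl

theorem run_circuits (l : List (Token G)) (r : List ((Bool ⊕ Token G) ⊕ Bool))
    (c : DescriptionCounter → ℕ) :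
    (descriptionTransducer T).run .circuits c ((l.map .inr).map .inl ++ r) =
      l ++ (descriptionTransducer T).run .circuits c r := by
  induction l with
  | nil => rfl
  | cons t l ih =>
    rw [List.cons_append, ← ih]
    rfl

/-- Qubits are named by their index within a register, and both registers are enlarged at the end.
The old circuits can therefore be copied verbatim. -/
theorem encodeCircuit_map_oldQubit {v q : ℕ} (E : ℕ) (C : Circuit G (VerifierQubits v q)) :
    encodeCircuit (C.map (GateApp.relabel (oldQubit v q E))) = encodeCircuit C := by
  have h₁ : (encodeQubit ∘ oldQubit v q E : _ → List (Token G)) = encodeQubit := by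
    funext i
    cases i <;> rfl
  rw [encodeCircuit, encodeCircuit, List.flatMap_map]
  congr 2
  funext a
  have e : List.ofFn (oldQubit v q E ∘ a.wires) = (List.ofFn a.wires).map (oldQubit v q E) :=
    List.map_ofFn.symm
  change Token.gate a.name :: (List.ofFn (oldQubit v q E ∘ a.wires)).flatMap encodeQubit = _
  rw [e, List.flatMap_map]
  change Token.gate a.name ::
    (List.ofFn a.wires).flatMap (encodeQubit ∘ oldQubit v q E : _ → List (Token G)) = _
  rw [h₁]
  rfl

theorem encodeDescription_extendVerifier (D : VerifierDescription G) (hD : D.circuits ≠ [])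
    (w : List Bool) : encodeDescription (extendVerifier T D w) =
      Token.priv :: (encodeUnary D.privateQubits ++ (encodeUnary (2 * w.length) ++
        (encodeUnary (T.anc + 3) ++ (Token.msg :: (encodeUnary D.messageQubits ++
          Token.one :: Token.priv :: (encodeUnary D.privateQubits ++
            (D.circuits.flatMap encodeCircuit ++
              ((testCircuit T w 0 (Nat.zero_add _)).map (GateApp.relabel
                (testQubit D.messageQubits T.anc w.length D.output))).flatMap
                  encodeGateApp))))))) := by
  have h₁ : (D.circuits.map (List.map (GateApp.relabel (oldQubit D.privateQubits D.messageQubits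
      (extraQubits T.anc w.length))))).flatMap encodeCircuit = D.circuits.flatMap encodeCircuit := by
    rw [List.flatMap_map]
    congr 1
    funext C
    exact encodeCircuit_map_oldQubit _ C
  have h₂ : (encodeUnary (D.privateQubits + extraQubits T.anc w.length) : List (Token G)) =
      encodeUnary D.privateQubits ++ (encodeUnary (2 * w.length) ++ encodeUnary (T.anc + 3)) := by
    rw [encodeUnary, encodeUnary, encodeUnary, encodeUnary, ← List.replicate_add,
      ← List.replicate_add, extraQubits]
    congr 1
    ring
  have h₃ : (encodeUnary (D.messageQubits + 1) : List (Token G)) =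
      encodeUnary D.messageQubits ++ [Token.one] := List.replicate_succ'
  rw [encodeDescription, flatMap_appendLast _ _ (by simpa using hD), h₁, h₂, h₃]
  simp only [List.append_assoc, List.cons_append, List.nil_append, Fin.val_natAdd, Nat.add_zero]

/-- The digits come twice: in front, since the number of qubits has to be written before the
circuits, and at the back, since the test is the end of the last circuit. -/
theorem output_descriptionTransducer (D : VerifierDescription G) (hD : D.circuits ≠ [])
    (w : List Bool) :
    (descriptionTransducer T).output
      ((w.map Sum.inl ++ (encodeDescription D).map Sum.inr).map Sum.inl ++ w.map Sum.inr) =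
    encodeDescription (extendVerifier T D w) := by
  -- The opening token of the first circuit is what ends the unary index of the output qubit.
  obtain ⟨C, L, hL⟩ := List.exists_cons_of_ne_nil hD
  have e₀ : (0 : DescriptionCounter → ℕ) = counterValues 0 0 0 0 0 := by
    funext j
    cases j <;> rfl
  have h₁ : ∀ c r, (descriptionTransducer T).run .start c (.inl (.inr .priv) :: r) =
      Token.priv :: (descriptionTransducer T).run .priv c r := fun _ _ => rfl
  have h₂ : ∀ c r, (descriptionTransducer T).run .priv c (.inl (.inr .msg) :: r) =
      encodeUnary (c .extra) ++ (encodeUnary (T.anc + 3) ++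
        Token.msg :: (descriptionTransducer T).run .msg c r) := by
    intro c r
    have : execCmds ((descriptionTransducer T).step .priv (.inl (.inr .msg))).2 c =
        (c, encodeUnary (c .extra) ++ (encodeUnary (T.anc + 3) ++ [Token.msg])) := by
      change execCmds (.copy .extra .one :: (List.replicate (T.anc + 3) (.emit .one) ++
        [.emit .msg]) : List (DescriptionCmd G)) c = _
      rw [execCmds, execCmds_append, CounterCmd.exec, execCmds_replicate_emit]
      rfl
    rw [CounterTransducer.run, this]
    simp only [List.append_assoc, List.cons_append, List.nil_append]
    rfl
  have h₃ : ∀ c r, (descriptionTransducer T).run .msg c (.inl (.inr .priv) :: r) =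
      Token.one :: Token.priv :: (encodeUnary (c .priv) ++
        (descriptionTransducer T).run .out c r) := by
    intro c r
    rw [CounterTransducer.run]
    simp only [descriptionTransducer, execCmds, CounterCmd.exec, List.append_nil,
      List.cons_append, List.nil_append]
    rfl
  have h₄ : ∀ c r, (descriptionTransducer T).run .out c (.inl (.inr .circuit) :: r) =
      Token.circuit :: (descriptionTransducer T).run .circuits c r := fun _ _ => rfl
  rw [encodeDescription_extendVerifier T D hD, encodeDescription, CounterTransducer.output, e₀,
    hL, List.flatMap_cons, encodeCircuit]
  simp only [List.map_append, List.map_cons, List.append_assoc, List.cons_append]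
  change (descriptionTransducer T).run .start _ _ = _
  rw [run_digits, h₁, run_privateQubits, h₂, run_messageQubits, h₃, run_output, h₄, run_circuits,
    run_circuits, run_testCircuit T D.output 0 w (Nat.zero_add _) (q := D.messageQubits) .circuits]
  all_goals simp [counterValues]

end

end QuantumIP

/-! ### The new verifier and the conclusion. -/

namespace QuantumIP

set_option linter.unusedSectionVars false

open Computability

/-! ### The new verifier -/

section
variable {G : GateSet} {m : ℕ → ℕ}

instance : Inhabited (Token G) := ⟨.one⟩

theorem Verifier.circuits_ne_nil (V : Verifier G m) (x : List Bool) :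
    (V.describe x).circuits ≠ [] := by
  intro h
  have := V.length_circuits x
  rw [h] at this
  simp at this

/-- The verifier which performs the final test after the given one. -/
def Verifier.extend (V : Verifier G m) (T : TestKit G) {w : List Bool → List Bool}
    (hw : PolyTime (id : List Bool → List Bool) w) : Verifier G m where
  describe x := extendVerifier T (V.describe x) (w x)
  polyTime := by
    refine computable_of_polyTime (((hw.pair (polyTime_of_computable V.polyTime)).pair hw).transducer
      (descriptionTransducer T) fun x => ?_)
    exact output_descriptionTransducer T _ (V.circuits_ne_nil x) _
  length_circuits x := by
    rw [length_appendLast, List.length_map, V.length_circuits]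

theorem polyTime_predDigits {p : ℕ → ℕ} (hp : PolynomiallyBounded p) {a : ℕ × ℕ → ℕ}
    (ha : Nonempty (Turing.TM2ComputableInPolyTime unaryPair encodeNat a)) :
    PolyTime (id : List Bool → List Bool) fun x =>
      predDigits (p x.length + 3) (a (x.length, p x.length + 2)) := by
  have hid : PolyTime (id : List Bool → List Bool) fun x => x := by
    refine PolyTime.congr (polyTime_transducer (simpleTransducer (J := Empty)
      (fun b : Bool => [.emit b]) [])) fun x => ?_
    rw [output_simpleTransducer, List.append_nil,
      execCmds_flatMap_of_const (g := fun b => [b]) fun _ _ => rfl]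
    exact List.flatMap_singleton' x
  have hlen : PolyTime (id : List Bool → List Bool) fun x => unaryEncodeNat x.length :=
    hid.length_add 0
  have hp' : PolyTime (id : List Bool → List Bool) fun x => unaryEncodeNat (p x.length) :=
    hlen.comp (polyTime_of_computable hp.2) (fun x => x.length) fun _ => rfl
  have hk : PolyTime (id : List Bool → List Bool) fun x => unaryEncodeNat (p x.length + 3) :=
    PolyTime.congr (hp'.length_add 3) fun x => by rw [unaryEncodeNat_eq (p x.length), List.length_replicate]
  exact hk.predDigits ((hk.unaryPair hlen).comp (polyTime_of_computable ha)
    (fun x => (x.length, p x.length + 2)) fun _ => rfl)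

end

end QuantumIP

theorem mainTheorem8 (G : GateSet) (hG : Admissible G)
    (m : ℕ → ℕ) (hm : PolynomiallyBounded m)
    (c s : ℕ → ℝ)
    (hc01 : ∀ n, c n ∈ Set.Icc (0 : ℝ) 1) (hs01 : ∀ n, s n ∈ Set.Icc (0 : ℝ) 1)
    (hc : PolyTimeComputableReal c) (hs : PolyTimeComputableReal s)
    (p : ℕ → ℕ) (hp : PolynomiallyBounded p)
    (hgap : ∀ n, 1 / (p n : ℝ) ≤ c n - s n)
    (A : PromiseProblem) (hA : A ∈ QIP G m c s) :
    HasPerfectlyRewindableProofSystem G m (fun n => 1 / 2 - (c n - s n) / 4) A := by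
  obtain ⟨V, hV⟩ := hA
  obtain ⟨T⟩ := hG.nonempty_testKit
  obtain ⟨a, ha, hac⟩ := hc
  -- Precision `p + 2` for the approximation of `c`, and one digit more for the threshold, because
  -- the last coin serves as the choice between the two tests.
  let w : List Bool → List Bool := fun x =>
    predDigits (p x.length + 3) (a (x.length, p x.length + 2))
  have hlen : ∀ x, (w x).length = p x.length + 2 + 1 := fun x =>
    length_predDigits (lt_two_pow_of_abs_sub_le (hc01 x.length) (by omega) (hac _ _))
  have hw : ∀ x, w x ≠ [] := fun x h => by
    have := hlen x
    rw [h] at this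
    simp at this
  have hbias : ∀ x, 1 - c x.length ≤ testBias (w x) ∧
      testBias (w x) ≤ 1 - c x.length + 2 / 2 ^ (p x.length + 2) := fun x =>
    testBias_bounds (hc01 x.length) (hlen x) (bitsValue_predDigits _ _) (hac _ _)
  refine ⟨fun n => ?_, V.extend T (polyTime_predDigits hp ha), fun x => ⟨fun hx => ?_, fun hx => ?_⟩⟩
  · have h₁ := (hc01 n).1
    have h₂ := (hc01 n).2
    have h₃ := (hs01 n).1
    have h₄ : (0 : ℝ) < 1 / p n := one_div_pos.mpr (by exact_mod_cast hp.1 n)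
    have h₅ := hgap n
    constructor <;> linarith
  · exact exists_isGreatest_acceptProb T (V.describe x) (hw x) (hm.1 _) (V.length_circuits x)
      (hbias x).1 ((hV x).1 hx)
  · exact fun P ρ hρ => (acceptProb_extendVerifier_le T (V.describe x) (hw x) (hm.1 _)
      (V.length_circuits x) ((hV x).2 hx) P ρ hρ).trans
        (soundness_bound (hp.1 _) (hgap _) (hbias x).2)
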